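/- Setting. Let $d\in\{2,3\}$, $\Omega\subset\mathbb R^d$ a bounded Lipschitz domain, $\Gamma_D,\Gamma_R\subseteq\partial\Omega$ measurable, $0<\varepsilon<1$, $k>0$, and $A:\Omega\to\{\varepsilon^2,1\}$ measurable. Let $V=\{u\in H^1(\Omega;\mathbb C):u=0\text{ on }\Gamma_D\}$ and $$\mathcal B(u,v)=\int_\Omega A\nabla u\cdot\nabla\bar v\,dx-\mathrm ik\int_{\Gamma_R}u\bar v\,ds-k^2\int_\Omega u\bar v\,dx .$$ Let $\mathcal T_H=\{K_1,\dots,K_N\}$ be a conforming mesh of $\Omega$ by nondegenerate quadrilaterals (hexahedra if $d=3$; images of $[0,1]^d$ under $d$-linear maps) of diameter at most $H$. On $K_j$ put $\tilde A=A\sum_{\sigma}|\nabla\eta_{j,\sigma}|^2$, where the $\eta_{j,\sigma}$ are the $2^d$ Lagrange basis functions of $K_j$, and assume, with a constant $c_*>0$, $$c_*^{-1}H^{-2}\min(1,\varepsilon^2)\le\tilde A\le c_*H^{-2}\max(1,\varepsilon^2),\qquad \sqrt{2c_*}\,kH\varepsilon^{-1}\le 1 .$$ Write $\|v\|_a^2=\int_\Omega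 A|\nabla v|^2$, $s(u,v)=\int_\Omega\tilde A u\bar v$, $\|v\|_s^2=s(v,v)$, and $a_j,s_j$ for the integrals of $A\nabla u\cdot\nabla\bar v$ and $\tilde A u\bar v$ over $K_j$. For each $j$ let $\lambda_j^1\le\lambda_j^2\le\cdots$ be the eigenvalues, listed with multiplicity, of $a_j(\phi,v)=\lambda s_j(\phi,v)$ for all $v\in H^1(K_j)$ (so $\lambda_j^1=0$), with $s_j$-orthogonal eigenfunctions $\phi_j^1,\phi_j^2,\dots\in H^1(K_j)$. Fix $l_j\ge0$, let $\pi_j$ be the $s_j$-orthogonal projection onto $\mathrm{span}\{\phi_j^1,\dots,\phi_j^{l_j}\}$, extended by zero outside $K_j$, and $\pi=\sum_j\pi_j$. Let $\Lambda>\frac12$ with $\Lambda\le\lambda_j^{l_j+1}$ for all $j$. Let $K_j^0=K_j$, and let $K_j^{m+1}$ be the interior of the union of $\overline{K_j^m}$ and of all closed elements meeting it. Assume that $\mathrm{card}\{K\in\mathcal T_H:K\subset K_j^m\}\le C_{\mathrm{ol}}m^d$ for all $j$ and $m\ge1$. Let $V_0(K_j^m)$ be the set of $v\in V$ that vanish outside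 $K_j^m$. For $t\in L^2(\Omega)$ let $T_jt\in V$ and $T_{j,m}t\in V_0(K_j^m)$ be defined by $$\mathcal B(T_jt,v)+s(\pi T_jt,\pi v)=s(\pi_jt,\pi v)\quad\forall v\in V,$$ $$\mathcal B(T_{j,m}t,v)+s(\pi T_{j,m}t,\pi v)=s(\pi_jt,\pi v)\quad\forall v\in V_0(K_j^m),$$ and let $T=\sum_jT_j$. Statement (global localization error). For every $d\in\{2,3\}$ and $\Lambda>\frac12$ there are constants $C=C(\Lambda)>0$ and $0<\beta<1$, depending on $d$ and $\Lambda$ only (in particular not on $H$, $m$, $k$), such that in every setting as above, for all $m\ge1$: the problems that define $T_jt$ and $T_{j,m}t$ have exactly one solution for all $j$ and $t\in L^2(\Omega)$, and for all $t_1,\dots,t_N\in L^2(\Omega)$ the function $z=\sum_{j=1}^N(T_j-T_{j,m})t_j$ satisfies $$\|z\|_a^2+\|\pi z\|_s^2\le C(\Lambda)^2\,C_{\mathrm{ol}}\,\beta^m(m+1)^d\;\mathrm{Re}\sum_{j=1}^N s(\pi_jt_j,\pi T_jt_j).$$ In particular, if $\pi t_j=\pi_jt_j$ for every $j$, then $$\|z\|_a^2+\|\pi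 z\|_s^2\le C(\Lambda)^2\,C_{\mathrm{ol}}\,\beta^m(m+1)^d\;\mathrm{Re}\sum_{j=1}^N s(\pi t_j,\pi Tt_j).$$ -/

import Mathlib

open MeasureTheory Set
open scoped ENNReal ContDiff

noncomputable section

namespace CEM

/-- The space `ℝ^d` with its Euclidean norm. -/
abbrev E (d : ℕ) := EuclideanSpace ℝ (Fin d)

/-- Complex vectors, the values of gradients of complex functions. -/
abbrev CVec (d : ℕ) := EuclideanSpace ℂ (Fin d)

/-- The `(d-1)`-dimensional surface measure on `ℝ^d`. -/
def surf (d : ℕ) : Measure (E d) := Measure.euclideanHausdorffMeasure (d - 1)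

/-- A bounded nonempty open set whose boundary is locally the graph of a Lipschitz function,
with the set on one side of it: near each boundary point there is a direction `e` in which
the set is the region strictly below the graph of `g` (a function of the component of the
point orthogonal to `e`). -/
structure IsLipschitzDomain {d : ℕ} (Ω : Set (E d)) : Prop where
  isOpen : IsOpen Ω
  bounded : Bornology.IsBounded Ω
  nonempty : Ω.Nonempty
  graph : ∀ x ∈ frontier Ω, ∃ (e : E d) (δ : ℝ) (L : NNReal) (g : E d → ℝ),
    ‖e‖ = 1 ∧ 0 < δ ∧ LipschitzWith L g ∧
    ∀ y ∈ Metric.ball x δ, y ∈ Ω ↔ inner ℝ e y < g (y - inner ℝ e y • e)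

/-! ### Sobolev spaces with traces -/

/-- The gradient of a (real-)differentiable complex function. -/
def cgrad {d : ℕ} (f : E d → ℂ) (x : E d) : CVec d :=
  WithLp.toLp 2 fun i => fderiv ℝ f x (EuclideanSpace.single i 1)

/-- Triples (function on `D`, vector field on `D`, function on the boundary piece `S`),
all square integrable. -/
abbrev Triple {d : ℕ} (D S : Set (E d)) :=
  Lp ℂ 2 (volume.restrict D) × Lp (CVec d) 2 (volume.restrict D) × Lp ℂ 2 ((surf d).restrict S)

/-- `(φ|_D, ∇φ|_D, φ|_S)` for smooth compactly supported `φ` on `ℝ^d`. -/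
def smoothTriples {d : ℕ} (D S : Set (E d)) : Submodule ℂ (Triple D S) where
  carrier := {U | ∃ φ : E d → ℂ, ContDiff ℝ ∞ φ ∧ HasCompactSupport φ ∧
    U.1 =ᵐ[volume.restrict D] φ ∧ U.2.1 =ᵐ[volume.restrict D] cgrad φ ∧
    U.2.2 =ᵐ[(surf d).restrict S] φ}
  zero_mem' := by
    refine ⟨0, contDiff_const, HasCompactSupport.zero, Lp.coeFn_zero _ _ _, ?_,
      Lp.coeFn_zero _ _ _⟩
    filter_upwards [Lp.coeFn_zero (CVec d) 2 (volume.restrict D)] with x hx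
    rw [Prod.snd_zero, Prod.fst_zero, hx]
    ext i
    simp [cgrad]
  add_mem' := by
    rintro U W ⟨φ, hφ, hφc, h1, h2, h3⟩ ⟨ψ, hψ, hψc, k1, k2, k3⟩
    refine ⟨φ + ψ, hφ.add hψ, hφc.add hψc, ?_, ?_, ?_⟩
    · filter_upwards [Lp.coeFn_add U.1 W.1, h1, k1] with x hx a b
      rw [Prod.fst_add, hx, Pi.add_apply, Pi.add_apply, a, b]
    · filter_upwards [Lp.coeFn_add U.2.1 W.2.1, h2, k2] with x hx a b
      rw [Prod.snd_add, Prod.fst_add, hx, Pi.add_apply, a, b]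
      ext i
      simp [cgrad, fderiv_add (hφ.differentiable (by simp) x) (hψ.differentiable (by simp) x)]
    · filter_upwards [Lp.coeFn_add U.2.2 W.2.2, h3, k3] with x hx a b
      rw [Prod.snd_add, Prod.snd_add, hx, Pi.add_apply, Pi.add_apply, a, b]
  smul_mem' := by
    rintro c U ⟨φ, hφ, hφc, h1, h2, h3⟩
    refine ⟨c • φ, hφ.const_smul c, hφc.smul_left (f := fun _ => c), ?_, ?_, ?_⟩
    · filter_upwards [Lp.coeFn_smul c U.1, h1] with x hx a
      rw [Prod.smul_fst, hx, Pi.smul_apply, Pi.smul_apply, a]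
    · filter_upwards [Lp.coeFn_smul c U.2.1, h2] with x hx a
      rw [Prod.smul_snd, Prod.smul_fst, hx, Pi.smul_apply, a]
      ext i
      simp [cgrad, fderiv_const_smul (hφ.differentiable (by simp) x) c]
    · filter_upwards [Lp.coeFn_smul c U.2.2, h3] with x hx a
      rw [Prod.smul_snd, Prod.smul_snd, hx, Pi.smul_apply, Pi.smul_apply, a]

/-- The Sobolev space `H¹(D)` of a Lipschitz domain `D`, an element `u` being recorded as the
triple `(u, ∇u, trace of u on S)` with `S ⊆ ∂D`: the closure in `L²(D) × L²(D)^d × L²(S)` of the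
smooth triples. On a Lipschitz domain the smooth functions on `ℝ^d` are dense in `H¹(D)` and
restriction to the boundary extends continuously to the trace operator, so this is the graph of
`u ↦ (∇u, u|_S)` on `H¹(D)`. With `S = ∅` it is `H¹(D)` itself, with the gradient recorded. -/
def H1 {d : ℕ} (D S : Set (E d)) : Submodule ℂ (Triple D S) :=
  (smoothTriples D S).topologicalClosure

/-! ### Quadrilateral (hexahedral) meshes -/

/-- The closed reference cube `[0,1]^d`. -/
def cube (d : ℕ) : Set (E d) := {x | ∀ i, x i ∈ Icc (0 : ℝ) 1}

/-- The open reference cube. -/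
def openCube (d : ℕ) : Set (E d) := {x | ∀ i, x i ∈ Ioo (0 : ℝ) 1}

/-- The `d`-linear nodal function of the vertex `σ` of the reference cube. -/
def shape {d : ℕ} (σ : Fin d → Bool) (x : E d) : ℝ := ∏ i, if σ i then x i else 1 - x i

/-- The `d`-linear map that sends the vertex `σ` of the reference cube to `P σ`. -/
def refMap {d : ℕ} (P : (Fin d → Bool) → E d) (x : E d) : E d := ∑ σ, shape σ x • P σ

/-- The closed and the open element with vertices `P`. -/
def closedElem {d : ℕ} (P : (Fin d → Bool) → E d) : Set (E d) := refMap P '' cube d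

def openElem {d : ℕ} (P : (Fin d → Bool) → E d) : Set (E d) := refMap P '' openCube d

/-- The Lagrange basis function of the vertex `P σ` on the element with vertices `P`. -/
def lagrange {d : ℕ} (P : (Fin d → Bool) → E d) (σ : Fin d → Bool) (x : E d) : ℝ :=
  shape σ (Function.invFunOn (refMap P) (cube d) x)

/-- A conforming quadrilateral mesh (hexahedral if `d = 3`) of `Ω` with nondegenerate elements.
Conformity is expressed through the nodal interpolant: for all nodal values `f` it is
single-valued where closed elements meet, i.e. the Lagrange space consists of continuous
functions. -/
structure QuadMesh (d : ℕ) (Ω : Set (E d)) where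
  N : ℕ
  vert : Fin N → (Fin d → Bool) → E d
  injOn : ∀ j, InjOn (refMap (vert j)) (cube d)
  nondegenerate : ∀ j, ∀ x ∈ cube d, (fderiv ℝ (refMap (vert j)) x).det ≠ 0
  elem_subset : ∀ j, openElem (vert j) ⊆ Ω
  disjoint : ∀ i j, i ≠ j → Disjoint (openElem (vert i)) (openElem (vert j))
  cover : closure Ω = ⋃ j, closedElem (vert j)
  conforming : ∀ i j, ∀ x ∈ closedElem (vert i) ∩ closedElem (vert j), ∀ f : E d → ℝ,
    ∑ σ, f (vert i σ) * lagrange (vert i) σ x = ∑ σ, f (vert j σ) * lagrange (vert j) σ x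

namespace QuadMesh

variable {d : ℕ} {Ω : Set (E d)} (M : QuadMesh d Ω)

/-- The (open) element `K_j`. -/
def K (j : Fin M.N) : Set (E d) := openElem (M.vert j)

/-- The oversampled domain `K_j^m`: `m` layers of elements are added to `K_j`. -/
def patch (j : Fin M.N) : ℕ → Set (E d)
  | 0 => M.K j
  | m + 1 => interior
      ((⋃ i ∈ {i : Fin M.N | (closure (patch j m) ∩ closure (M.K i)).Nonempty}, closure (M.K i))
        ∪ closure (patch j m))

end QuadMesh

/-! ### The Helmholtz problem -/

/-- Domain, boundary pieces, coefficient and wave number. The impedance form is integrated over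
`ΓR`; the choice `ΓR = frontier Ω` is allowed. -/
structure Helmholtz (d : ℕ) where
  Ω : Set (E d)
  ΓD : Set (E d)
  ΓR : Set (E d)
  ε : ℝ
  k : ℝ
  A : E d → ℝ
  lipschitz : IsLipschitzDomain Ω
  ΓD_subset : ΓD ⊆ frontier Ω
  ΓR_subset : ΓR ⊆ frontier Ω
  ΓD_measurable : MeasurableSet ΓD
  ΓR_measurable : MeasurableSet ΓR
  ε_pos : 0 < ε
  ε_lt_one : ε < 1
  k_pos : 0 < k
  A_measurable : Measurable A
  A_values : ∀ x ∈ Ω, A x = ε ^ 2 ∨ A x = 1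

namespace Helmholtz

variable {d : ℕ} (P : Helmholtz d)

/-- The boundary piece on which traces enter the problem. -/
abbrev Γ : Set (E d) := P.ΓD ∪ P.ΓR

/-- `V = {u ∈ H¹(Ω) : u = 0 on ΓD}`. -/
def V : Submodule ℂ (Triple P.Ω P.Γ) where
  carrier := {U | U ∈ H1 P.Ω P.Γ ∧ ∀ᵐ x ∂((surf d).restrict P.Γ), x ∈ P.ΓD → U.2.2 x = 0}
  zero_mem' := by
    refine ⟨Submodule.zero_mem _, ?_⟩
    filter_upwards [Lp.coeFn_zero ℂ 2 ((surf d).restrict P.Γ)] with x hx _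
    rw [Prod.snd_zero, Prod.snd_zero, hx, Pi.zero_apply]
  add_mem' := by
    rintro U W ⟨hU, hU'⟩ ⟨hW, hW'⟩
    refine ⟨Submodule.add_mem _ hU hW, ?_⟩
    filter_upwards [Lp.coeFn_add U.2.2 W.2.2, hU', hW'] with x hx a b h
    rw [Prod.snd_add, Prod.snd_add, hx, Pi.add_apply, a h, b h, add_zero]
  smul_mem' := by
    rintro c U ⟨hU, hU'⟩
    refine ⟨Submodule.smul_mem _ c hU, ?_⟩
    filter_upwards [Lp.coeFn_smul c U.2.2, hU'] with x hx a h
    rw [Prod.smul_snd, Prod.smul_snd, hx, Pi.smul_apply, a h, smul_zero]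

/-- The functions of `V` that vanish outside `D`, i.e. the extensions by zero of the functions on
`D` with zero trace on `ΓD` and on the part of `∂D` inside `Ω`. -/
def V0 (D : Set (E d)) : Submodule ℂ (Triple P.Ω P.Γ) where
  carrier := {U | U ∈ P.V ∧
    (∀ᵐ x ∂(volume.restrict P.Ω), x ∉ closure D → U.1 x = 0 ∧ U.2.1 x = 0) ∧
    ∀ᵐ x ∂((surf d).restrict P.Γ), x ∉ closure D → U.2.2 x = 0}
  zero_mem' := by
    refine ⟨Submodule.zero_mem _, ?_, ?_⟩
    · filter_upwards [Lp.coeFn_zero ℂ 2 (volume.restrict P.Ω),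
        Lp.coeFn_zero (CVec d) 2 (volume.restrict P.Ω)] with x hx hx' _
      rw [Prod.snd_zero, Prod.fst_zero, Prod.fst_zero, hx, hx']
      exact ⟨rfl, rfl⟩
    · filter_upwards [Lp.coeFn_zero ℂ 2 ((surf d).restrict P.Γ)] with x hx _
      rw [Prod.snd_zero, Prod.snd_zero, hx, Pi.zero_apply]
  add_mem' := by
    rintro U W ⟨hU, hU1, hU2⟩ ⟨hW, hW1, hW2⟩
    refine ⟨Submodule.add_mem _ hU hW, ?_, ?_⟩
    · filter_upwards [Lp.coeFn_add U.1 W.1, Lp.coeFn_add U.2.1 W.2.1, hU1, hW1]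
        with x hx hx' a b h
      rw [Prod.snd_add, Prod.fst_add, Prod.fst_add, hx, hx', Pi.add_apply, Pi.add_apply,
        (a h).1, (a h).2, (b h).1, (b h).2, add_zero, add_zero]
      exact ⟨rfl, rfl⟩
    · filter_upwards [Lp.coeFn_add U.2.2 W.2.2, hU2, hW2] with x hx a b h
      rw [Prod.snd_add, Prod.snd_add, hx, Pi.add_apply, a h, b h, add_zero]
  smul_mem' := by
    rintro c U ⟨hU, hU1, hU2⟩
    refine ⟨Submodule.smul_mem _ c hU, ?_, ?_⟩
    · filter_upwards [Lp.coeFn_smul c U.1, Lp.coeFn_smul c U.2.1, hU1] with x hx hx' a h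
      rw [Prod.smul_snd, Prod.smul_fst, Prod.smul_fst, hx, hx', Pi.smul_apply, Pi.smul_apply,
        (a h).1, (a h).2, smul_zero, smul_zero]
      exact ⟨rfl, rfl⟩
    · filter_upwards [Lp.coeFn_smul c U.2.2, hU2] with x hx a h
      rw [Prod.smul_snd, Prod.smul_snd, hx, Pi.smul_apply, a h, smul_zero]

/-- `a_D(u, v) = ∫_D A ∇u · conj ∇v` on triples over any set `D'` and boundary piece `S`. -/
def aForm (D : Set (E d)) {D' S : Set (E d)} (u v : Triple D' S) : ℂ :=
  ∫ x in D, (P.A x : ℂ) * inner ℂ (v.2.1 x) (u.2.1 x)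

/-- The sesquilinear form `𝓑(u, v) = (A∇u, ∇v) - i k (u, v)_{ΓR} - k² (u, v)`. -/
def B (u v : Triple P.Ω P.Γ) : ℂ :=
  P.aForm P.Ω u v
    - Complex.I * P.k * (∫ x in P.ΓR, u.2.2 x * (starRingEnd ℂ) (v.2.2 x) ∂(surf d))
    - (P.k : ℂ) ^ 2 * ∫ x in P.Ω, u.1 x * (starRingEnd ℂ) (v.1 x)

/-- The squared energy norm `‖u‖_a² = ∫_Ω A |∇u|²`. -/
def aNormSq (u : Triple P.Ω P.Γ) : ℝ := ∫ x in P.Ω, P.A x * ‖u.2.1 x‖ ^ 2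

variable (M : QuadMesh d P.Ω)

/-- The weight `Ã`, equal to `A ∑_σ |∇η_σ|²` on each element, where the `η_σ` are the Lagrange
basis functions of the element. -/
def wt (x : E d) : ℝ :=
  ∑ j, (M.K j).indicator
    (fun y => P.A y * ∑ σ, ‖gradient (lagrange (M.vert j) σ) y‖ ^ 2) x

/-- `s_D(f, g) = ∫_D Ã f conj g`. -/
def sForm (D : Set (E d)) (f g : E d → ℂ) : ℂ :=
  ∫ x in D, (P.wt M x : ℂ) * (f x * (starRingEnd ℂ) (g x))

/-- The squared norm `‖f‖_s² = ∫_Ω Ã |f|²`. -/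
def sNormSq (f : E d → ℂ) : ℝ := ∫ x in P.Ω, P.wt M x * ‖f x‖ ^ 2

/-- `w ∈ H¹(K_j)` satisfies `a_j(w, v) = μ s_j(w, v)` for all `v ∈ H¹(K_j)`. -/
def IsEigen (j : Fin M.N) (μ : ℝ) (w : Triple (M.K j) ∅) : Prop :=
  w ∈ H1 (M.K j) ∅ ∧
    ∀ v ∈ H1 (M.K j) ∅, P.aForm (M.K j) w v = (μ : ℂ) * P.sForm M (M.K j) w.1 v.1

/-- The auxiliary data: on each element `K_j` the eigenvalues `lam j 0 ≤ lam j 1 ≤ …`, listed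
with multiplicity, with `s_j`-orthogonal eigenfunctions `φ j i`, and the number `l j` of
eigenfunctions (the first `l j` ones) that span the local auxiliary space. The field `all` says
that the list is complete: no further eigenfunction is orthogonal to all those in the list. -/
structure Aux where
  l : Fin M.N → ℕ
  lam : Fin M.N → ℕ → ℝ
  φ : (j : Fin M.N) → ℕ → Triple (M.K j) ∅
  eigen : ∀ j i, P.IsEigen M j (lam j i) (φ j i)
  ne_zero : ∀ j i, φ j i ≠ 0
  mono : ∀ j, Monotone (lam j)
  orth : ∀ j i i', i ≠ i' → P.sForm M (M.K j) (φ j i).1 (φ j i').1 = 0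
  all : ∀ j (μ : ℝ) (w : Triple (M.K j) ∅), P.IsEigen M j μ w →
    (∀ i, P.sForm M (M.K j) w.1 (φ j i).1 = 0) → w = 0

variable {M} (X : P.Aux M)

/-- The local projection `π_j`, extended by zero outside `K_j`. -/
def projLoc (j : Fin M.N) (f : E d → ℂ) : E d → ℂ :=
  (M.K j).indicator fun x => ∑ i ∈ Finset.range (X.l j),
    P.sForm M (M.K j) f (X.φ j i).1 / P.sForm M (M.K j) (X.φ j i).1 (X.φ j i).1 * (X.φ j i).1 x

/-- The global projection `π = ∑_j π_j`. -/
def proj (f : E d → ℂ) : E d → ℂ := fun x => ∑ j, P.projLoc X j f x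

/-- `u` solves the corrector problem in the space `W` with data `π_j t`:
`𝓑(u, v) + s(π u, π v) = s(π_j t, π v)` for all `v ∈ W`. -/
def IsCorrector (W : Submodule ℂ (Triple P.Ω P.Γ)) (j : Fin M.N) (t : E d → ℂ)
    (u : Triple P.Ω P.Γ) : Prop :=
  u ∈ W ∧ ∀ v ∈ W, P.B u v + P.sForm M P.Ω (P.proj X u.1) (P.proj X v.1)
    = P.sForm M P.Ω (P.projLoc X j t) (P.proj X v.1)

open Classical in
/-- The solution of the corrector problem (`0` if there is none). -/
def corrector (W : Submodule ℂ (Triple P.Ω P.Γ)) (j : Fin M.N) (t : E d → ℂ) :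
    Triple P.Ω P.Γ :=
  if h : ∃ u, P.IsCorrector X W j t u then h.choose else 0

/-- The global operator `T_j`. -/
def T (j : Fin M.N) (t : E d → ℂ) : Triple P.Ω P.Γ := P.corrector X P.V j t

/-- The localized operator `T_{j,m}`. -/
def Tloc (j : Fin M.N) (m : ℕ) (t : E d → ℂ) : Triple P.Ω P.Γ :=
  P.corrector X (P.V0 (M.patch j m)) j t

/-- The sum `T = ∑_j T_j`. -/
def Tsum (t : E d → ℂ) : Triple P.Ω P.Γ := ∑ j, P.T X j t

end Helmholtz

end CEM

end

noncomputable section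

namespace CEM

/-! ### The reference cube and its nodal functions. -/

variable {d : ℕ}

/-! Coercivity is an elementwise matter. Resolution gives `2k² ≤ Ã`, so on `K_j` one has `k²‖u‖² ≤
½‖u‖_s² = ½‖πu‖_s² + ½‖u - πu‖_s²`, and the spectral gap bounds the last term by `‖u‖_a² / (2Λ)`.
Since `Λ > 1/2`, the stabilization `s(πu, πu)` and the gradient term together absorb the negative
mass term and a fixed fraction of both survives (`coerc_mul_en_le`). The impedance term contributes
`-ik‖u‖²` on `ΓR`: the real part does not see it, and multiplication by `1 + i` makes it appear with
a positive sign (`coerc_mul_energy_le`). Lax–Milgram then solves the problems on `V` and on each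
closed subspace of it.

Decay rests on two facts. The form is a sum of element contributions and a boundary integral, and
the data of `T_j` act on `v` only through `π_j v`. Further, if `g` is the nodal interpolant of an
indicator function, then `A|∇g|² ≤ 2^d Ã`; this is what the weight `Ã` is designed for, and it makes
multiplication by `g` stable on every single element with a constant depending on `d` only
(`en_cut_le`). Testing with `g u`, where `g` vanishes on `m` layers around `K_j`, bounds the energy
beyond the next layer by the energy inside that layer (`caccioppoli`). Hole filling turns this into
geometric decay (`far_le`), and Céa's argument with a cutoff of `T_j t` as competitor gives the
error of one corrector (`energy_sub_le`).

For the sum `z` of all errors, the `j`-th error is orthogonal to `(1 - g_j) z`, so only `g_j z` is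
left, which lives in `m + 1` layers around `K_j`. The relation "in the `m + 1` layers of" is
symmetric, hence Cauchy–Schwarz costs just the number of elements in such layers instead of `N`
(`energy_sum_le`).

The remaining work is analysis. As `H¹` is a closure of smooth triples, Lipschitz cutoffs are shown
to preserve it by mollification (`cutOp_mem_H1`). The spectral gap is derived from the completeness
of the list of eigenpairs by minimizing the Rayleigh quotient (`rayleigh_bound`); the compactness
needed there is Rellich's theorem on an element, proved with Poincaré's inequality on small curved
cells (`isCompactOperator_embedL2`). -/

theorem contDiff_shape (σ : Fin d → Bool) : ContDiff ℝ ∞ (shape σ : E d → ℝ) := by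
  unfold shape
  refine contDiff_prod fun i _ => ?_
  split_ifs <;> fun_prop

theorem contDiff_refMap (P : (Fin d → Bool) → E d) : ContDiff ℝ ∞ (refMap P) := by
  unfold refMap
  exact ContDiff.sum fun σ _ => (contDiff_shape σ).smul contDiff_const

theorem sum_shape (x : E d) : ∑ σ, shape σ x = 1 := by
  have h : ∏ i : Fin d, ∑ b : Bool, (if b then x i else 1 - x i)
      = ∑ σ : Fin d → Bool, ∏ i, (if σ i then x i else 1 - x i) := by
    rw [Finset.prod_univ_sum, Fintype.piFinset_univ]
  rw [show (∑ σ, shape σ x) = ∑ σ : Fin d → Bool, ∏ i, (if σ i then x i else 1 - x i) from rfl,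
    ← h]
  simp

theorem shape_nonneg {x : E d} (hx : x ∈ cube d) (σ : Fin d → Bool) : 0 ≤ shape σ x := by
  refine Finset.prod_nonneg fun i _ => ?_
  have := hx i
  split_ifs
  · exact this.1
  · linarith [this.2]

theorem cube_eq_preimage :
    cube d = (EuclideanSpace.equiv (Fin d) ℝ) ⁻¹' Set.pi univ fun _ => Icc (0 : ℝ) 1 := by
  ext x; simp only [cube, mem_ofPred_eq, mem_preimage, mem_pi, mem_univ, true_implies]; rfl

theorem openCube_eq_preimage :
    openCube d = (EuclideanSpace.equiv (Fin d) ℝ) ⁻¹' Set.pi univ fun _ => Ioo (0 : ℝ) 1 := by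
  ext x; simp only [openCube, mem_ofPred_eq, mem_preimage, mem_pi, mem_univ, true_implies]; rfl

theorem isCompact_cube : IsCompact (cube d) := by
  rw [cube_eq_preimage]
  exact (EuclideanSpace.equiv (Fin d) ℝ).toHomeomorph.isCompact_preimage.2
    (isCompact_univ_pi fun _ => isCompact_Icc)

theorem isOpen_openCube : IsOpen (openCube d) := by
  rw [openCube_eq_preimage]
  exact (isOpen_set_pi finite_univ fun _ _ => isOpen_Ioo).preimage
    (EuclideanSpace.equiv (Fin d) ℝ).continuous

theorem closure_openCube : closure (openCube d) = cube d := by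
  rw [openCube_eq_preimage, cube_eq_preimage,
    show ((EuclideanSpace.equiv (Fin d) ℝ) ⁻¹' Set.pi univ fun _ => Ioo (0 : ℝ) 1)
      = (EuclideanSpace.equiv (Fin d) ℝ).toHomeomorph ⁻¹' Set.pi univ fun _ => Ioo (0 : ℝ) 1
      from rfl, ← Homeomorph.preimage_closure, closure_pi_set]
  simp only [closure_Ioo (zero_ne_one' ℝ)]
  rfl

theorem openCube_subset_cube : openCube d ⊆ cube d := fun _ hx i => Ioo_subset_Icc_self (hx i)

theorem convex_openCube : Convex ℝ (openCube d) := by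
  rw [openCube_eq_preimage]
  exact (convex_pi fun _ _ => convex_Ioo 0 1).linear_preimage
    (EuclideanSpace.equiv (Fin d) ℝ).toLinearEquiv.toLinearMap

theorem openCube_nonempty : (openCube d).Nonempty :=
  ⟨WithLp.toLp 2 fun _ => 1 / 2, fun i => by norm_num⟩

theorem volume_cube_diff_openCube : volume (cube d \ openCube d) = 0 := by
  refine measure_mono_null ?_ ((convex_openCube (d := d)).addHaar_frontier volume)
  rw [frontier, closure_openCube, isOpen_openCube.interior_eq]

/-! ### One element: the reference map and its Lipschitz inverse. -/

section Element

variable {P : (Fin d → Bool) → E d}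

theorem openElem_subset_closedElem : openElem P ⊆ closedElem P :=
  image_mono openCube_subset_cube

theorem isCompact_closedElem : IsCompact (closedElem P) :=
  isCompact_cube.image (contDiff_refMap P).continuous

theorem closure_openElem : closure (openElem P) = closedElem P := by
  apply Subset.antisymm
  · exact isCompact_closedElem.isClosed.closure_subset_iff.2 openElem_subset_closedElem
  · rw [closedElem, ← closure_openCube]
    exact image_closure_subset_closure_image (contDiff_refMap P).continuous

theorem openElem_nonempty : (openElem P).Nonempty := openCube_nonempty.image _

/-- The boundary of a convex set is a null set, and a differentiable map of `ℝ^d` to itself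
preserves null sets. -/
theorem volume_closedElem_diff_openElem : volume (closedElem P \ openElem P) = 0 := by
  refine measure_mono_null ?_ (addHaar_image_eq_zero_of_differentiableOn_of_addHaar_eq_zero volume
    (((contDiff_refMap P).differentiable (by simp)).differentiableOn (s := cube d \ openCube d))
    volume_cube_diff_openCube)
  rintro _ ⟨⟨x, hx, rfl⟩, h⟩
  exact ⟨x, ⟨hx, fun h' => h ⟨x, h', rfl⟩⟩, rfl⟩

/-- The derivative of the reference map as an equivalence. -/
def refDeriv (P : (Fin d → Bool) → E d) (x : E d) (h : (fderiv ℝ (refMap P) x).det ≠ 0) :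
    E d ≃L[ℝ] E d :=
  (fderiv ℝ (refMap P) x).toContinuousLinearEquivOfDetNeZero h

theorem hasStrictFDerivAt_refMap {x : E d} (h : (fderiv ℝ (refMap P) x).det ≠ 0) :
    HasStrictFDerivAt (refMap P) (refDeriv P x h : E d →L[ℝ] E d) x := by
  have := ((contDiff_refMap P).contDiffAt (x := x)).hasStrictFDerivAt (by simp)
  rwa [refDeriv, ContinuousLinearMap.coe_toContinuousLinearEquivOfDetNeZero]

variable (inj : InjOn (refMap P) (cube d))
  (nd : ∀ x ∈ cube d, (fderiv ℝ (refMap P) x).det ≠ 0)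

/-- The inverse of the reference map. -/
abbrev refInv (P : (Fin d → Bool) → E d) : E d → E d := Function.invFunOn (refMap P) (cube d)

theorem refInv_mem {y : E d} (hy : y ∈ closedElem P) : refInv P y ∈ cube d :=
  Function.invFunOn_mem hy

theorem refMap_refInv {y : E d} (hy : y ∈ closedElem P) : refMap P (refInv P y) = y :=
  Function.invFunOn_eq hy

include nd in
theorem isOpen_openElem : IsOpen (openElem P) := by
  rw [isOpen_iff_mem_nhds]
  rintro _ ⟨x, hx, rfl⟩
  rw [← (hasStrictFDerivAt_refMap (nd x (openCube_subset_cube hx))).map_nhds_eq_of_equiv]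
  exact Filter.image_mem_map (isOpen_openCube.mem_nhds hx)

-- Compactness argument. Pairs violating the bound with constants `n + 1` accumulate at `(a, b)`;
-- their images approach each other, so injectivity forces `a = b`, and near `a` the inverse
-- function theorem contradicts the violation.
include inj nd in
theorem exists_antilipschitz_refMap :
    ∃ L : ℝ, 0 < L ∧ ∀ x ∈ cube d, ∀ y ∈ cube d, dist x y ≤ L * dist (refMap P x) (refMap P y) := by
  by_contra! hcon
  choose x hx y hy hxy using fun n : ℕ => hcon (n + 1) (by positivity)
  obtain ⟨⟨a, b⟩, ⟨ha, hb⟩, φ, hφ, hlim⟩ :=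
    (isCompact_cube.prod isCompact_cube).tendsto_subseq (x := fun n => (x n, y n))
      fun n => ⟨hx n, hy n⟩
  have hF := (contDiff_refMap P).continuous
  have hxl : Filter.Tendsto (fun n => x (φ n)) Filter.atTop (nhds a) :=
    (continuous_fst.tendsto _).comp hlim
  have hyl : Filter.Tendsto (fun n => y (φ n)) Filter.atTop (nhds b) :=
    (continuous_snd.tendsto _).comp hlim
  have hFd : Filter.Tendsto (fun n => dist (refMap P (x (φ n))) (refMap P (y (φ n))))
      Filter.atTop (nhds (dist (refMap P a) (refMap P b))) :=
    ((hF.tendsto a).comp hxl).dist ((hF.tendsto b).comp hyl)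
  have hd := hxl.dist hyl
  have hzero : dist (refMap P a) (refMap P b) = 0 := by
    by_contra h0
    have hpos : 0 < dist (refMap P a) (refMap P b) := lt_of_le_of_ne dist_nonneg (Ne.symm h0)
    have h1 : Filter.Tendsto (fun n : ℕ => ((φ n : ℝ) + 1) *
        dist (refMap P (x (φ n))) (refMap P (y (φ n)))) Filter.atTop Filter.atTop := by
      refine Filter.Tendsto.atTop_mul_pos hpos ?_ hFd
      exact Filter.tendsto_atTop_add_const_right _ _
        (tendsto_natCast_atTop_atTop.comp hφ.tendsto_atTop)
    exact not_tendsto_nhds_of_tendsto_atTop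
      (Filter.tendsto_atTop_mono (fun n => (hxy (φ n)).le) h1) _ hd
  have hab : a = b := inj ha hb (dist_eq_zero.1 hzero)
  subst hab
  obtain ⟨s, has, hso, hs⟩ :=
    (hasStrictFDerivAt_refMap (nd a ha)).approximates_deriv_on_open_nhds
  obtain ⟨C, hanti⟩ : ∃ C, AntilipschitzWith C (s.domRestrict (refMap P)) :=
    ⟨_, hs.antilipschitz ((refDeriv P a (nd a ha)).subsingleton_or_nnnorm_symm_pos.imp id fun h =>
      NNReal.half_lt_self (ne_of_gt (inv_pos.2 h)))⟩
  have hev : ∀ᶠ n in Filter.atTop, (C : ℝ) ≤ (φ n : ℝ) + 1 :=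
    (Filter.tendsto_atTop_add_const_right _ _
      (tendsto_natCast_atTop_atTop.comp hφ.tendsto_atTop)).eventually_ge_atTop _
  obtain ⟨n, h1, h2, h3⟩ := ((hxl.eventually (hso.mem_nhds has)).and
    ((hyl.eventually (hso.mem_nhds has)).and hev)).exists
  have h4 := hanti.le_mul_dist ⟨_, h1⟩ ⟨_, h2⟩
  simp only [Subtype.dist_eq, Set.domRestrict_apply] at h4
  have h5 := hxy (φ n)
  have := mul_le_mul_of_nonneg_right h3
    (dist_nonneg (x := refMap P (x (φ n))) (y := refMap P (y (φ n))))
  linarith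

include inj nd in
theorem exists_lipschitzOnWith_refInv :
    ∃ L : NNReal, LipschitzOnWith L (refInv P) (closedElem P) := by
  obtain ⟨L, hL, h⟩ := exists_antilipschitz_refMap inj nd
  refine ⟨⟨L, hL.le⟩, LipschitzOnWith.of_dist_le_mul fun x hx y hy => ?_⟩
  have := h _ (refInv_mem hx) _ (refInv_mem hy)
  rwa [refMap_refInv hx, refMap_refInv hy] at this

theorem exists_lipschitzOnWith_of_contDiff {F : Type*} [NormedAddCommGroup F] [NormedSpace ℝ F]
    {f : E d → F} (hf : ContDiff ℝ ∞ f) {s : Set (E d)} (hs : IsCompact s) :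
    ∃ L : NNReal, LipschitzOnWith L f s :=
  LocallyLipschitzOn.exists_lipschitzOnWith_of_compact hs
    ((hf.of_le (by simp)).locallyLipschitz.locallyLipschitzOn)

include inj nd in
theorem exists_lipschitzOnWith_lagrange (σ : Fin d → Bool) :
    ∃ L : NNReal, LipschitzOnWith L (lagrange P σ) (closedElem P) := by
  obtain ⟨L, hL⟩ := exists_lipschitzOnWith_refInv inj nd
  obtain ⟨L', hL'⟩ := exists_lipschitzOnWith_of_contDiff (contDiff_shape σ) (isCompact_cube (d := d))
  exact ⟨L' * L, hL'.comp hL fun x hx => refInv_mem hx⟩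

include inj nd in
theorem exists_hasStrictFDerivAt_refInv {y : E d} (hy : y ∈ openElem P) :
    ∃ g' : E d →L[ℝ] E d, HasStrictFDerivAt (refInv P) g' y := by
  obtain ⟨L, hL⟩ := exists_lipschitzOnWith_refInv inj nd
  have hnhds : closedElem P ∈ nhds y :=
    Filter.mem_of_superset ((isOpen_openElem nd).mem_nhds hy) openElem_subset_closedElem
  refine ⟨_, HasStrictFDerivAt.of_local_left_inverse (hL.continuousOn.continuousAt hnhds)
    (hasStrictFDerivAt_refMap (nd _ (refInv_mem (openElem_subset_closedElem hy)))) ?_⟩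
  filter_upwards [hnhds] with z hz using refMap_refInv hz

-- Strict differentiability is what lets the gradients of mollifications converge at the point, see
-- `tendsto_fderiv_mollify`.
include inj nd in
theorem hasStrictFDerivAt_lagrange (σ : Fin d → Bool) {y : E d} (hy : y ∈ openElem P) :
    HasStrictFDerivAt (lagrange P σ) (fderiv ℝ (lagrange P σ) y) y := by
  obtain ⟨g', hg'⟩ := exists_hasStrictFDerivAt_refInv inj nd hy
  have h := (((contDiff_shape σ).contDiffAt (x := refInv P y)).hasStrictFDerivAt (by simp)).comp y hg'
  have h' : HasStrictFDerivAt (lagrange P σ) _ y := h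
  rwa [h'.hasFDerivAt.fderiv]

theorem lagrange_nonneg (σ : Fin d → Bool) {y : E d} (hy : y ∈ closedElem P) :
    0 ≤ lagrange P σ y := shape_nonneg (refInv_mem hy) σ

theorem sum_lagrange (y : E d) : ∑ σ, lagrange P σ y = 1 := sum_shape _

theorem vert_mem_closedElem (σ : Fin d → Bool) : P σ ∈ closedElem P := by
  refine ⟨WithLp.toLp 2 fun i => if σ i then 1 else 0, fun i => ?_, ?_⟩
  · dsimp only
    split_ifs <;> simp
  · rw [refMap, Finset.sum_eq_single σ]
    · have : shape σ (WithLp.toLp 2 fun i => if σ i then (1 : ℝ) else 0 : E d) = 1 := by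
        refine Finset.prod_eq_one fun i _ => ?_
        dsimp only
        split_ifs <;> simp
      rw [this, one_smul]
    · intro τ _ hτ
      obtain ⟨i, hi⟩ := Function.ne_iff.1 hτ
      have : shape τ (WithLp.toLp 2 fun i => if σ i then (1 : ℝ) else 0 : E d) = 0 := by
        refine Finset.prod_eq_zero (Finset.mem_univ i) ?_
        dsimp only
        cases h1 : τ i <;> cases h2 : σ i <;> simp_all
      rw [this, zero_smul]
    · simp

end Element

/-- A function on an interval that is `L`-Lipschitz on each member of a finite closed cover is
`L`-Lipschitz. -/
theorem dist_le_of_finite_closed_cover {ι : Type*} (s : Finset ι) (F : ι → Set ℝ)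
    (hF : ∀ i, IsClosed (F i)) {f : ℝ → ℝ} {L b : ℝ}
    (hf : ∀ i, ∀ x ∈ F i, ∀ y ∈ F i, x ≤ y → |f x - f y| ≤ L * (y - x)) :
    ∀ a ≤ b, Icc a b ⊆ ⋃ i ∈ s, F i → |f a - f b| ≤ L * (b - a) := by
  classical
  induction s using Finset.strongInduction with
  | H s ih =>
    intro a hab hcov
    obtain ⟨i, his, hai⟩ := mem_iUnion₂.1 (hcov ⟨le_rfl, hab⟩)
    have hK : IsCompact (F i ∩ Icc a b) := isCompact_Icc.inter_left (hF i)
    -- Beyond its last point `t` in `[a, b]` the set `F i` is not needed, so the induction continues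
    -- on `[t, b]` without it. Closedness of the other sets keeps `t` itself covered.
    obtain ⟨t, ⟨⟨hti, hat, htb⟩, hmax⟩⟩ := hK.exists_isGreatest ⟨a, hai, le_rfl, hab⟩
    rcases htb.eq_or_lt with rfl | htb'
    · exact hf i a hai t hti hat
    have hcl : IsClosed (⋃ k ∈ s.erase i, F k) :=
      isClosed_biUnion_finset fun k _ => hF k
    have hsub : Icc t b ⊆ ⋃ k ∈ s.erase i, F k := by
      rw [← closure_Ioc htb'.ne]
      refine hcl.closure_subset_iff.2 fun r hr => ?_
      obtain ⟨k, hks, hrk⟩ := mem_iUnion₂.1 (hcov ⟨hat.trans hr.1.le, hr.2⟩)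
      refine mem_iUnion₂.2 ⟨k, Finset.mem_erase.2 ⟨?_, hks⟩, hrk⟩
      rintro rfl
      exact absurd (hmax ⟨hrk, hat.trans hr.1.le, hr.2⟩) (not_le.2 hr.1)
    have h1 := ih (s.erase i) (Finset.erase_ssubset his) t htb hsub
    have h2 := hf i a hai t hti hat
    calc |f a - f b| ≤ |f a - f t| + |f t - f b| := abs_sub_le _ _ _
      _ ≤ L * (b - a) := by linarith

/-- On a Lipschitz domain a bounded function that is Lipschitz along segments is Lipschitz. -/
theorem IsLipschitzDomain.exists_lipschitzOnWith {Ω : Set (E d)} (hΩ : IsLipschitzDomain Ω)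
    {f : E d → ℝ} {L B : ℝ} (hB : ∀ x ∈ Ω, |f x| ≤ B)
    (hf : ∀ x y, segment ℝ x y ⊆ Ω → |f x - f y| ≤ L * dist x y) :
    ∃ L' : NNReal, LipschitzOnWith L' f Ω := by
  have hloc : ∀ a ∈ closure Ω, ∃ r > 0, ∃ C : ℝ, ∀ x ∈ Ω ∩ Metric.ball a r,
      ∀ y ∈ Ω ∩ Metric.ball a r, |f x - f y| ≤ C * dist x y := by
    intro a ha
    by_cases haΩ : a ∈ Ω
    · obtain ⟨r, hr, hsub⟩ := Metric.isOpen_iff.1 hΩ.isOpen a haΩ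
      exact ⟨r, hr, L, fun x hx y hy =>
        hf x y (((convex_ball a r).segment_subset hx.2 hy.2).trans hsub)⟩
    · obtain ⟨e, δ, K, g, he, hδ, hg, hgr⟩ := hΩ.graph a
        (by rw [frontier, hΩ.isOpen.interior_eq]; exact ⟨ha, haΩ⟩)
      have hK : (0 : ℝ) ≤ K := K.2
      -- Two points at distance `D` are joined by going down by `(K + 1) * D`, across, and up again,
      -- a path of length `(2 * K + 3) * D`. With this radius the path stays in the ball where `Ω`
      -- is a subgraph.
      refine ⟨δ / (2 * K + 3), by positivity, (2 * K + 3) * L, fun x hx y hy => ?_⟩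
      set r := δ / (2 * K + 3) with hr
      have hrδ : r * (2 * K + 3) = δ := by rw [hr]; field_simp
      have hrpos : 0 < r := by rw [hr]; positivity
      set D := dist x y with hD
      have hD0 : 0 ≤ D := dist_nonneg
      have hxa := Metric.mem_ball.1 hx.2
      have hya := Metric.mem_ball.1 hy.2
      have hDr : D < 2 * r := by
        have := dist_triangle_right x y a
        linarith
      -- Along the crossing the height rises by at most `D` and the graph falls by at most `K * D`;
      -- this depth keeps the crossing below the graph.
      set h := (K + 1) * D with hh
      have hh0 : 0 ≤ h := by positivity
      have hin : ∀ z, dist z a < r → ∀ t ∈ Icc (0 : ℝ) h, z - t • e ∈ Metric.ball a δ := by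
        intro z hz t ht
        rw [Metric.mem_ball, dist_eq_norm]
        have h1 : ‖z - t • e - a‖ ≤ ‖z - a‖ + ‖t • e‖ := by
          rw [sub_right_comm]; exact norm_sub_le _ _
        rw [norm_smul, he, mul_one, Real.norm_of_nonneg ht.1] at h1
        rw [dist_eq_norm] at hz
        have h2 : h ≤ (K + 1) * (2 * r) := mul_le_mul_of_nonneg_left hDr.le (by positivity)
        have h3 := ht.2
        nlinarith
      have hee : inner ℝ e e = (1 : ℝ) := by rw [real_inner_self_eq_norm_sq, he]; norm_num
      have hproj : ∀ (z : E d) (t : ℝ), (z - t • e) - inner ℝ e (z - t • e) • e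
          = z - inner ℝ e z • e := by
        intro z t
        rw [inner_sub_right, inner_smul_right, hee, mul_one, sub_smul]
        abel
      have hdown : ∀ z ∈ Ω, dist z a < r → segment ℝ z (z - h • e) ⊆ Ω := by
        intro z hz hza w hw
        obtain ⟨θ, hθ, rfl⟩ := (segment_eq_image' ℝ z (z - h • e)) ▸ hw
        have h1 : z + θ • (z - h • e - z) = z - (θ * h) • e := by
          rw [sub_sub_cancel_left, smul_neg, smul_smul, sub_eq_add_neg]
        have hθh : θ * h ∈ Icc (0 : ℝ) h :=
          ⟨mul_nonneg hθ.1 hh0, mul_le_of_le_one_left hh0 hθ.2⟩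
        simp only [h1]
        rw [hgr _ (hin z hza _ hθh), hproj, inner_sub_right, inner_smul_right, hee, mul_one]
        have h2 := (hgr z (Metric.ball_subset_ball (by nlinarith) hza)).1 hz
        linarith [hθh.1]
      have hacross : segment ℝ (x - h • e) (y - h • e) ⊆ Ω := by
        intro w hw
        obtain ⟨θ, hθ, rfl⟩ := (segment_eq_image' ℝ (x - h • e) (y - h • e)) ▸ hw
        set z := x + θ • (y - x) with hz
        have h1 : x - h • e + θ • (y - h • e - (x - h • e)) = z - h • e := by
          rw [hz, sub_sub_sub_cancel_right]; abel
        have hzball : dist z a < r := by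
          have : z ∈ Metric.ball a r := (convex_ball a r).segment_subset hx.2 hy.2
            (by rw [segment_eq_image']; exact ⟨θ, hθ, rfl⟩)
          exact this
        have hzx : ‖z - x‖ ≤ D := by
          rw [hz, add_sub_cancel_left, norm_smul, Real.norm_of_nonneg hθ.1, hD, dist_comm,
            dist_eq_norm]
          exact mul_le_of_le_one_left (norm_nonneg _) hθ.2
        simp only [h1]
        rw [hgr _ (hin z hzball h ⟨hh0, le_rfl⟩), hproj, inner_sub_right, inner_smul_right, hee,
          mul_one]
        have h2 := (hgr x (Metric.ball_subset_ball (by nlinarith) hxa)).1 hx.1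
        have h3 : inner ℝ e z ≤ inner ℝ e x + D := by
          have := real_inner_le_norm e (z - x)
          rw [he, one_mul, inner_sub_right] at this
          linarith
        have h4 : g (x - inner ℝ e x • e) ≤ g (z - inner ℝ e z • e) + K * D := by
          have := hg.dist_le_mul (x - inner ℝ e x • e) (z - inner ℝ e z • e)
          rw [Real.dist_eq] at this
          have h5 : dist (x - inner ℝ e x • e) (z - inner ℝ e z • e) ≤ D := by
            rw [dist_eq_norm]
            refine le_trans ?_ hzx
            have h6 : x - inner ℝ e x • e - (z - inner ℝ e z • e)
                = (x - z) - inner ℝ e (x - z) • e := by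
              rw [inner_sub_right, sub_smul]; abel
            rw [h6, ← norm_sub_rev x z]
            refine le_of_sq_le_sq ?_ (norm_nonneg _)
            rw [norm_sub_sq_real, inner_smul_right, norm_smul, he, mul_one, real_inner_comm,
              Real.norm_eq_abs, sq_abs]
            nlinarith [sq_nonneg (inner ℝ e (x - z))]
          have h6 := mul_le_mul_of_nonneg_left h5 hK
          linarith [le_abs_self (g (x - inner ℝ e x • e) - g (z - inner ℝ e z • e))]
        rw [hh]
        linarith
      have hdx := hf _ _ (hdown x hx.1 hxa)
      have hdy := hf _ _ (hdown y hy.1 hya)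
      have hdxy := hf _ _ hacross
      have hdist : ∀ z : E d, dist z (z - h • e) = h := by
        intro z
        rw [dist_eq_norm, sub_sub_cancel, norm_smul, he, mul_one, Real.norm_of_nonneg hh0]
      rw [hdist] at hdx hdy
      rw [dist_sub_right, ← hD] at hdxy
      have t1 := abs_sub_le (f x) (f (x - h • e)) (f y)
      have t2 := abs_sub_le (f (x - h • e)) (f (y - h • e)) (f y)
      rw [abs_sub_comm (f (y - h • e)) (f y)] at t2
      have : L * h + L * D + L * h = (2 * K + 3) * L * D := by rw [hh]; ring
      linarith
  -- From local to global: points with difference quotients larger than `n + 1` have distance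
  -- tending to `0` because `f` is bounded, so they accumulate at one point of the compact closure
  -- and violate the local bound there.
  by_contra! hcon
  have hcon' : ∀ n : ℕ, ∃ x ∈ Ω, ∃ y ∈ Ω, ((n : ℝ) + 1) * dist x y < |f x - f y| := by
    intro n
    by_contra! h
    exact hcon (n + 1) (LipschitzOnWith.of_dist_le_mul fun x hx y hy => by
      simpa [Real.dist_eq] using h x hx y hy)
  choose x hx y hy hxy using hcon'
  obtain ⟨a, ha, φ, hφ, hxl⟩ := hΩ.bounded.isCompact_closure.tendsto_subseq
    fun n => subset_closure (hx n)
  have hn : Filter.Tendsto (fun n => (φ n : ℝ) + 1) Filter.atTop Filter.atTop :=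
    Filter.tendsto_atTop_add_const_right _ _
      (tendsto_natCast_atTop_atTop.comp hφ.tendsto_atTop)
  have hxy0 : Filter.Tendsto (fun n => dist (x (φ n)) (y (φ n))) Filter.atTop (nhds 0) := by
    have hlim : Filter.Tendsto (fun n => 2 * B * ((φ n : ℝ) + 1)⁻¹) Filter.atTop (nhds 0) := by
      simpa using (tendsto_inv_atTop_zero.comp hn).const_mul (2 * B)
    refine squeeze_zero (fun _ => dist_nonneg) (fun n => ?_) hlim
    have h1 := hxy (φ n)
    have h2 := abs_sub (f (x (φ n))) (f (y (φ n)))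
    have h3 := hB _ (hx (φ n))
    have h4 := hB _ (hy (φ n))
    rw [← div_eq_mul_inv, le_div_iff₀ (by positivity), mul_comm]
    linarith
  have hyl : Filter.Tendsto (fun n => y (φ n)) Filter.atTop (nhds a) :=
    (tendsto_iff_of_dist hxy0).1 hxl
  obtain ⟨r, hr, C, hC⟩ := hloc a ha
  obtain ⟨n, h1, h2, h3⟩ := ((hxl.eventually (Metric.ball_mem_nhds a hr)).and
    ((hyl.eventually (Metric.ball_mem_nhds a hr)).and (hn.eventually_ge_atTop C))).exists
  have h4 := hC _ ⟨hx _, h1⟩ _ ⟨hy _, h2⟩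
  have h5 := hxy (φ n)
  have := mul_le_mul_of_nonneg_right h3 (dist_nonneg (x := x (φ n)) (y := y (φ n)))
  linarith

/-! ### Nodal interpolants on a conforming mesh. -/

namespace QuadMesh

variable {Ω : Set (E d)} (M : QuadMesh d Ω)

/-- The nodal interpolant of `f`. -/
def nodal (f : E d → ℝ) (x : E d) : ℝ :=
  open Classical in
  if h : ∃ j, x ∈ closedElem (M.vert j) then
    ∑ σ, f (M.vert h.choose σ) * lagrange (M.vert h.choose) σ x
  else 0

/-- Conformity makes the element chosen in `nodal` irrelevant. -/
theorem nodal_eq (f : E d → ℝ) {j : Fin M.N} {x : E d} (hx : x ∈ closedElem (M.vert j)) :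
    M.nodal f x = ∑ σ, f (M.vert j σ) * lagrange (M.vert j) σ x := by
  have h : ∃ j, x ∈ closedElem (M.vert j) := ⟨j, hx⟩
  rw [nodal, dif_pos h]
  exact M.conforming _ _ x ⟨h.choose_spec, hx⟩ f

theorem nodal_eq_const {f : E d → ℝ} {j : Fin M.N} {x : E d} (hx : x ∈ closedElem (M.vert j))
    {c : ℝ} (hf : ∀ y ∈ closedElem (M.vert j), f y = c) : M.nodal f x = c := by
  rw [M.nodal_eq f hx]
  simp only [hf _ (vert_mem_closedElem _), ← Finset.mul_sum, sum_lagrange, mul_one]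

theorem nodal_mem_Icc {f : E d → ℝ} (hf : ∀ x, f x ∈ Icc (0 : ℝ) 1) (x : E d) :
    M.nodal f x ∈ Icc (0 : ℝ) 1 := by
  by_cases h : ∃ j, x ∈ closedElem (M.vert j)
  · obtain ⟨j, hj⟩ := h
    rw [M.nodal_eq f hj]
    refine ⟨Finset.sum_nonneg fun σ _ => mul_nonneg (hf _).1 (lagrange_nonneg σ hj), ?_⟩
    rw [← sum_lagrange (P := M.vert j) x]
    exact Finset.sum_le_sum fun σ _ => mul_le_of_le_one_left (lagrange_nonneg σ hj) (hf _).2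
  · rw [nodal, dif_neg h]
    simp

theorem exists_lipschitzOnWith_nodal_closedElem (f : E d → ℝ) :
    ∃ L : NNReal, ∀ j, LipschitzOnWith L (M.nodal f) (closedElem (M.vert j)) := by
  have h : ∀ j, ∃ L : NNReal, LipschitzOnWith L (M.nodal f) (closedElem (M.vert j)) := by
    intro j
    choose L hL using fun σ => exists_lipschitzOnWith_lagrange (M.injOn j) (M.nondegenerate j) σ
    refine ⟨∑ σ, ‖f (M.vert j σ)‖₊ * L σ, LipschitzOnWith.of_dist_le_mul fun x hx y hy => ?_⟩
    rw [M.nodal_eq f hx, M.nodal_eq f hy]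
    push_cast
    rw [Finset.sum_mul, Real.dist_eq, ← Finset.sum_sub_distrib]
    refine (Finset.abs_sum_le_sum_abs _ _).trans (Finset.sum_le_sum fun σ _ => ?_)
    rw [← mul_sub, abs_mul, mul_assoc]
    exact mul_le_mul_of_nonneg_left ((hL σ).dist_le_mul x hx y hy) (abs_nonneg _)
  choose L hL using h
  exact ⟨∑ j, L j, fun j => (hL j).weaken (Finset.single_le_sum (fun _ _ => zero_le)
    (Finset.mem_univ j))⟩

/-- A segment inside `Ω` is covered by finitely many closed elements, so the elementwise constant is
valid along it. Since `Ω` need not be convex, the graph condition is needed to pass from segments to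
arbitrary pairs of points. -/
theorem exists_lipschitzOnWith_nodal (hΩ : IsLipschitzDomain Ω) {f : E d → ℝ}
    (hf : ∀ x, f x ∈ Icc (0 : ℝ) 1) :
    ∃ L : NNReal, LipschitzOnWith L (M.nodal f) (closure Ω) := by
  obtain ⟨L, hL⟩ := M.exists_lipschitzOnWith_nodal_closedElem f
  have hseg : ∀ x y, segment ℝ x y ⊆ Ω → |M.nodal f x - M.nodal f y| ≤ L * dist x y := by
    intro x y hxy
    have hγ : Continuous fun t : ℝ => AffineMap.lineMap x y t := AffineMap.lineMap_continuous
    have hcov : Icc (0 : ℝ) 1 ⊆ ⋃ j ∈ (Finset.univ : Finset (Fin M.N)),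
        (fun t : ℝ => AffineMap.lineMap x y t) ⁻¹' closedElem (M.vert j) := by
      intro t ht
      have h1 : AffineMap.lineMap x y t ∈ closure Ω := subset_closure
        (hxy (by rw [segment_eq_image_lineMap]; exact ⟨t, ht, rfl⟩))
      rw [M.cover] at h1
      obtain ⟨j, hj⟩ := mem_iUnion.1 h1
      exact mem_iUnion₂.2 ⟨j, Finset.mem_univ j, hj⟩
    have := dist_le_of_finite_closed_cover Finset.univ
      (fun j => (fun t : ℝ => AffineMap.lineMap x y t) ⁻¹' closedElem (M.vert j))
      (fun j => isCompact_closedElem.isClosed.preimage hγ)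
      (f := fun t => M.nodal f (AffineMap.lineMap x y t)) (L := L * dist x y)
      (fun j s hs t ht hst => ?_) 0 zero_le_one hcov
    · simpa using this
    · have := (hL j).dist_le_mul _ hs _ ht
      rw [dist_lineMap_lineMap, Real.dist_eq, dist_comm, Real.dist_eq,
        abs_of_nonneg (sub_nonneg.2 hst)] at this
      calc _ ≤ L * ((t - s) * dist x y) := this
        _ = _ := by ring
  obtain ⟨L', hL'⟩ := hΩ.exists_lipschitzOnWith (B := 1) (fun x _ => by
    rw [abs_of_nonneg (M.nodal_mem_Icc hf x).1]; exact (M.nodal_mem_Icc hf x).2) hseg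
  refine ⟨L', ?_⟩
  have hcont : ContinuousOn (M.nodal f) (closure Ω) := by
    rw [M.cover]
    exact (locallyFinite_of_finite _).continuousOn_iUnion
      (fun j => isCompact_closedElem.isClosed) fun j => (hL j).continuousOn
  exact hL'.closure hcont

end QuadMesh

/-! ### Operators on `L²` -/

section LpOperators

variable {α : Type*} [MeasurableSpace α] {μ : Measure α} {F F' : Type*}
  [NormedAddCommGroup F] [InnerProductSpace ℂ F] [NormedAddCommGroup F'] [InnerProductSpace ℂ F']

theorem norm_sq_Lp (f : Lp F 2 μ) : ‖f‖ ^ 2 = ∫ x, ‖f x‖ ^ 2 ∂μ := by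
  rw [← inner_self_eq_norm_sq (𝕜 := ℂ), L2.inner_def, ← integral_re (L2.integrable_inner f f)]
  simp only [inner_self_eq_norm_sq]

omit [InnerProductSpace ℂ F] in
theorem integrable_norm_sq_Lp (f : Lp F 2 μ) : Integrable (fun x => ‖f x‖ ^ 2) μ :=
  (memLp_two_iff_integrable_sq_norm (Lp.aestronglyMeasurable f)).1 (Lp.memLp f)

/-- Pointwise application of a bounded measurable family of operators. -/
def mulOp (T : α → F →L[ℂ] F') (hT : MemLp T ∞ μ) : Lp F 2 μ →L[ℂ] Lp F' 2 μ :=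
  (ContinuousLinearMap.id ℂ (F →L[ℂ] F')).holderL μ ∞ 2 2 (hT.toLp T)

theorem coeFn_mulOp (T : α → F →L[ℂ] F') (hT : MemLp T ∞ μ) (f : Lp F 2 μ) :
    mulOp T hT f =ᵐ[μ] fun x => T x (f x) := by
  filter_upwards [(ContinuousLinearMap.id ℂ (F →L[ℂ] F')).coeFn_holder (r := 2) (hT.toLp T) f,
    hT.coeFn_toLp] with x h1 h2
  rw [h2] at h1
  exact h1

/-- Dominated convergence with majorant `(2C)²|f|²`. Pointwise convergence is all that is available
for the gradients of mollified cutoffs, so the operators converge strongly and need not converge in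
norm. -/
theorem tendsto_mulOp {T : ℕ → α → F →L[ℂ] F'} {T' : α → F →L[ℂ] F'} (hT : ∀ n, MemLp (T n) ∞ μ)
    (hT' : MemLp T' ∞ μ) {C : ℝ} (hC : ∀ n, ∀ᵐ x ∂μ, ‖T n x‖ ≤ C)
    (hlim : ∀ᵐ x ∂μ, Filter.Tendsto (fun n => T n x) Filter.atTop (nhds (T' x))) (f : Lp F 2 μ) :
    Filter.Tendsto (fun n => mulOp (T n) (hT n) f) Filter.atTop (nhds (mulOp T' hT' f)) := by
  rw [tendsto_iff_norm_sub_tendsto_zero]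
  have hC' : ∀ᵐ x ∂μ, ‖T' x‖ ≤ C := by
    filter_upwards [hlim, ae_all_iff.2 hC] with x h1 h2
    exact le_of_tendsto h1.norm (Filter.Eventually.of_forall h2)
  have hsq : Filter.Tendsto (fun n => ‖mulOp (T n) (hT n) f - mulOp T' hT' f‖ ^ 2) Filter.atTop
      (nhds (∫ _, (0 : ℝ) ∂μ)) := by
    simp only [norm_sq_Lp]
    have hrepr : ∀ n, ∀ᵐ x ∂μ, (mulOp (T n) (hT n) f - mulOp T' hT' f : Lp F' 2 μ) x
        = (T n x - T' x) (f x) := by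
      intro n
      filter_upwards [Lp.coeFn_sub (mulOp (T n) (hT n) f) (mulOp T' hT' f), coeFn_mulOp _ (hT n) f,
        coeFn_mulOp _ hT' f] with x h1 h2 h3
      rw [h1, Pi.sub_apply, h2, h3, sub_apply]
    refine tendsto_integral_of_dominated_convergence (fun x => (2 * C) ^ 2 * ‖f x‖ ^ 2) (fun n => ?_)
      ((integrable_norm_sq_Lp f).const_mul _) (fun n => ?_) ?_
    · exact ((Lp.aestronglyMeasurable _).norm.pow 2)
    · filter_upwards [hrepr n, hC n, hC'] with x h1 h2 h3
      rw [h1, Real.norm_of_nonneg (by positivity), ← mul_pow]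
      gcongr
      refine (ContinuousLinearMap.le_opNorm _ _).trans ?_
      gcongr
      exact (norm_sub_le _ _).trans (by linarith)
    · filter_upwards [ae_all_iff.2 hrepr, hlim] with x h1 h2
      simp only [h1]
      have h3 : Filter.Tendsto (fun n => (T n x - T' x) (f x)) Filter.atTop (nhds 0) := by
        have := ((ContinuousLinearMap.apply ℂ F' (f x)).continuous.tendsto _).comp
          (h2.sub_const (T' x))
        simpa [Function.comp_def] using this
      simpa using (h3.norm.pow 2)
  rw [integral_zero] at hsq
  have := (Real.continuous_sqrt.tendsto _).comp hsq
  simpa [Function.comp_def, Real.sqrt_sq (norm_nonneg _)] using this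

/-- Multiplication by a bounded measurable real function. -/
def smulOp (χ : α → ℝ) (hχ : MemLp χ ∞ μ) : Lp F 2 μ →L[ℂ] Lp F 2 μ :=
  mulOp (fun x => (χ x : ℂ) • ContinuousLinearMap.id ℂ F)
    (hχ.ofReal.continuousLinearMap_comp
      ((ContinuousLinearMap.id ℂ ℂ).smulRight (ContinuousLinearMap.id ℂ F)))

theorem coeFn_smulOp (χ : α → ℝ) (hχ : MemLp χ ∞ μ) (f : Lp F 2 μ) :
    smulOp χ hχ f =ᵐ[μ] fun x => (χ x : ℂ) • f x := coeFn_mulOp _ _ _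

/-- Multiplication of scalar functions by a bounded measurable vector field. -/
def vecOp (G : α → F) (hG : MemLp G ∞ μ) : Lp ℂ 2 μ →L[ℂ] Lp F 2 μ :=
  mulOp (fun x => ContinuousLinearMap.toSpanSingleton ℂ (G x))
    (hG.continuousLinearMap_comp
      (ContinuousLinearMap.toSpanSingletonCLE (𝕜 := ℂ) (E := F)).toContinuousLinearMap)

theorem coeFn_vecOp (G : α → F) (hG : MemLp G ∞ μ) (f : Lp ℂ 2 μ) :
    vecOp G hG f =ᵐ[μ] fun x => f x • G x := coeFn_mulOp _ _ _

end LpOperators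
/-! ### Mollification of Lipschitz functions -/

/-- A smooth bump supported in the ball of radius `2 / (n + 1)`. -/
def bump (d n : ℕ) : ContDiffBump (0 : E d) where
  rIn := 1 / (n + 1)
  rOut := 2 / (n + 1)
  rIn_pos := by positivity
  rIn_lt_rOut := by gcongr; norm_num

/-- Mollification. -/
def mollify (n : ℕ) (g : E d → ℝ) (x : E d) : ℝ := ∫ t, (bump d n).normed volume t * g (x - t)

theorem contDiff_mollify (n : ℕ) {g : E d → ℝ} (hg : Continuous g) :
    ContDiff ℝ ∞ (mollify n g) :=
  (bump d n).hasCompactSupport_normed.contDiff_convolution_left (ContinuousLinearMap.mul ℝ ℝ)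
    (bump d n).contDiff_normed hg.locallyIntegrable

theorem integrable_bump_mul (n : ℕ) {h : E d → ℝ} (hh : Continuous h) :
    Integrable (fun t => (bump d n).normed volume t * h t) :=
  ((bump d n).continuous_normed.mul hh).integrable_of_hasCompactSupport
    (bump d n).hasCompactSupport_normed.mul_right

theorem abs_integral_bump_le (n : ℕ) {h : E d → ℝ} {C : ℝ}
    (hb : ∀ t : E d, ‖t‖ < 2 / (n + 1) → |h t| ≤ C) :
    |∫ t, (bump d n).normed volume t * h t| ≤ C := by
  have h1 : ∫ t, (bump d n).normed volume t * C = C := by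
    rw [integral_mul_const, (bump d n).integral_normed, one_mul]
  rw [← Real.norm_eq_abs]
  refine (norm_integral_le_of_norm_le (g := fun t => (bump d n).normed volume t * C)
    (integrable_bump_mul n continuous_const) (Filter.Eventually.of_forall fun t => ?_)).trans h1.le
  rw [norm_mul, Real.norm_of_nonneg ((bump d n).nonneg_normed t), Real.norm_eq_abs]
  by_cases ht : ‖t‖ < 2 / (n + 1)
  · exact mul_le_mul_of_nonneg_left (hb t ht) ((bump d n).nonneg_normed t)
  · have : (bump d n).normed volume t = 0 := by
      rw [← Function.notMem_support, (bump d n).support_normed_eq]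
      simpa [bump] using ht
    rw [this, zero_mul, zero_mul]

/-- The bump has integral one, so a constant may be moved under the integral. With `c = 0` this
gives the Lipschitz bound, with `c = g' (y - x)` the convergence of derivatives. -/
theorem mollify_sub_sub (n : ℕ) {g : E d → ℝ} (hg : Continuous g) (x y : E d) (c : ℝ) :
    mollify n g y - mollify n g x - c
      = ∫ t, (bump d n).normed volume t * (g (y - t) - g (x - t) - c) := by
  have hi : ∀ z : E d, Integrable fun t => (bump d n).normed volume t * g (z - t) := fun z =>
    integrable_bump_mul n (hg.comp (continuous_const.sub continuous_id))
  have hc : Integrable fun t => (bump d n).normed volume t * c :=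
    integrable_bump_mul n continuous_const
  have h1 : ∫ t, (bump d n).normed volume t * c = c := by
    rw [integral_mul_const, (bump d n).integral_normed, one_mul]
  simp only [mul_sub]
  have h2 := integral_sub ((hi y).sub (hi x)) hc
  have h3 := integral_sub' (hi y) (hi x)
  rw [h3, h1] at h2
  exact h2.symm

theorem lipschitzWith_mollify (n : ℕ) {g : E d → ℝ} {L : NNReal} (hg : LipschitzWith L g) :
    LipschitzWith L (mollify n g) := by
  refine LipschitzWith.of_dist_le_mul fun y x => ?_
  have h := mollify_sub_sub n hg.continuous x y 0
  rw [sub_zero] at h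
  rw [Real.dist_eq, h]
  refine abs_integral_bump_le n fun t _ => ?_
  have := hg.dist_le_mul (y - t) (x - t)
  rwa [Real.dist_eq, dist_sub_right, ← sub_zero (g (y - t) - g (x - t))] at this

theorem tendsto_mollify {g : E d → ℝ} {L : NNReal} (hg : LipschitzWith L g) (x : E d) :
    Filter.Tendsto (fun n => mollify n g x) Filter.atTop (nhds (g x)) := by
  rw [tendsto_iff_norm_sub_tendsto_zero]
  have hlim : Filter.Tendsto (fun n : ℕ => (L : ℝ) * (2 / ((n : ℝ) + 1))) Filter.atTop
      (nhds 0) := by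
    have := (tendsto_one_div_add_atTop_nhds_zero_nat (𝕜 := ℝ)).const_mul (2 * L : ℝ)
    rw [mul_zero] at this
    refine this.congr fun n => ?_
    ring
  refine squeeze_zero (fun _ => norm_nonneg _) (fun n => ?_) hlim
  have h : mollify n g x - g x = ∫ t, (bump d n).normed volume t * (g (x - t) - g x) := by
    simp only [mul_sub]
    have h2 := integral_sub (integrable_bump_mul n (h := fun t => g (x - t))
      (hg.continuous.comp (continuous_const.sub continuous_id)))
      (integrable_bump_mul n (continuous_const (y := g x)))
    rw [integral_mul_const, (bump d n).integral_normed, one_mul] at h2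
    exact h2.symm
  rw [h, Real.norm_eq_abs]
  refine abs_integral_bump_le n fun t ht => ?_
  have := hg.dist_le_mul (x - t) x
  rw [Real.dist_eq, dist_eq_norm, sub_sub_cancel_left, norm_neg] at this
  exact this.trans (mul_le_mul_of_nonneg_left ht.le L.2)

theorem mollify_mem_Icc (n : ℕ) {g : E d → ℝ} (h01 : ∀ x, g x ∈ Icc (0 : ℝ) 1)
    (x : E d) : mollify n g x ∈ Icc (0 : ℝ) 1 := by
  refine ⟨integral_nonneg fun t => mul_nonneg ((bump d n).nonneg_normed t) (h01 _).1, ?_⟩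
  exact (le_abs_self _).trans (abs_integral_bump_le n fun t _ => by
    rw [abs_of_nonneg (h01 _).1]; exact (h01 _).2)

/-- By strict differentiability `g - g'` is `ε/2`-Lipschitz near `x`. Averaging over small
translations keeps this property, and a derivative is bounded by the local Lipschitz constant. -/
theorem tendsto_fderiv_mollify {g : E d → ℝ} (hg : Continuous g) {x : E d}
    {g' : E d →L[ℝ] ℝ} (hx : HasStrictFDerivAt g g' x) :
    Filter.Tendsto (fun n => fderiv ℝ (mollify n g) x) Filter.atTop (nhds g') := by
  rw [Metric.tendsto_atTop]
  intro ε hε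
  obtain ⟨s, hs, hsε⟩ := hx.approximates_deriv_on_nhds (c := ⟨ε / 2, by positivity⟩)
    (Or.inr (by show (0 : ℝ) < ε / 2; positivity))
  obtain ⟨r, hr, hrs⟩ := Metric.mem_nhds_iff.1 hs
  -- This bound puts the support radius `2 / (n + 1)` below `r / 2`, so translates of points of the
  -- half ball stay in the ball of radius `r`.
  obtain ⟨N, hN⟩ := exists_nat_gt (4 / r)
  refine ⟨N, fun n hn => ?_⟩
  have hn' : 2 / ((n : ℝ) + 1) < r / 2 := by
    have h1 : 4 / r < (n : ℝ) + 1 := by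
      have : (N : ℝ) ≤ n := by exact_mod_cast hn
      linarith
    rw [div_lt_iff₀ hr] at h1
    rw [div_lt_div_iff₀ (by positivity) (by norm_num)]
    linarith
  have hd : HasFDerivAt (fun y => mollify n g y - g' y) (fderiv ℝ (mollify n g) x - g') x :=
    (((contDiff_mollify n hg).differentiable (by simp)) x).hasFDerivAt.sub g'.hasFDerivAt
  have hle : ‖fderiv ℝ (mollify n g) x - g'‖ ≤ ε / 2 := by
    refine hd.le_of_lip' (by positivity) ?_
    filter_upwards [Metric.ball_mem_nhds x (half_pos hr)] with y hy
    have h1 : mollify n g y - g' y - (mollify n g x - g' x)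
        = mollify n g y - mollify n g x - g' (y - x) := by rw [map_sub]; ring
    rw [h1, mollify_sub_sub n hg, Real.norm_eq_abs]
    refine abs_integral_bump_le n fun t ht => ?_
    have hxt : x - t ∈ s := hrs (by
      rw [Metric.mem_ball, dist_eq_norm, sub_sub_cancel_left, norm_neg]; linarith)
    have hyt : y - t ∈ s := hrs (by
      rw [Metric.mem_ball, dist_eq_norm]
      rw [Metric.mem_ball, dist_eq_norm] at hy
      have : ‖y - t - x‖ ≤ ‖y - x‖ + ‖t‖ := by rw [sub_right_comm]; exact norm_sub_le _ _
      linarith)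
    have := hsε (y - t) hyt (x - t) hxt
    rwa [sub_sub_sub_cancel_right] at this
  rw [dist_eq_norm]
  linarith

/-! ### Multiplication by Lipschitz functions on `H¹` -/

/-- The gradient of a real function as a complex vector. -/
def rgrad (g : E d → ℝ) (x : E d) : CVec d :=
  WithLp.toLp 2 fun i => ((fderiv ℝ g x (EuclideanSpace.single i 1) : ℝ) : ℂ)

theorem norm_rgrad_eq_norm_gradient (g : E d → ℝ) (x : E d) : ‖rgrad g x‖ = ‖gradient g x‖ := by
  rw [EuclideanSpace.norm_eq, EuclideanSpace.norm_eq]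
  congr 1
  refine Finset.sum_congr rfl fun i _ => ?_
  have h : (gradient g x) i = fderiv ℝ g x (EuclideanSpace.single i 1) := by
    rw [gradient, ← InnerProductSpace.toDual_symm_apply, real_inner_comm,
      EuclideanSpace.inner_single_left]
    simp
  rw [h, rgrad]
  simp

theorem norm_rgrad (g : E d → ℝ) (x : E d) : ‖rgrad g x‖ = ‖fderiv ℝ g x‖ := by
  rw [norm_rgrad_eq_norm_gradient, gradient, LinearIsometryEquiv.norm_map]

theorem measurable_rgrad (g : E d → ℝ) : Measurable (rgrad g) := by
  refine (WithLp.measurable_toLp 2 _).comp (measurable_pi_lambda _ fun i => ?_)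
  exact Complex.measurable_ofReal.comp (measurable_fderiv_apply_const ℝ g _)

theorem tendsto_rgrad_mollify {g : E d → ℝ} (hg : Continuous g) {x : E d}
    (hx : HasStrictFDerivAt g (fderiv ℝ g x) x) :
    Filter.Tendsto (fun n => rgrad (mollify n g) x) Filter.atTop (nhds (rgrad g x)) := by
  refine ((PiLp.continuous_toLp 2 _).tendsto _).comp (tendsto_pi_nhds.2 fun i => ?_)
  exact (Complex.continuous_ofReal.tendsto _).comp
    (((ContinuousLinearMap.apply ℝ ℝ (EuclideanSpace.single i 1)).continuous.tendsto _).comp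
      (tendsto_fderiv_mollify hg hx))

theorem cgrad_mul {g : E d → ℝ} {φ : E d → ℂ} {x : E d} (hg : DifferentiableAt ℝ g x)
    (hφ : DifferentiableAt ℝ φ x) :
    cgrad (fun y => (g y : ℂ) * φ y) x = (g x : ℂ) • cgrad φ x + φ x • rgrad g x := by
  ext i
  have h : (fun y => (g y : ℂ) * φ y) = fun y => g y • φ y := by
    ext y; exact (Complex.real_smul).symm
  simp only [cgrad, rgrad, h, fderiv_fun_smul hg hφ, PiLp.add_apply, PiLp.smul_apply,
    add_apply, smul_apply, ContinuousLinearMap.smulRight_apply,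
    Complex.real_smul, smul_eq_mul]
  ring

section Cutoff

variable {g : E d → ℝ} {L : NNReal}

theorem memLp_top_of_mem_Icc (hg : LipschitzWith L g) (h01 : ∀ x, g x ∈ Icc (0 : ℝ) 1)
    (μ : Measure (E d)) : MemLp g ∞ μ :=
  memLp_top_of_bound hg.continuous.aestronglyMeasurable 1 (Filter.Eventually.of_forall fun x => by
    rw [Real.norm_of_nonneg (h01 x).1]; exact (h01 x).2)

theorem norm_rgrad_le (hg : LipschitzWith L g) (x : E d) : ‖rgrad g x‖ ≤ L := by
  rw [norm_rgrad]
  exact norm_fderiv_le_of_lipschitz ℝ hg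

theorem memLp_top_rgrad (hg : LipschitzWith L g) (μ : Measure (E d)) : MemLp (rgrad g) ∞ μ :=
  memLp_top_of_bound (measurable_rgrad g).aestronglyMeasurable L
    (Filter.Eventually.of_forall (norm_rgrad_le hg))

/-- Multiplication of `(u, ∇u, trace u)` by `g`. -/
def cutOp (hg : LipschitzWith L g) (h01 : ∀ x, g x ∈ Icc (0 : ℝ) 1) (D S : Set (E d)) :
    Triple D S →L[ℂ] Triple D S :=
  ((smulOp g (memLp_top_of_mem_Icc hg h01 _)).comp (ContinuousLinearMap.fst ℂ _ _)).prod
    (((smulOp g (memLp_top_of_mem_Icc hg h01 _)).comp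
        ((ContinuousLinearMap.fst ℂ _ _).comp (ContinuousLinearMap.snd ℂ _ _))
      + (vecOp (rgrad g) (memLp_top_rgrad hg _)).comp (ContinuousLinearMap.fst ℂ _ _)).prod
    ((smulOp g (memLp_top_of_mem_Icc hg h01 _)).comp
        ((ContinuousLinearMap.snd ℂ _ _).comp (ContinuousLinearMap.snd ℂ _ _))))

variable (hg : LipschitzWith L g) (h01 : ∀ x, g x ∈ Icc (0 : ℝ) 1) {D S : Set (E d)}

theorem cutOp_fst (u : Triple D S) :
    (cutOp hg h01 D S u).1 =ᵐ[volume.restrict D] fun x => (g x : ℂ) * u.1 x :=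
  coeFn_smulOp g (memLp_top_of_mem_Icc hg h01 _) u.1

theorem cutOp_grad (u : Triple D S) :
    (cutOp hg h01 D S u).2.1 =ᵐ[volume.restrict D]
      fun x => (g x : ℂ) • u.2.1 x + u.1 x • rgrad g x := by
  have h : (cutOp hg h01 D S u).2.1 = smulOp g (memLp_top_of_mem_Icc hg h01 _) u.2.1
    + vecOp (rgrad g) (memLp_top_rgrad hg _) u.1 := rfl
  rw [h]
  filter_upwards [Lp.coeFn_add (smulOp g (memLp_top_of_mem_Icc hg h01 _) u.2.1)
    (vecOp (rgrad g) (memLp_top_rgrad hg _) u.1),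
    coeFn_smulOp g (memLp_top_of_mem_Icc hg h01 _) u.2.1,
    coeFn_vecOp (rgrad g) (memLp_top_rgrad hg _) u.1] with x h1 h2 h3
  rw [h1, Pi.add_apply, h2, h3]

theorem cutOp_trace (u : Triple D S) :
    (cutOp hg h01 D S u).2.2 =ᵐ[(surf d).restrict S] fun x => (g x : ℂ) * u.2.2 x :=
  coeFn_smulOp g (memLp_top_of_mem_Icc hg h01 _) u.2.2

/-- Mollification keeps the range in `[0, 1]` and the Lipschitz constant, which provides uniform
bounds. The values converge at every point, hence also almost everywhere for the surface measure, as
the trace component requires. -/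
theorem tendsto_cutOp_mollify
    (hdiff : ∀ᵐ x ∂volume.restrict D, HasStrictFDerivAt g (fderiv ℝ g x) x) (u : Triple D S) :
    Filter.Tendsto (fun n => cutOp (lipschitzWith_mollify n hg)
      (mollify_mem_Icc n h01) D S u) Filter.atTop (nhds (cutOp hg h01 D S u)) := by
  have hs : ∀ {F : Type} [NormedAddCommGroup F] [InnerProductSpace ℂ F] (μ : Measure (E d))
      (f : Lp F 2 μ), Filter.Tendsto (fun n => smulOp (mollify n g) (memLp_top_of_mem_Icc
        (lipschitzWith_mollify n hg) (mollify_mem_Icc n h01) μ) f) Filter.atTop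
        (nhds (smulOp g (memLp_top_of_mem_Icc hg h01 μ) f)) := by
    intro F _ _ μ f
    refine tendsto_mulOp _ _ (C := 1) (fun n => Filter.Eventually.of_forall fun x => ?_)
      (Filter.Eventually.of_forall fun x => ?_) f
    · rw [norm_smul, Complex.norm_real,
        Real.norm_of_nonneg (mollify_mem_Icc n h01 x).1]
      exact mul_le_one₀ (mollify_mem_Icc n h01 x).2 (norm_nonneg _)
        ContinuousLinearMap.norm_id_le
    · exact ((Complex.continuous_ofReal.tendsto _).comp (tendsto_mollify hg x)).smul_const _
  have hv : Filter.Tendsto (fun n => vecOp (rgrad (mollify n g))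
      (memLp_top_rgrad (lipschitzWith_mollify n hg) _) u.1) Filter.atTop
      (nhds (vecOp (rgrad g) (memLp_top_rgrad hg _) u.1)) := by
    refine tendsto_mulOp _ _ (C := L) (fun n => Filter.Eventually.of_forall fun x => ?_) ?_ _
    · rw [ContinuousLinearMap.norm_toSpanSingleton]
      exact norm_rgrad_le (lipschitzWith_mollify n hg) x
    · filter_upwards [hdiff] with x hx
      exact ((ContinuousLinearMap.toSpanSingletonCLE (𝕜 := ℂ) (E := CVec d)).continuous.tendsto
        _).comp (tendsto_rgrad_mollify hg.continuous hx)
  exact (hs _ u.1).prodMk_nhds (((hs _ u.2.1).add hv).prodMk_nhds (hs _ u.2.2))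

/-- Multiplication by a Lipschitz function that is strictly differentiable almost everywhere
preserves `H¹`. -/
theorem cutOp_mem_H1
    (hdiff : ∀ᵐ x ∂volume.restrict D, HasStrictFDerivAt g (fderiv ℝ g x) x) {u : Triple D S}
    (hu : u ∈ H1 D S) : cutOp hg h01 D S u ∈ H1 D S := by
  have hle : smoothTriples D S ≤ (H1 D S).comap (cutOp hg h01 D S).toLinearMap := by
    intro U hU
    -- A smooth triple times a mollification of `g` is again a smooth triple; the limit is therefore
    -- in the closure. Continuity of the multiplication extends this to all of `H¹`.
    refine (smoothTriples D S).isClosed_topologicalClosure.mem_of_tendsto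
      (tendsto_cutOp_mollify hg h01 hdiff U)
      (Filter.Eventually.of_forall fun n => (smoothTriples D S).le_topologicalClosure ?_)
    obtain ⟨φ, hφ, hφc, h1, h2, h3⟩ := hU
    have hm := contDiff_mollify n hg.continuous
    refine ⟨fun x => (mollify n g x : ℂ) * φ x, (Complex.ofRealCLM.contDiff.comp hm).mul hφ,
      hφc.mul_left, ?_, ?_, ?_⟩
    · filter_upwards [cutOp_fst (lipschitzWith_mollify n hg)
        (mollify_mem_Icc n h01) U, h1] with x a b
      rw [a, b]
    · filter_upwards [cutOp_grad (lipschitzWith_mollify n hg)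
        (mollify_mem_Icc n h01) U, h1, h2] with x a b c
      rw [a, b, c, cgrad_mul (hm.differentiable (by simp) x) (hφ.differentiable (by simp) x)]
    · filter_upwards [cutOp_trace (lipschitzWith_mollify n hg)
        (mollify_mem_Icc n h01) U, h3] with x a b
      rw [a, b]
  exact (smoothTriples D S).topologicalClosure_minimal hle
    ((smoothTriples D S).isClosed_topologicalClosure.preimage (cutOp hg h01 D S).continuous) hu

end Cutoff

/-! ### The elements as a partition of the domain up to null sets. -/

namespace QuadMesh

variable {Ω : Set (E d)} (M : QuadMesh d Ω)

theorem isOpen_K (j : Fin M.N) : IsOpen (M.K j) := isOpen_openElem (M.nondegenerate j)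

theorem measurableSet_K (j : Fin M.N) : MeasurableSet (M.K j) := (M.isOpen_K j).measurableSet

theorem closure_K (j : Fin M.N) : closure (M.K j) = closedElem (M.vert j) := closure_openElem

theorem K_nonempty (j : Fin M.N) : (M.K j).Nonempty := openElem_nonempty

theorem K_subset (j : Fin M.N) : M.K j ⊆ Ω := M.elem_subset j

theorem closedElem_subset (j : Fin M.N) : closedElem (M.vert j) ⊆ closure Ω := by
  rw [M.cover]
  exact subset_iUnion (fun j => closedElem (M.vert j)) j

theorem pairwise_disjoint : Pairwise (Function.onFun Disjoint M.K) := fun i j h => M.disjoint i j h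

theorem ae_mem_iUnion_K : ∀ᵐ x ∂volume, x ∈ closure Ω → x ∈ ⋃ j, M.K j := by
  have h : volume (⋃ j, closedElem (M.vert j) \ openElem (M.vert j)) = 0 :=
    measure_iUnion_null fun j => volume_closedElem_diff_openElem
  filter_upwards [measure_eq_zero_iff_ae_notMem.1 h] with x hx hxΩ
  rw [M.cover] at hxΩ
  obtain ⟨j, hj⟩ := mem_iUnion.1 hxΩ
  by_contra hcon
  exact hx (mem_iUnion.2 ⟨j, hj, fun h => hcon (mem_iUnion.2 ⟨j, h⟩)⟩)

theorem iUnion_K_ae_eq : (⋃ j, M.K j) =ᵐ[volume] Ω := by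
  filter_upwards [M.ae_mem_iUnion_K] with x hx
  exact propext ⟨fun h => (iUnion_subset M.K_subset) h, fun h => hx (subset_closure h)⟩

theorem restrict_iUnion_K : volume.restrict Ω = volume.restrict (⋃ j, M.K j) :=
  (Measure.restrict_congr_set M.iUnion_K_ae_eq).symm

/-- A property that holds almost everywhere in each element holds almost everywhere. -/
theorem ae_restrict_of_forall {p : E d → Prop}
    (h : ∀ j, ∀ᵐ x ∂volume.restrict (M.K j), p x) : ∀ᵐ x ∂volume.restrict Ω, p x := by
  rw [M.restrict_iUnion_K, ae_restrict_iUnion_iff]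
  exact h

theorem ae_restrict_K {p : E d → Prop} (h : ∀ᵐ x ∂volume.restrict Ω, p x) (j : Fin M.N) :
    ∀ᵐ x ∂volume.restrict (M.K j), p x :=
  ae_restrict_of_ae_restrict_of_subset (M.K_subset j) h

theorem integral_eq_sum {F : Type*} [NormedAddCommGroup F] [NormedSpace ℝ F] {f : E d → F}
    (hf : ∀ j, IntegrableOn f (M.K j)) : ∫ x in Ω, f x = ∑ j, ∫ x in M.K j, f x := by
  rw [M.restrict_iUnion_K]
  exact integral_iUnion_fintype M.measurableSet_K M.pairwise_disjoint hf

/-! ### Layers of elements -/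

/-- The indices of the elements in `m` layers around the element `j`. -/
def layer (j : Fin M.N) : ℕ → Set (Fin M.N)
  | 0 => {j}
  | m + 1 => {i | ∃ l ∈ layer j m, (closedElem (M.vert l) ∩ closedElem (M.vert i)).Nonempty}

theorem closedElem_inter_self_nonempty (j : Fin M.N) :
    (closedElem (M.vert j) ∩ closedElem (M.vert j)).Nonempty := by
  rw [inter_self, ← M.closure_K]
  exact (M.K_nonempty j).closure

theorem layer_mono (j : Fin M.N) : Monotone (M.layer j) :=
  monotone_nat_of_le_succ fun _ i hi => ⟨i, hi, M.closedElem_inter_self_nonempty i⟩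

theorem self_mem_layer (j : Fin M.N) (m : ℕ) : j ∈ M.layer j m :=
  M.layer_mono j (Nat.zero_le m) (mem_singleton j)

/-- A chain of touching elements can be shortened at either end; this is the inductive step for the
symmetry `mem_layer_comm`. -/
theorem mem_layer_succ_iff {i j : Fin M.N} {m : ℕ} : i ∈ M.layer j (m + 1) ↔
    ∃ l, (closedElem (M.vert j) ∩ closedElem (M.vert l)).Nonempty ∧ i ∈ M.layer l m := by
  induction m generalizing i with
  | zero =>
    constructor
    · rintro ⟨l, hl, h⟩
      rw [mem_singleton_iff.1 hl] at h
      exact ⟨i, h, mem_singleton i⟩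
    · rintro ⟨l, h, hi⟩
      rw [← mem_singleton_iff.1 hi] at h
      exact ⟨j, mem_singleton j, h⟩
  | succ m ih =>
    constructor
    · rintro ⟨l, hl, h⟩
      obtain ⟨l', hl', hll'⟩ := ih.1 hl
      exact ⟨l', hl', l, hll', h⟩
    · rintro ⟨l, hl, l', hl', h⟩
      exact ⟨l', ih.2 ⟨l, hl, hl'⟩, h⟩

theorem mem_layer_comm {i j : Fin M.N} {m : ℕ} : i ∈ M.layer j m ↔ j ∈ M.layer i m := by
  induction m generalizing i j with
  | zero => exact eq_comm
  | succ m ih =>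
    rw [mem_layer_succ_iff]
    constructor
    · rintro ⟨l, hl, hi⟩
      exact ⟨l, ih.1 hi, by rwa [inter_comm]⟩
    · rintro ⟨l, hl, hi⟩
      exact ⟨l, by rwa [inter_comm], ih.2 hl⟩

/-- The union of the closed elements in `m` layers around the element `j`. -/
def layerUnion (j : Fin M.N) (m : ℕ) : Set (E d) := ⋃ i ∈ M.layer j m, closedElem (M.vert i)

theorem isClosed_biUnion_closedElem (s : Set (Fin M.N)) :
    IsClosed (⋃ i ∈ s, closedElem (M.vert i)) :=
  s.toFinite.isClosed_biUnion fun _ _ => isCompact_closedElem.isClosed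

theorem closure_interior_biUnion (s : Set (Fin M.N)) :
    closure (interior (⋃ i ∈ s, closedElem (M.vert i))) = ⋃ i ∈ s, closedElem (M.vert i) := by
  apply Subset.antisymm
  · exact closure_minimal interior_subset (M.isClosed_biUnion_closedElem s)
  · refine iUnion₂_subset fun i hi => ?_
    rw [← M.closure_K]
    refine closure_mono (interior_maximal ?_ (M.isOpen_K i))
    exact openElem_subset_closedElem.trans
      (subset_biUnion_of_mem (u := fun i => closedElem (M.vert i)) hi)

/-- Each closed element is the closure of an open set, so passing to the interior of a union of
closed elements and back to the closure loses nothing. From here on a patch is handled through its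
index set `layer`. -/
theorem closure_patch (j : Fin M.N) (m : ℕ) : closure (M.patch j m) = M.layerUnion j m := by
  induction m with
  | zero => simp [layerUnion, layer, patch, closure_K]
  | succ m ih =>
    have h : (⋃ i ∈ {i : Fin M.N | (closure (M.patch j m) ∩ closure (M.K i)).Nonempty},
        closure (M.K i)) ∪ closure (M.patch j m) = M.layerUnion j (m + 1) := by
      simp only [M.closure_K, ih]
      apply Subset.antisymm
      · refine union_subset (iUnion₂_subset fun i hi => ?_)
          (biUnion_mono (M.layer_mono j (Nat.le_succ m)) fun _ _ => Subset.rfl)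
        obtain ⟨x, hx, hxi⟩ := hi
        obtain ⟨l, hl, hxl⟩ := mem_iUnion₂.1 hx
        exact subset_biUnion_of_mem (u := fun i => closedElem (M.vert i))
          (show i ∈ M.layer j (m + 1) from ⟨l, hl, x, hxl, hxi⟩)
      · refine iUnion₂_subset fun i hi => Subset.trans ?_ subset_union_left
        obtain ⟨l, hl, x, hxl, hxi⟩ := hi
        exact subset_biUnion_of_mem (u := fun i => closedElem (M.vert i))
          (show i ∈ {i : Fin M.N | (M.layerUnion j m ∩ closedElem (M.vert i)).Nonempty} from
            ⟨x, mem_iUnion₂.2 ⟨l, hl, hxl⟩, hxi⟩)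
    rw [patch, h]
    exact M.closure_interior_biUnion _

theorem K_disjoint_closedElem {i j : Fin M.N} (h : i ≠ j) :
    Disjoint (M.K i) (closedElem (M.vert j)) := by
  rw [← M.closure_K]
  exact (M.disjoint i j h).closure_right (M.isOpen_K i)

theorem K_disjoint_layerUnion {i j : Fin M.N} {m : ℕ} (h : i ∉ M.layer j m) :
    Disjoint (M.K i) (M.layerUnion j m) :=
  disjoint_iUnion₂_right.2 fun _ hl => M.K_disjoint_closedElem fun hil => h (hil ▸ hl)

/-- Identifies the elements counted by the overlap assumption with those of `layer`. -/
theorem K_subset_patch_iff {i j : Fin M.N} {m : ℕ} :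
    M.K i ⊆ M.patch j m ↔ i ∈ M.layer j m := by
  constructor
  · intro h
    by_contra hi
    obtain ⟨x, hx⟩ := M.K_nonempty i
    exact (M.K_disjoint_layerUnion hi).le_bot
      ⟨hx, M.closure_patch j m ▸ subset_closure (h hx)⟩
  · intro hi
    cases m with
    | zero => rw [mem_singleton_iff.1 hi]; exact Subset.rfl
    | succ m =>
      refine interior_maximal ?_ (M.isOpen_K i)
      obtain ⟨l, hl, x, hxl, hxi⟩ := hi
      refine Subset.trans ?_ subset_union_left
      refine subset_closure.trans (subset_biUnion_of_mem (u := fun i => closure (M.K i))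
        (show i ∈ {i : Fin M.N | (closure (M.patch j m) ∩ closure (M.K i)).Nonempty} from ?_))
      rw [mem_ofPred_eq, M.closure_K, M.closure_patch]
      exact ⟨x, mem_iUnion₂.2 ⟨l, hl, hxl⟩, hxi⟩

theorem card_layer (j : Fin M.N) (m : ℕ) :
    Nat.card {i : Fin M.N // M.K i ⊆ M.patch j m} = (M.layer j m).ncard := by
  rw [← Nat.card_coe_set_eq]
  exact Nat.card_congr (Equiv.subtypeEquivRight fun i => M.K_subset_patch_iff)

/-! ### Cutoff functions -/

/-- A Lipschitz cutoff function whose gradient is controlled by those of the nodal functions. -/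
structure IsCutoff (L : NNReal) (g : E d → ℝ) : Prop where
  lipschitz : LipschitzWith L g
  mem_Icc : ∀ x, g x ∈ Icc (0 : ℝ) 1
  strict : ∀ j, ∀ x ∈ M.K j, HasStrictFDerivAt g (fderiv ℝ g x) x
  grad_le : ∀ j, ∀ x ∈ M.K j,
    ‖rgrad g x‖ ^ 2 ≤ 2 ^ d * ∑ σ, ‖gradient (lagrange (M.vert j) σ) x‖ ^ 2

/-- The function is the nodal interpolant of the indicator of `U`, extended from the closure of `Ω`
and clipped to `[0, 1]`. On an element it is a sum of some of the `2^d` Lagrange functions, so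
Cauchy–Schwarz bounds its gradient by the sum defining `Ã`. The constant `L` depends on the mesh but
enters no estimate. -/
theorem exists_cutoff (hΩ : IsLipschitzDomain Ω) (U : Set (E d)) :
    ∃ (L : NNReal) (g : E d → ℝ), M.IsCutoff L g ∧
      (∀ j, closedElem (M.vert j) ⊆ U → ∀ x ∈ closedElem (M.vert j), g x = 1) ∧
      (∀ j, Disjoint (closedElem (M.vert j)) U → ∀ x ∈ closedElem (M.vert j), g x = 0) := by
  classical
  set f : E d → ℝ := U.indicator 1 with hf
  have hf01 : ∀ x, f x ∈ Icc (0 : ℝ) 1 := fun x => by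
    by_cases hx : x ∈ U <;> simp [hf, hx]
  obtain ⟨L, hL⟩ := M.exists_lipschitzOnWith_nodal hΩ hf01
  obtain ⟨g₀, hg₀, heq⟩ := hL.extend_real
  set g : E d → ℝ := fun x => max 0 (min 1 (g₀ x)) with hg
  have hgeq : ∀ x ∈ closure Ω, g x = M.nodal f x := by
    intro x hx
    have := M.nodal_mem_Icc hf01 x
    rw [hg]
    simp only [← heq hx, min_eq_right this.2, max_eq_right this.1]
  have hnear : ∀ j, ∀ x ∈ M.K j, g =ᶠ[nhds x]
      fun y => ∑ σ, f (M.vert j σ) * lagrange (M.vert j) σ y := by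
    intro j x hx
    filter_upwards [(M.isOpen_K j).mem_nhds hx] with y hy
    rw [hgeq y (subset_closure (M.K_subset j hy)), M.nodal_eq f (openElem_subset_closedElem hy)]
  have hder : ∀ j, ∀ x ∈ M.K j, HasStrictFDerivAt g
      (∑ σ, f (M.vert j σ) • fderiv ℝ (lagrange (M.vert j) σ) x) x := by
    intro j x hx
    refine HasStrictFDerivAt.congr_of_eventuallyEq ?_ (hnear j x hx).symm
    exact HasStrictFDerivAt.fun_sum fun σ _ =>
      (hasStrictFDerivAt_lagrange (M.injOn j) (M.nondegenerate j) σ hx).const_mul _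
  refine ⟨L, g, ⟨?_, ?_, ?_, ?_⟩, ?_, ?_⟩
  · exact (hg₀.const_min 1).const_max 0
  · exact fun x => ⟨le_max_left _ _, max_le zero_le_one (min_le_left _ _)⟩
  · intro j x hx
    have := hder j x hx
    rwa [this.hasFDerivAt.fderiv]
  · intro j x hx
    rw [norm_rgrad, (hder j x hx).hasFDerivAt.fderiv]
    have h1 : ‖∑ σ, f (M.vert j σ) • fderiv ℝ (lagrange (M.vert j) σ) x‖
        ≤ ∑ σ, ‖gradient (lagrange (M.vert j) σ) x‖ := by
      refine (norm_sum_le _ _).trans (Finset.sum_le_sum fun σ _ => ?_)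
      rw [norm_smul, gradient, LinearIsometryEquiv.norm_map, Real.norm_of_nonneg (hf01 _).1]
      exact mul_le_of_le_one_left (norm_nonneg _) (hf01 _).2
    calc _ ≤ (∑ σ, ‖gradient (lagrange (M.vert j) σ) x‖) ^ 2 :=
          pow_le_pow_left₀ (norm_nonneg _) h1 2
      _ ≤ _ := by
          refine sq_sum_le_card_mul_sum_sq.trans (le_of_eq ?_)
          simp
  · intro j hj x hx
    rw [hgeq x (M.closedElem_subset j hx)]
    exact M.nodal_eq_const hx fun y hy => indicator_of_mem (hj hy) _
  · intro j hj x hx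
    rw [hgeq x (M.closedElem_subset j hx)]
    exact M.nodal_eq_const hx fun y hy => indicator_of_notMem (disjoint_left.1 hj hy) _

theorem IsCutoff.one_sub {M : QuadMesh d Ω} {L : NNReal} {g : E d → ℝ} (hg : M.IsCutoff L g) :
    M.IsCutoff L (fun x => 1 - g x) where
  lipschitz := by
    refine LipschitzWith.of_dist_le_mul fun x y => ?_
    rw [dist_sub_left]
    exact hg.lipschitz.dist_le_mul x y
  mem_Icc x := ⟨sub_nonneg.2 (hg.mem_Icc x).2, by linarith [(hg.mem_Icc x).1]⟩
  strict j x hx := by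
    rw [fderiv_const_sub]
    exact (hg.strict j x hx).const_sub 1
  grad_le j x hx := by
    rw [norm_rgrad, fderiv_const_sub, norm_neg, ← norm_rgrad]
    exact hg.grad_le j x hx

theorem IsCutoff.ae_strict {M : QuadMesh d Ω} {L : NNReal} {g : E d → ℝ} (hg : M.IsCutoff L g) :
    ∀ᵐ x ∂volume.restrict Ω, HasStrictFDerivAt g (fderiv ℝ g x) x :=
  M.ae_restrict_of_forall fun j =>
    (ae_restrict_iff' (M.measurableSet_K j)).2 (Filter.Eventually.of_forall (hg.strict j))

end QuadMesh

/-! ### The Poincaré inequality on convex sets -/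

theorem lintegral_comp_add_smul (f : E d → ℝ≥0∞) (hf : Measurable f) (a : E d) {t : ℝ}
    (ht : 0 < t) : ∫⁻ y, f (a + t • y) = ENNReal.ofReal (t ^ d)⁻¹ * ∫⁻ y, f y := by
  have h1 : ∫⁻ y, f (a + t • y) = ∫⁻ y, f (a + y) ∂(Measure.map (t • ·) (volume : Measure (E d))) := by
    rw [lintegral_map (f := fun y => f (a + y)) (hf.comp (measurable_const_add a))
      (measurable_const_smul t)]
  rw [h1, Measure.map_addHaar_smul volume ht.ne', lintegral_smul_measure,
    lintegral_add_left_eq_self f a, finrank_euclideanSpace, Fintype.card_fin,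
    abs_of_nonneg (by positivity), smul_eq_mul]

/-- For `t ≥ 1/2` the substitution in `y` has Jacobian factor `t^(-d) ≤ 2^d`, and convexity keeps
the combination in `Q`. For `t ≤ 1/2` the roles of `x` and `y` are exchanged. -/
theorem lintegral_lintegral_convexCombo_le {Q : Set (E d)} (hQ : Convex ℝ Q)
    (hQm : MeasurableSet Q) {w : E d → ℝ≥0∞} (hw : Measurable w) {t : ℝ} (ht : t ∈ Icc (0 : ℝ) 1) :
    ∫⁻ x in Q, ∫⁻ y in Q, w ((1 - t) • x + t • y) ≤ 2 ^ d * volume Q * ∫⁻ x in Q, w x := by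
  have key : ∀ t ∈ Icc (1 / 2 : ℝ) 1, ∫⁻ x in Q, ∫⁻ y in Q, w ((1 - t) • x + t • y)
      ≤ 2 ^ d * volume Q * ∫⁻ x in Q, w x := by
    intro t ht
    have ht0 : 0 < t := by linarith [ht.1]
    have hin : ∀ x ∈ Q, ∫⁻ y in Q, w ((1 - t) • x + t • y) ≤ 2 ^ d * ∫⁻ x in Q, w x := by
      intro x hx
      calc ∫⁻ y in Q, w ((1 - t) • x + t • y)
          ≤ ∫⁻ y in Q, Q.indicator w ((1 - t) • x + t • y) := by
            refine setLIntegral_mono' hQm fun y hy => ?_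
            rw [indicator_of_mem (hQ hx hy (by linarith [ht.2]) ht0.le (by ring))]
        _ ≤ ∫⁻ y, Q.indicator w ((1 - t) • x + t • y) := setLIntegral_le_lintegral _ _
        _ = ENNReal.ofReal (t ^ d)⁻¹ * ∫⁻ x in Q, w x := by
            rw [lintegral_comp_add_smul _ (hw.indicator hQm) _ ht0, lintegral_indicator hQm]
        _ ≤ 2 ^ d * ∫⁻ x in Q, w x := by
            gcongr
            rw [show (2 : ℝ≥0∞) ^ d = ENNReal.ofReal (2 ^ d) by
              rw [ENNReal.ofReal_pow (by norm_num)]; norm_num]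
            refine ENNReal.ofReal_le_ofReal ?_
            rw [← inv_pow]
            refine pow_le_pow_left₀ (by positivity) ?_ d
            rw [inv_le_comm₀ ht0 (by norm_num)]
            linarith [ht.1]
    calc _ ≤ ∫⁻ _ in Q, 2 ^ d * ∫⁻ x in Q, w x := setLIntegral_mono' hQm hin
      _ = _ := by rw [setLIntegral_const]; ring
  rcases le_total (1 / 2) t with h | h
  · exact key t ⟨h, ht.2⟩
  · have := key (1 - t) ⟨by linarith, by linarith [ht.1]⟩
    rw [lintegral_lintegral_swap] at this
    · convert this using 6 with x y
      rw [sub_sub_cancel, add_comm]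
    · exact (hw.comp (by fun_prop)).aemeasurable

/-- The fundamental theorem of calculus along the segment, followed by Cauchy–Schwarz in `t`. -/
theorem enorm_sub_sq_le {u : E d → ℂ} (hu : ContDiff ℝ 1 u) (x y : E d) :
    ‖u x - u y‖ₑ ^ 2 ≤ ‖x - y‖ₑ ^ 2 * ∫⁻ t in Ioc (0 : ℝ) 1,
      ‖fderiv ℝ u ((1 - t) • x + t • y)‖ₑ ^ 2 := by
  have hγ : ∀ t : ℝ, HasDerivAt (fun t : ℝ => (1 - t) • x + t • y) (y - x) t := by
    intro t
    have h1 : HasDerivAt (fun t : ℝ => (1 - t) • x + t • y) ((-1 : ℝ) • x + (1 : ℝ) • y) t :=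
      (((hasDerivAt_id t).const_sub 1).smul_const x).add ((hasDerivAt_id t).smul_const y)
    convert h1 using 1
    rw [neg_one_smul, one_smul]; abel
  have hγc : Continuous fun t : ℝ => (1 - t) • x + t • y := by fun_prop
  have hDc : Continuous fun t : ℝ => fderiv ℝ u ((1 - t) • x + t • y) :=
    (hu.continuous_fderiv (by simp)).comp hγc
  have hFTC : ∫ t in (0 : ℝ)..1, fderiv ℝ u ((1 - t) • x + t • y) (y - x) = u y - u x := by
    rw [intervalIntegral.integral_eq_sub_of_hasDerivAt
      (f := fun t : ℝ => u ((1 - t) • x + t • y))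
      (fun t _ => (hu.differentiable (by simp) _).hasFDerivAt.comp_hasDerivAt t (hγ t))]
    · simp
    · exact (hDc.clm_apply continuous_const).intervalIntegrable 0 1
  set f : ℝ → ℝ≥0∞ := fun t => ‖fderiv ℝ u ((1 - t) • x + t • y)‖ₑ with hf
  have hfm : Measurable f := hDc.enorm.measurable
  have h1 : ‖u x - u y‖ₑ ≤ ∫⁻ t in Ioc (0 : ℝ) 1, f t * ‖x - y‖ₑ := by
    rw [← enorm_neg, neg_sub, ← hFTC, intervalIntegral.integral_of_le zero_le_one]
    refine (enorm_integral_le_lintegral_enorm _).trans (lintegral_mono fun t => ?_)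
    rw [← enorm_neg (x - y), neg_sub]
    exact ContinuousLinearMap.le_opENorm _ _
  have h2 : ∫⁻ t in Ioc (0 : ℝ) 1, f t ≤ (∫⁻ t in Ioc (0 : ℝ) 1, f t ^ 2) ^ (1 / 2 : ℝ) := by
    have := ENNReal.lintegral_mul_le_Lp_mul_Lq (volume.restrict (Ioc (0 : ℝ) 1))
      (Real.HolderConjugate.two_two) hfm.aemeasurable (aemeasurable_const (b := (1 : ℝ≥0∞)))
    simpa using this
  calc ‖u x - u y‖ₑ ^ 2 ≤ (∫⁻ t in Ioc (0 : ℝ) 1, f t * ‖x - y‖ₑ) ^ 2 := by gcongr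
    _ = ‖x - y‖ₑ ^ 2 * (∫⁻ t in Ioc (0 : ℝ) 1, f t) ^ 2 := by
        rw [lintegral_mul_const _ hfm, mul_pow, mul_comm]
    _ ≤ ‖x - y‖ₑ ^ 2 * ((∫⁻ t in Ioc (0 : ℝ) 1, f t ^ 2) ^ (1 / 2 : ℝ)) ^ 2 := by gcongr
    _ = _ := by
        congr 1
        rw [← ENNReal.rpow_natCast, ← ENNReal.rpow_mul]
        norm_num
        rfl

/-- Poincaré's inequality on a convex set of diameter at most `h`. -/
theorem exists_poincare {Q : Set (E d)} (hQ : Convex ℝ Q) (hQm : MeasurableSet Q)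
    (hfin : volume Q ≠ ⊤) {h : ℝ≥0∞} (hdiam : ∀ x ∈ Q, ∀ y ∈ Q, ‖x - y‖ₑ ≤ h)
    {u : E d → ℂ} (hu : ContDiff ℝ 1 u) :
    ∃ c : ℂ, ∫⁻ x in Q, ‖u x - c‖ₑ ^ 2 ≤ h ^ 2 * 2 ^ d * ∫⁻ x in Q, ‖fderiv ℝ u x‖ₑ ^ 2 := by
  by_cases h0 : volume Q = 0
  · exact ⟨0, by rw [setLIntegral_measure_zero _ _ h0]; exact zero_le⟩
  set w : E d → ℝ≥0∞ := fun x => ‖fderiv ℝ u x‖ₑ ^ 2 with hw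
  have hwm : Measurable w := ((hu.continuous_fderiv (by simp)).enorm.measurable.pow_const 2)
  have hdouble : ∫⁻ y in Q, ∫⁻ x in Q, ‖u x - u y‖ₑ ^ 2
      ≤ h ^ 2 * (2 ^ d * volume Q * ∫⁻ x in Q, w x) := by
    calc ∫⁻ y in Q, ∫⁻ x in Q, ‖u x - u y‖ₑ ^ 2
        ≤ ∫⁻ y in Q, ∫⁻ x in Q, h ^ 2 * ∫⁻ t in Ioc (0 : ℝ) 1, w ((1 - t) • y + t • x) := by
          refine setLIntegral_mono' hQm fun y hy => setLIntegral_mono' hQm fun x hx => ?_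
          rw [← enorm_neg, neg_sub]
          exact (enorm_sub_sq_le hu y x).trans (by gcongr; exact hdiam y hy x hx)
      _ = h ^ 2 * ∫⁻ t in Ioc (0 : ℝ) 1, ∫⁻ y in Q, ∫⁻ x in Q, w ((1 - t) • y + t • x) := by
          have hm3 : Measurable fun p : (E d × E d) × ℝ =>
              w ((1 - p.2) • p.1.1 + p.2 • p.1.2) := hwm.comp (by fun_prop)
          have e1 : ∀ y, ∫⁻ x in Q, h ^ 2 * ∫⁻ t in Ioc (0 : ℝ) 1, w ((1 - t) • y + t • x)
              = h ^ 2 * ∫⁻ t in Ioc (0 : ℝ) 1, ∫⁻ x in Q, w ((1 - t) • y + t • x) := by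
            intro y
            rw [lintegral_const_mul]
            · rw [lintegral_lintegral_swap]
              exact (hwm.comp (by fun_prop)).aemeasurable
            · exact Measurable.lintegral_prod_right' (f := fun p : E d × ℝ =>
                w ((1 - p.2) • y + p.2 • p.1)) (hwm.comp (by fun_prop))
          simp only [e1]
          rw [lintegral_const_mul, lintegral_lintegral_swap]
          · refine (Measurable.lintegral_prod_right' (f := fun p : (E d × ℝ) × E d =>
              w ((1 - p.1.2) • p.1.1 + p.1.2 • p.2)) (hwm.comp (by fun_prop))).aemeasurable
          · refine Measurable.lintegral_prod_right' (f := fun p : E d × ℝ =>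
              ∫⁻ x in Q, w ((1 - p.2) • p.1 + p.2 • x)) ?_
            exact Measurable.lintegral_prod_right' (f := fun p : (E d × ℝ) × E d =>
              w ((1 - p.1.2) • p.1.1 + p.1.2 • p.2)) (hwm.comp (by fun_prop))
      _ ≤ h ^ 2 * ∫⁻ _ in Ioc (0 : ℝ) 1, 2 ^ d * volume Q * ∫⁻ x in Q, w x := by
          gcongr h ^ 2 * ?_
          exact setLIntegral_mono' measurableSet_Ioc fun t ht =>
            lintegral_lintegral_convexCombo_le hQ hQm hwm (Ioc_subset_Icc_self ht)
      _ = _ := by rw [setLIntegral_const]; simp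
  have hm : Measurable fun y => ∫⁻ x in Q, ‖u x - u y‖ₑ ^ 2 := by
    refine Measurable.lintegral_prod_right' (f := fun p : E d × E d => ‖u p.2 - u p.1‖ₑ ^ 2) ?_
    exact ((hu.continuous.comp continuous_snd).sub
      (hu.continuous.comp continuous_fst)).enorm.measurable.pow_const 2
  -- Some `y` does no worse than the average of the inner integral, so the value `u y` can replace
  -- the mean of `u`.
  obtain ⟨y, _, hy⟩ := exists_le_setLAverage h0 hfin hm.aemeasurable
  refine ⟨u y, hy.trans ?_⟩
  rw [setLAverage_eq, ENNReal.div_le_iff h0 hfin]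
  refine hdouble.trans (le_of_eq ?_)
  ring

/-! ### Rellich's theorem on an element -/

theorem coeFn_sum_Lp {α ι F : Type*} [MeasurableSpace α] {μ : Measure α} [NormedAddCommGroup F]
    (s : Finset ι) (f : ι → Lp F 2 μ) : ⇑(∑ i ∈ s, f i) =ᵐ[μ] fun x => ∑ i ∈ s, f i x := by
  classical
  induction s using Finset.induction_on with
  | empty =>
    filter_upwards [Lp.coeFn_zero F 2 μ] with x hx
    simp only [Finset.sum_empty, hx, Pi.zero_apply]
  | insert i s hi ih =>
    rw [Finset.sum_insert hi]
    filter_upwards [Lp.coeFn_add (f i) (∑ i ∈ s, f i), ih] with x h1 h2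
    rw [h1, Pi.add_apply, h2, Finset.sum_insert hi]

theorem enorm_sq_Lp {α F : Type*} [MeasurableSpace α] {μ : Measure α} [NormedAddCommGroup F]
    (f : Lp F 2 μ) : ‖f‖ₑ ^ 2 = ∫⁻ x, ‖f x‖ₑ ^ 2 ∂μ := by
  rw [Lp.enorm_def, eLpNorm_eq_lintegral_rpow_enorm_toReal two_ne_zero ENNReal.ofNat_ne_top,
    ← ENNReal.rpow_natCast, ← ENNReal.rpow_mul]
  norm_num

theorem norm_fderiv_le_norm_cgrad (φ : E d → ℂ) (x : E d) : ‖fderiv ℝ φ x‖ ≤ ‖cgrad φ x‖ := by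
  refine ContinuousLinearMap.opNorm_le_bound _ (norm_nonneg _) fun v => ?_
  have hv : v = ∑ i, v i • EuclideanSpace.single i (1 : ℝ) := by
    ext j
    simp [Pi.single_apply]
  have h1 : fderiv ℝ φ x v = ∑ i, (v i : ℂ) * cgrad φ x i := by
    conv_lhs => rw [hv, map_sum]
    refine Finset.sum_congr rfl fun i _ => ?_
    rw [map_smul, Complex.real_smul]
    rfl
  have h2 : ‖fderiv ℝ φ x v‖ ≤ ∑ i, ‖cgrad φ x i‖ * ‖v i‖ := by
    rw [h1]
    refine (norm_sum_le _ _).trans (Finset.sum_le_sum fun i _ => ?_)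
    rw [norm_mul, Complex.norm_real, mul_comm]
  refine h2.trans ((Real.sum_mul_le_sqrt_mul_sqrt _ _ _).trans ?_)
  rw [EuclideanSpace.norm_eq, EuclideanSpace.norm_eq]

section Element

variable {P : (Fin d → Bool) → E d} (inj : InjOn (refMap P) (cube d))
  (nd : ∀ x ∈ cube d, (fderiv ℝ (refMap P) x).det ≠ 0)

include inj in
theorem lintegral_refMap_image {Q : Set (E d)} (hQ : Q ⊆ openCube d) (hQm : MeasurableSet Q)
    (g : E d → ℝ≥0∞) : ∫⁻ x in refMap P '' Q, g x
      = ∫⁻ x in Q, ENNReal.ofReal |(fderiv ℝ (refMap P) x).det| * g (refMap P x) :=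
  lintegral_image_eq_lintegral_abs_det_fderiv_mul volume hQm
    (fun x _ => ((contDiff_refMap P).differentiable (by simp) x).hasFDerivAt.hasFDerivWithinAt)
    (inj.mono (hQ.trans openCube_subset_cube)) g

include nd in
theorem exists_bounds_refMap : ∃ a b c : ℝ, 0 < a ∧ ∀ x ∈ cube d,
    a ≤ |(fderiv ℝ (refMap P) x).det| ∧ |(fderiv ℝ (refMap P) x).det| ≤ b ∧
      ‖fderiv ℝ (refMap P) x‖ ≤ c := by
  have hD : Continuous (fderiv ℝ (refMap P)) := (contDiff_refMap P).continuous_fderiv (by simp)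
  have hdet : Continuous fun x => |(fderiv ℝ (refMap P) x).det| :=
    (ContinuousLinearMap.continuous_det.comp hD).abs
  obtain ⟨x0, hx0, h0⟩ := isCompact_cube.exists_isMinOn
    (openCube_nonempty.mono (openCube_subset_cube (d := d))) hdet.continuousOn
  obtain ⟨b, hb⟩ := isCompact_cube.exists_bound_of_continuousOn (hdet.continuousOn (s := cube d))
  obtain ⟨c, hc⟩ := isCompact_cube.exists_bound_of_continuousOn (hD.continuousOn (s := cube d))
  refine ⟨_, b, c, abs_pos.2 (nd x0 hx0), fun x hx => ⟨h0 hx, ?_, hc x hx⟩⟩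
  have := hb x hx
  rwa [Real.norm_of_nonneg (abs_nonneg _)] at this

-- The image of a cell need not be convex, so Poincaré's inequality is applied to `φ ∘ refMap P` on
-- the cell itself. The bounds on the Jacobian hold on the whole cube, hence `C` does not depend on
-- the cell.
include inj nd in
theorem exists_poincare_image : ∃ C : ℝ≥0∞, C ≠ ⊤ ∧ ∀ (Q : Set (E d)), Q ⊆ openCube d →
    Convex ℝ Q → MeasurableSet Q → ∀ h : ℝ≥0∞, (∀ x ∈ Q, ∀ y ∈ Q, ‖x - y‖ₑ ≤ h) →
    ∀ φ : E d → ℂ, ContDiff ℝ ∞ φ → ∃ c : ℂ, ∫⁻ x in refMap P '' Q, ‖φ x - c‖ₑ ^ 2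
      ≤ C * h ^ 2 * ∫⁻ x in refMap P '' Q, ‖fderiv ℝ φ x‖ₑ ^ 2 := by
  obtain ⟨a, b, c₀, ha, hab⟩ := exists_bounds_refMap nd
  set A := ENNReal.ofReal a with hA
  set B := ENNReal.ofReal b
  set L := ENNReal.ofReal c₀
  have hA0 : A ≠ 0 := by simpa [hA] using ha
  refine ⟨B * 2 ^ d * L ^ 2 * A⁻¹, ?_, fun Q hQ hQc hQm h hdiam φ hφ => ?_⟩
  · refine ENNReal.mul_ne_top (ENNReal.mul_ne_top (ENNReal.mul_ne_top ENNReal.ofReal_ne_top ?_) ?_)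
      (ENNReal.inv_ne_top.2 hA0)
    · exact ENNReal.pow_ne_top (by norm_num)
    · exact ENNReal.pow_ne_top ENNReal.ofReal_ne_top
  have hfin : volume Q ≠ ⊤ := ne_top_of_le_ne_top isCompact_cube.measure_lt_top.ne
    (measure_mono (hQ.trans openCube_subset_cube))
  have hφ1 : ContDiff ℝ 1 φ := hφ.of_le (by simp)
  have hF1 : ContDiff ℝ 1 (refMap P) := (contDiff_refMap P).of_le (by simp)
  obtain ⟨c, hc⟩ := exists_poincare hQc hQm hfin hdiam (hφ1.comp hF1)
  refine ⟨c, ?_⟩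
  rw [lintegral_refMap_image inj hQ hQm, lintegral_refMap_image inj hQ hQm]
  calc ∫⁻ x in Q, ENNReal.ofReal |(fderiv ℝ (refMap P) x).det| * ‖φ (refMap P x) - c‖ₑ ^ 2
      ≤ ∫⁻ x in Q, B * ‖(φ ∘ refMap P) x - c‖ₑ ^ 2 := by
        refine setLIntegral_mono' hQm fun x hx => ?_
        gcongr
        · exact ENNReal.ofReal_le_ofReal (hab x (openCube_subset_cube (hQ hx))).2.1
        · rfl
    _ = B * ∫⁻ x in Q, ‖(φ ∘ refMap P) x - c‖ₑ ^ 2 :=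
        lintegral_const_mul' _ _ ENNReal.ofReal_ne_top
    _ ≤ B * (h ^ 2 * 2 ^ d * ∫⁻ x in Q, ‖fderiv ℝ (φ ∘ refMap P) x‖ₑ ^ 2) := by gcongr
    _ ≤ B * (h ^ 2 * 2 ^ d * ∫⁻ x in Q, L ^ 2 * A⁻¹ *
          (ENNReal.ofReal |(fderiv ℝ (refMap P) x).det| * ‖fderiv ℝ φ (refMap P x)‖ₑ ^ 2)) := by
        gcongr B * (h ^ 2 * 2 ^ d * ?_)
        refine setLIntegral_mono' hQm fun x hx => ?_
        have hx' := hab x (openCube_subset_cube (hQ hx))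
        have h1 : ‖fderiv ℝ (φ ∘ refMap P) x‖ₑ ≤ ‖fderiv ℝ φ (refMap P x)‖ₑ * L := by
          rw [fderiv_comp x (hφ1.differentiable (by simp) _) (hF1.differentiable (by simp) _)]
          refine (ContinuousLinearMap.opENorm_comp_le _ _).trans ?_
          gcongr
          rw [← ofReal_norm]
          exact ENNReal.ofReal_le_ofReal hx'.2.2
        have h2 : (1 : ℝ≥0∞) ≤ A⁻¹ * ENNReal.ofReal |(fderiv ℝ (refMap P) x).det| := by
          rw [← ENNReal.inv_mul_cancel hA0 ENNReal.ofReal_ne_top]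
          gcongr
          exact ENNReal.ofReal_le_ofReal hx'.1
        calc _ ≤ (‖fderiv ℝ φ (refMap P x)‖ₑ * L) ^ 2 * 1 := by rw [mul_one]; gcongr
          _ ≤ (‖fderiv ℝ φ (refMap P x)‖ₑ * L) ^ 2
              * (A⁻¹ * ENNReal.ofReal |(fderiv ℝ (refMap P) x).det|) := by gcongr
          _ = _ := by ring
    _ = _ := by
        rw [lintegral_const_mul' _ _ (ENNReal.mul_ne_top (ENNReal.pow_ne_top ENNReal.ofReal_ne_top)
          (ENNReal.inv_ne_top.2 hA0))]
        ring

/-- The cells of the reference cube of side length `1 / (n + 1)`. -/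
def cell (n : ℕ) (z : Fin d → Fin (n + 1)) : Set (E d) :=
  openCube d ∩ (EuclideanSpace.equiv (Fin d) ℝ) ⁻¹'
    Set.pi univ fun i => Ico ((z i : ℝ) / (n + 1)) (((z i : ℝ) + 1) / (n + 1))

theorem cell_subset (n : ℕ) (z : Fin d → Fin (n + 1)) : cell n z ⊆ openCube d := inter_subset_left

theorem convex_cell (n : ℕ) (z : Fin d → Fin (n + 1)) : Convex ℝ (cell n z) :=
  convex_openCube.inter ((convex_pi fun _ _ => convex_Ico _ _).linear_preimage
    (EuclideanSpace.equiv (Fin d) ℝ).toLinearEquiv.toLinearMap)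

theorem measurableSet_cell (n : ℕ) (z : Fin d → Fin (n + 1)) : MeasurableSet (cell n z) :=
  isOpen_openCube.measurableSet.inter ((MeasurableSet.univ_pi fun _ => measurableSet_Ico).preimage
    (EuclideanSpace.equiv (Fin d) ℝ).continuous.measurable)

theorem mem_cell_iff {n : ℕ} {z : Fin d → Fin (n + 1)} {x : E d} (hx : x ∈ openCube d) :
    x ∈ cell n z ↔ ∀ i, ⌊x i * (n + 1)⌋₊ = z i := by
  have h1 : x ∈ cell n z ↔ ∀ i, (z i : ℝ) / (n + 1) ≤ x i ∧ x i < ((z i : ℝ) + 1) / (n + 1) :=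
    ⟨fun h i => h.2 i (mem_univ i), fun h => ⟨hx, fun i _ => h i⟩⟩
  rw [h1]
  refine forall_congr' fun i => ?_
  have hn : (0 : ℝ) < n + 1 := by positivity
  rw [div_le_iff₀ hn, lt_div_iff₀ hn, Nat.floor_eq_iff (mul_nonneg (hx i).1.le hn.le)]

theorem iUnion_cell (n : ℕ) : ⋃ z, cell (d := d) n z = openCube d := by
  apply Subset.antisymm (iUnion_subset fun z => cell_subset n z)
  intro x hx
  refine mem_iUnion.2 ⟨fun i => ⟨⌊x i * (n + 1)⌋₊, ?_⟩, (mem_cell_iff hx).2 fun i => rfl⟩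
  rw [Nat.floor_lt (mul_nonneg (hx i).1.le (by positivity))]
  push_cast
  exact mul_lt_of_lt_one_left (by positivity) (hx i).2

theorem disjoint_cell {n : ℕ} {z w : Fin d → Fin (n + 1)} (h : z ≠ w) :
    Disjoint (cell n z) (cell n w) := by
  rw [disjoint_left]
  intro x hx hx'
  refine h (funext fun i => Fin.ext ?_)
  rw [← (mem_cell_iff hx.1).1 hx i, ← (mem_cell_iff hx.1).1 hx' i]

theorem enorm_sub_le_of_mem_cell {n : ℕ} {z : Fin d → Fin (n + 1)} {x y : E d}
    (hx : x ∈ cell n z) (hy : y ∈ cell n z) :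
    ‖x - y‖ₑ ≤ ENNReal.ofReal (Real.sqrt d * (1 / ((n : ℝ) + 1))) := by
  rw [← ofReal_norm]
  refine ENNReal.ofReal_le_ofReal ?_
  rw [EuclideanSpace.norm_eq]
  have h : ∀ i, ‖(x - y) i‖ ^ 2 ≤ (1 / ((n : ℝ) + 1)) ^ 2 := by
    intro i
    have h1 := hx.2 i (mem_univ i)
    have h2 := hy.2 i (mem_univ i)
    have h3 : ((z i : ℝ) + 1) / (n + 1) = (z i : ℝ) / (n + 1) + 1 / (n + 1) := add_div _ _ _
    refine pow_le_pow_left₀ (norm_nonneg _) ?_ 2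
    rw [Real.norm_eq_abs, abs_le]
    simp only [mem_Ico, h3] at h1 h2
    have e1 : (x - y) i = (EuclideanSpace.equiv (Fin d) ℝ) x i
      - (EuclideanSpace.equiv (Fin d) ℝ) y i := rfl
    rw [e1]
    constructor <;> linarith [h1.1, h1.2, h2.1, h2.2]
  calc _ ≤ Real.sqrt (∑ _i : Fin d, (1 / ((n : ℝ) + 1)) ^ 2) :=
        Real.sqrt_le_sqrt (Finset.sum_le_sum fun i _ => h i)
    _ = _ := by
        rw [Finset.sum_const, Finset.card_univ, Fintype.card_fin, nsmul_eq_mul,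
          Real.sqrt_mul (Nat.cast_nonneg d), Real.sqrt_sq (by positivity)]

include inj in
theorem measurableSet_image_cell (n : ℕ) (z : Fin d → Fin (n + 1)) :
    MeasurableSet (refMap P '' cell n z) :=
  (measurableSet_cell n z).image_of_continuousOn_injOn (contDiff_refMap P).continuous.continuousOn
    (inj.mono ((cell_subset n z).trans openCube_subset_cube))

theorem image_cell_subset (n : ℕ) (z : Fin d → Fin (n + 1)) :
    refMap P '' cell n z ⊆ openElem P := image_mono (cell_subset n z)

theorem restrict_image_cell_ne_top (n : ℕ) (z : Fin d → Fin (n + 1)) :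
    volume.restrict (openElem P) (refMap P '' cell n z) ≠ ⊤ :=
  ne_top_of_le_ne_top (isCompact_closedElem (P := P)).measure_lt_top.ne
    ((measure_mono ((image_cell_subset n z).trans openElem_subset_closedElem)).trans'
      (Measure.restrict_apply_le _ _))

theorem iUnion_image_cell (n : ℕ) :
    ⋃ z : Fin d → Fin (n + 1), refMap P '' cell n z = openElem P := by
  rw [← image_iUnion, iUnion_cell]; rfl

include inj in
theorem disjoint_image_cell {n : ℕ} {z w : Fin d → Fin (n + 1)} (h : z ≠ w) :
    Disjoint (refMap P '' cell n z) (refMap P '' cell n w) :=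
  (disjoint_cell h).image inj ((cell_subset n z).trans openCube_subset_cube)
    ((cell_subset n w).trans openCube_subset_cube)

/-- The piecewise constant functions on the cells of an element. -/
def cellSpace (inj : InjOn (refMap P) (cube d)) (n : ℕ) :
    Submodule ℂ (Lp ℂ 2 (volume.restrict (openElem P))) :=
  Submodule.span ℂ (range fun z : Fin d → Fin (n + 1) =>
    indicatorConstLp 2 (measurableSet_image_cell inj n z) (restrict_image_cell_ne_top n z) (1 : ℂ))

instance (n : ℕ) : FiniteDimensional ℂ (cellSpace inj n) :=
  FiniteDimensional.span_of_finite ℂ (finite_range _)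

-- On each curved cell the constant from Poincaré's inequality is used; the squared errors add up
-- because the cells partition the element.
include nd in
theorem exists_cellSpace_approx : ∃ C : ℝ≥0∞, C ≠ ⊤ ∧ ∀ n, ∀ U ∈ smoothTriples (openElem P) ∅,
    ∃ w ∈ cellSpace inj n, ‖U.1 - w‖ₑ ^ 2
      ≤ C * ENNReal.ofReal (Real.sqrt d * (1 / ((n : ℝ) + 1))) ^ 2 * ‖U.2.1‖ₑ ^ 2 := by
  obtain ⟨C, hC, hP⟩ := exists_poincare_image inj nd
  refine ⟨C, hC, fun n U hU => ?_⟩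
  obtain ⟨φ, hφ, -, h1, h2, -⟩ := hU
  choose c hc using fun z => hP (cell n z) (cell_subset n z) (convex_cell n z)
    (measurableSet_cell n z) _ (fun x hx y hy => enorm_sub_le_of_mem_cell hx hy) φ hφ
  set ind := fun z : Fin d → Fin (n + 1) => indicatorConstLp 2 (measurableSet_image_cell inj n z)
    (restrict_image_cell_ne_top n z) (1 : ℂ) with hind
  refine ⟨∑ z, c z • ind z, Submodule.sum_mem _ fun z _ => Submodule.smul_mem _ _
    (Submodule.subset_span ⟨z, rfl⟩), ?_⟩
  have hunion := iUnion_image_cell (P := P) n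
  have hdisj : Pairwise (Function.onFun Disjoint fun z => refMap P '' cell n z) :=
    fun z w h => disjoint_image_cell inj h
  have hw : ∀ᵐ x ∂volume.restrict (openElem P), ∀ z, x ∈ refMap P '' cell n z →
      (U.1 - ∑ z, c z • ind z : Lp ℂ 2 (volume.restrict (openElem P))) x = φ x - c z := by
    have hi := ae_all_iff.2 fun z => indicatorConstLp_coeFn (p := 2)
      (hs := measurableSet_image_cell inj n z) (hμs := restrict_image_cell_ne_top n z)
      (c := (1 : ℂ))
    have hsm := ae_all_iff.2 fun z => Lp.coeFn_smul (c z) (ind z)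
    filter_upwards [Lp.coeFn_sub U.1 (∑ z, c z • ind z), h1,
      coeFn_sum_Lp Finset.univ fun z => c z • ind z, hi, hsm] with x e1 e2 e3 e4 e5 z hz
    rw [e1, Pi.sub_apply, e2, e3]
    congr 1
    rw [Finset.sum_eq_single z]
    · rw [e5, Pi.smul_apply, hind, e4, indicator_of_mem hz, smul_eq_mul, mul_one]
    · intro w _ hwz
      rw [e5, Pi.smul_apply, hind, e4,
        indicator_of_notMem (disjoint_left.1 (disjoint_image_cell inj hwz.symm) hz), smul_zero]
    · simp
  rw [enorm_sq_Lp, enorm_sq_Lp]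
  have split : ∀ g : E d → ℝ≥0∞, ∫⁻ x in openElem P, g x
      = ∑ z : Fin d → Fin (n + 1), ∫⁻ x in refMap P '' cell n z, g x := by
    intro g
    rw [← hunion, lintegral_iUnion (fun z => measurableSet_image_cell inj n z) hdisj,
      tsum_fintype]
  rw [split, split, Finset.mul_sum]
  refine Finset.sum_le_sum fun z _ => ?_
  calc _ = ∫⁻ x in refMap P '' cell n z, ‖φ x - c z‖ₑ ^ 2 := by
        refine setLIntegral_congr_fun_ae (measurableSet_image_cell inj n z) ?_
        filter_upwards [(ae_restrict_iff' (isOpen_openElem nd).measurableSet).1 hw] with x hx hxz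
        rw [hx (image_cell_subset n z hxz) z hxz]
    _ ≤ _ := hc z
    _ ≤ _ := by
        refine mul_le_mul_right ?_ _
        refine setLIntegral_mono_ae' (measurableSet_image_cell inj n z) ?_
        filter_upwards [(ae_restrict_iff' (isOpen_openElem nd).measurableSet).1 h2] with x hx hxz
        rw [hx (image_cell_subset n z hxz)]
        gcongr
        rw [← ofReal_norm, ← ofReal_norm]
        exact ENNReal.ofReal_le_ofReal (norm_fderiv_le_norm_cgrad φ x)

-- With the best approximation in place of an unspecified one, the estimate is a closed condition on
-- `U` and passes from smooth triples to their closure.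
include nd in
theorem norm_sub_starProjection_cellSpace_le : ∃ C : ℝ, ∀ n, ∀ U ∈ H1 (openElem P) ∅,
    ‖U.1 - (cellSpace inj n).starProjection U.1‖ ≤ C * (1 / ((n : ℝ) + 1)) * ‖U.2.1‖ := by
  obtain ⟨C, hC, happ⟩ := exists_cellSpace_approx inj nd
  refine ⟨Real.sqrt C.toReal * Real.sqrt d, fun n => ?_⟩
  have hcl : IsClosed {U : Triple (openElem P) ∅ | ‖U.1 - (cellSpace inj n).starProjection U.1‖
      ≤ Real.sqrt C.toReal * Real.sqrt d * (1 / ((n : ℝ) + 1)) * ‖U.2.1‖} :=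
    isClosed_le (by fun_prop) (by fun_prop)
  intro U hU
  have hU' : U ∈ closure (smoothTriples (openElem P) ∅ : Set (Triple (openElem P) ∅)) := hU
  refine closure_minimal ?_ hcl hU'
  intro U hU
  obtain ⟨w, hw, hle⟩ := happ n U hU
  have h1 : ‖U.1 - (cellSpace inj n).starProjection U.1‖ ≤ ‖U.1 - w‖ := by
    rw [Submodule.starProjection_minimal]
    exact ciInf_le ⟨0, by rintro _ ⟨x, rfl⟩; exact norm_nonneg _⟩ (⟨w, hw⟩ : cellSpace inj n)
  refine h1.trans ?_
  refine le_of_sq_le_sq ?_ (by positivity)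
  have h2 := ENNReal.toReal_mono (ENNReal.mul_ne_top (ENNReal.mul_ne_top hC
    (ENNReal.pow_ne_top ENNReal.ofReal_ne_top)) (ENNReal.pow_ne_top enorm_ne_top)) hle
  rw [ENNReal.toReal_mul, ENNReal.toReal_mul, ENNReal.toReal_pow, ENNReal.toReal_pow,
    ENNReal.toReal_pow, toReal_enorm, toReal_enorm, ENNReal.toReal_ofReal (by positivity)] at h2
  refine h2.trans (le_of_eq ?_)
  rw [mul_pow, mul_pow, mul_pow, mul_pow, Real.sq_sqrt ENNReal.toReal_nonneg]
  ring

/-- The embedding of `H¹` of an element into `L²`. -/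
def embedL2 (D : Set (E d)) : H1 D ∅ →L[ℂ] Lp ℂ 2 (volume.restrict D) :=
  (ContinuousLinearMap.fst ℂ _ _).comp (H1 D ∅).subtypeL

include inj nd in
/-- Rellich's theorem on an element. -/
theorem isCompactOperator_embedL2 : IsCompactOperator (embedL2 (openElem P)) := by
  obtain ⟨C, hC⟩ := norm_sub_starProjection_cellSpace_le inj nd
  -- The embedding is the norm limit of its compositions with projections of finite rank.
  refine isCompactOperator_of_tendsto (l := Filter.atTop)
    (F := fun n => (cellSpace inj n).starProjection.comp (embedL2 (openElem P))) ?_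
    (Filter.Eventually.of_forall fun n => ?_)
  · rw [tendsto_iff_norm_sub_tendsto_zero]
    have hlim : Filter.Tendsto (fun n : ℕ => |C| * (1 / ((n : ℝ) + 1))) Filter.atTop (nhds 0) := by
      simpa using (tendsto_one_div_add_atTop_nhds_zero_nat (𝕜 := ℝ)).const_mul |C|
    refine squeeze_zero (fun _ => norm_nonneg _) (fun n => ?_) hlim
    refine ContinuousLinearMap.opNorm_le_bound _ (by positivity) fun U => ?_
    rw [sub_apply, ← norm_neg, neg_sub]
    refine (hC n U U.2).trans ?_
    gcongr
    · exact le_abs_self C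
    · exact (norm_fst_le U.1.2).trans (norm_snd_le U.1)
  · exact (isCompactOperator_of_locallyCompactSpace_rng (cellSpace inj n).subtypeL).comp_clm
      ((cellSpace inj n).orthogonalProjectionOnto.comp (embedL2 (openElem P)))

end Element

/-! ### The spectral gap -/

section Rayleigh

variable {V 𝒢 𝒮 : Type*} [NormedAddCommGroup V] [NormedSpace ℂ V]
  [NormedAddCommGroup 𝒢] [InnerProductSpace ℂ 𝒢] [NormedAddCommGroup 𝒮] [InnerProductSpace ℂ 𝒮]
  (G : V →L[ℂ] 𝒢) (S : V →L[ℂ] 𝒮)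

theorem norm_add_sq_complex {F : Type*} [NormedAddCommGroup F] [InnerProductSpace ℂ F] (x y : F)
    (t : ℝ) : ‖x + (t : ℂ) • y‖ ^ 2 = ‖x‖ ^ 2 + 2 * t * (inner ℂ y x).re + t ^ 2 * ‖y‖ ^ 2 := by
  rw [@norm_add_sq ℂ, norm_smul, Complex.norm_real, mul_pow, Real.norm_eq_abs, sq_abs,
    inner_smul_right, RCLike.re_to_complex, Complex.re_ofReal_mul]
  have h : (inner ℂ x y).re = (inner ℂ y x).re := inner_re_symm (𝕜 := ℂ) x y
  rw [h]
  ring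

theorem eq_zero_of_quadratic_nonneg {a b : ℝ} (h : ∀ t : ℝ, 0 ≤ t * a + t ^ 2 * b) : a = 0 := by
  -- At this `t` the expression is at most `-a² / (|b| + 1)²`; the `+ 1` covers `b = 0`.
  have h1 := h (-a / (|b| + 1))
  have hpos : 0 < |b| + 1 := by positivity
  have h2 : -a / (|b| + 1) * a + (-a / (|b| + 1)) ^ 2 * b
      ≤ -(a ^ 2 / (|b| + 1) ^ 2) := by
    have h3 : (-a / (|b| + 1)) ^ 2 * b ≤ (-a / (|b| + 1)) ^ 2 * |b| :=
      mul_le_mul_of_nonneg_left (le_abs_self b) (sq_nonneg _)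
    refine (add_le_add_right h3 _).trans (le_of_eq ?_)
    field_simp
    ring
  have h4 : a ^ 2 / (|b| + 1) ^ 2 ≤ 0 := by linarith
  have h5 : 0 ≤ a ^ 2 / (|b| + 1) ^ 2 := by positivity
  have h6 : a ^ 2 / (|b| + 1) ^ 2 = 0 := le_antisymm h4 h5
  rw [div_eq_zero_iff] at h6
  rcases h6 with h6 | h6
  · exact pow_eq_zero_iff two_ne_zero |>.1 h6
  · exact absurd h6 (by positivity)

variable {G S}

/-- First-order optimality of a minimizer of the Rayleigh quotient. -/
theorem inner_eq_of_minimizer {Y : Submodule ℂ V} {μ : ℝ} (hμ : ∀ v ∈ Y, μ * ‖S v‖ ^ 2 ≤ ‖G v‖ ^ 2)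
    {v : V} (hv : v ∈ Y) (heq : ‖G v‖ ^ 2 = μ * ‖S v‖ ^ 2) {w : V} (hw : w ∈ Y) :
    inner ℂ (G w) (G v) = μ * inner ℂ (S w) (S v) := by
  have key : ∀ z ∈ Y, (inner ℂ (G z) (G v) - μ * inner ℂ (S z) (S v)).re = 0 := by
    intro z hz
    have := eq_zero_of_quadratic_nonneg
      (a := 2 * (inner ℂ (G z) (G v) - μ * inner ℂ (S z) (S v)).re)
      (b := ‖G z‖ ^ 2 - μ * ‖S z‖ ^ 2) fun t => ?_
    · linarith
    · have h := hμ (v + (t : ℂ) • z) (Y.add_mem hv (Y.smul_mem _ hz))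
      rw [map_add, map_add, map_smul, map_smul, norm_add_sq_complex, norm_add_sq_complex] at h
      rw [Complex.sub_re, Complex.re_ofReal_mul]
      linarith
  have h1 := key w hw
  -- The direction `i w` yields the imaginary part of the identity.
  have h2 := key (Complex.I • w) (Y.smul_mem _ hw)
  rw [map_smul, map_smul, inner_smul_left, inner_smul_left] at h2
  rw [← sub_eq_zero]
  refine Complex.ext h1 ?_
  simp only [Complex.conj_I, Complex.sub_re, Complex.neg_re, Complex.mul_re, Complex.I_re,
    Complex.I_im, Complex.ofReal_re, Complex.ofReal_im, Complex.neg_im, Complex.mul_im] at h2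
  simp only [Complex.sub_im, Complex.mul_im, Complex.ofReal_re, Complex.ofReal_im, Complex.zero_im]
  linarith

/-- The Rayleigh quotient attains its infimum over a closed subspace. -/
theorem exists_minimizer [CompleteSpace V] (hS : IsCompactOperator S) {C : ℝ}
    (hC : ∀ u, ‖u‖ ≤ C * (‖G u‖ + ‖S u‖)) {Y : Submodule ℂ V} (hY : IsClosed (Y : Set V))
    {v₀ : V} (hv₀ : v₀ ∈ Y) (hS₀ : S v₀ ≠ 0) :
    ∃ μ : ℝ, ∃ v ∈ Y, (∀ u ∈ Y, μ * ‖S u‖ ^ 2 ≤ ‖G u‖ ^ 2) ∧ ‖S v‖ = 1 ∧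
      ‖G v‖ ^ 2 = μ * ‖S v‖ ^ 2 := by
  set A : Set ℝ := (fun v => ‖G v‖ ^ 2) '' {v | v ∈ Y ∧ ‖S v‖ = 1} with hA
  have hnorm : ∀ u ∈ Y, S u ≠ 0 → ((‖S u‖⁻¹ : ℝ) : ℂ) • u ∈ {v | v ∈ Y ∧ ‖S v‖ = 1} := by
    intro u hu hSu
    refine ⟨Y.smul_mem _ hu, ?_⟩
    rw [map_smul, norm_smul, Complex.norm_real, norm_inv, norm_norm,
      inv_mul_cancel₀ (norm_ne_zero_iff.2 hSu)]
  have hne : A.Nonempty := ⟨_, mem_image_of_mem _ (hnorm v₀ hv₀ hS₀)⟩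
  have hbdd : BddBelow A := ⟨0, by rintro _ ⟨v, _, rfl⟩; positivity⟩
  set μ := sInf A
  have hμ0 : 0 ≤ μ := le_csInf hne (by rintro _ ⟨v, _, rfl⟩; positivity)
  have hμ : ∀ u ∈ Y, μ * ‖S u‖ ^ 2 ≤ ‖G u‖ ^ 2 := by
    intro u hu
    by_cases hSu : S u = 0
    · rw [hSu, norm_zero]; simp only [ne_eq, OfNat.ofNat_ne_zero, not_false_eq_true, zero_pow,
        mul_zero]; positivity
    · have h := csInf_le hbdd (mem_image_of_mem _ (hnorm u hu hSu))
      simp only [map_smul, norm_smul, Complex.norm_real, norm_inv, norm_norm, mul_pow,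
        inv_pow] at h
      rwa [inv_mul_eq_div, le_div_iff₀ (by positivity)] at h
  obtain ⟨a, -, ha, haA⟩ := exists_seq_tendsto_sInf hne hbdd
  choose v hv hva using haA
  have hbound : Bornology.IsBounded (range v) := by
    obtain ⟨B, hB⟩ := ha.bddAbove_range
    refine isBounded_iff_forall_norm_le.2 ⟨|C| * (B + 1 + 1), ?_⟩
    rintro _ ⟨n, rfl⟩
    have h1 : ‖G (v n)‖ ≤ B + 1 := by
      have h2 : ‖G (v n)‖ ^ 2 ≤ B := by
        have := hB (mem_range_self n)
        rwa [← hva n] at this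
      nlinarith [sq_nonneg (‖G (v n)‖ - 1)]
    refine (hC _).trans ?_
    rw [(hv n).2]
    refine (mul_le_mul_of_nonneg_right (le_abs_self C) (by positivity)).trans ?_
    gcongr
  obtain ⟨K, hK, hSK⟩ := hS.image_subset_compact_of_bounded (f := S.toLinearMap) hbound
  obtain ⟨s, -, ψ, hψ, hlim⟩ := hK.tendsto_subseq (x := fun n => S (v n))
    fun n => hSK ⟨v n, mem_range_self n, rfl⟩
  -- Compactness makes a subsequence of `S (v n)` Cauchy. The parallelogram law, with the lower
  -- bound by `μ` applied to `v n + v m`, transfers this to `G (v n)`, so the subsequence converges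
  -- strongly.
  have hpar : ∀ n m, ‖G (v n) - G (v m)‖ ^ 2
      ≤ 2 * a n + 2 * a m - 4 * μ + μ * ‖S (v n) - S (v m)‖ ^ 2 := by
    intro n m
    have h1 := parallelogram_law_with_norm ℂ (G (v n)) (G (v m))
    have h2 := parallelogram_law_with_norm ℂ (S (v n)) (S (v m))
    have h3 := hμ (v n + v m) (Y.add_mem (hv n).1 (hv m).1)
    rw [map_add, map_add] at h3
    have h4 := hva n
    have h5 := hva m
    rw [(hv n).2, (hv m).2] at h2
    simp only at h4 h5
    have h6 : ‖S (v n) + S (v m)‖ ^ 2 = 4 - ‖S (v n) - S (v m)‖ ^ 2 := by linarith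
    rw [h6] at h3
    nlinarith
  have hSc : CauchySeq fun n => S (v (ψ n)) := hlim.cauchySeq
  have hSd := cauchySeq_iff_tendsto_dist_atTop_0.1 hSc
  have haψ : Filter.Tendsto (fun n => a (ψ n)) Filter.atTop (nhds μ) := ha.comp hψ.tendsto_atTop
  have hGd : Filter.Tendsto (fun p : ℕ × ℕ => dist (G (v (ψ p.1))) (G (v (ψ p.2)))) Filter.atTop
      (nhds 0) := by
    have hfst : Filter.Tendsto (fun p : ℕ × ℕ => a (ψ p.1)) Filter.atTop (nhds μ) := by
      rw [← Filter.prod_atTop_atTop_eq]; exact haψ.comp Filter.tendsto_fst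
    have hsnd : Filter.Tendsto (fun p : ℕ × ℕ => a (ψ p.2)) Filter.atTop (nhds μ) := by
      rw [← Filter.prod_atTop_atTop_eq]; exact haψ.comp Filter.tendsto_snd
    have hR : Filter.Tendsto (fun p : ℕ × ℕ => Real.sqrt (2 * a (ψ p.1) + 2 * a (ψ p.2) - 4 * μ
        + μ * dist (S (v (ψ p.1))) (S (v (ψ p.2))) ^ 2)) Filter.atTop (nhds 0) := by
      have := ((((hfst.const_mul 2).add (hsnd.const_mul 2)).sub_const (4 * μ)).add
        ((hSd.pow 2).const_mul μ)).sqrt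
      convert this using 2
      rw [show 2 * μ + 2 * μ - 4 * μ + μ * 0 ^ 2 = 0 by ring, Real.sqrt_zero]
    refine squeeze_zero (fun _ => dist_nonneg) (fun p => Real.le_sqrt_of_sq_le ?_) hR
    rw [dist_eq_norm, dist_eq_norm]
    exact hpar _ _
  have hvc : CauchySeq fun n => v (ψ n) := by
    rw [cauchySeq_iff_tendsto_dist_atTop_0]
    have hR := (hGd.add hSd).const_mul C
    rw [add_zero, mul_zero] at hR
    refine squeeze_zero (fun _ => dist_nonneg) (fun p => ?_) hR
    have := hC (v (ψ p.1) - v (ψ p.2))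
    rwa [map_sub, map_sub, ← dist_eq_norm, ← dist_eq_norm, ← dist_eq_norm] at this
  obtain ⟨u, hu⟩ := cauchySeq_tendsto_of_complete hvc
  have hGu : ‖G u‖ ^ 2 = μ := by
    refine tendsto_nhds_unique (((G.continuous.tendsto u).comp hu).norm.pow 2) ?_
    refine haψ.congr fun n => ?_
    exact (hva (ψ n)).symm
  have hSu : ‖S u‖ = 1 := by
    refine tendsto_nhds_unique ((S.continuous.tendsto u).comp hu).norm ?_
    refine tendsto_const_nhds.congr fun n => ?_
    exact ((hv (ψ n)).2).symm
  refine ⟨μ, u, hY.mem_of_tendsto hu (Filter.Eventually.of_forall fun n => (hv _).1), hμ, hSu, ?_⟩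
  rw [hGu, hSu]; ring

/-- If a list of eigenpairs of `⟪G v, G φ⟫ = lam ⟪S v, S φ⟫` is complete, then the Rayleigh
quotient on the orthogonal complement of the first `l` eigenvectors is at least the infimum of
the remaining eigenvalues. -/
theorem rayleigh_bound [CompleteSpace V] (hS : IsCompactOperator S) {C : ℝ}
    (hC : ∀ u, ‖u‖ ≤ C * (‖G u‖ + ‖S u‖)) {lam : ℕ → ℝ} {φ : ℕ → V}
    (heig : ∀ i v, inner ℂ (G v) (G (φ i)) = lam i * inner ℂ (S v) (S (φ i)))
    (horth : ∀ i i', i ≠ i' → inner ℂ (S (φ i)) (S (φ i')) = 0) (hne : ∀ i, S (φ i) ≠ 0)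
    (hall : ∀ (μ : ℝ) (w : V), (∀ v, inner ℂ (G v) (G w) = μ * inner ℂ (S v) (S w)) →
      (∀ i, inner ℂ (S (φ i)) (S w) = 0) → w = 0)
    {l : ℕ} {Λ : ℝ} (hΛ : ∀ i, l ≤ i → Λ ≤ lam i) {v : V}
    (hv : ∀ i < l, inner ℂ (S (φ i)) (S v) = 0) : Λ * ‖S v‖ ^ 2 ≤ ‖G v‖ ^ 2 := by
  -- Otherwise the minimizer of the Rayleigh quotient over the complement of the first `l`
  -- eigenvectors would be an eigenvector with eigenvalue below `Λ` that is missing from the list.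
  by_contra! hcon
  set T : V →L[ℂ] (Fin l → ℂ) :=
    ContinuousLinearMap.pi fun i : Fin l => (innerSL ℂ (S (φ i))).comp S with hT
  set Y : Submodule ℂ V := LinearMap.ker T.toLinearMap with hYdef
  have hmem : ∀ u, u ∈ Y ↔ ∀ i < l, inner ℂ (S (φ i)) (S u) = 0 := by
    intro u
    rw [hYdef, LinearMap.mem_ker]
    constructor
    · intro h i hi
      exact congrFun h ⟨i, hi⟩
    · intro h
      exact funext fun i => h i i.2
  have hY : IsClosed (Y : Set V) := T.isClosed_ker
  have hSv : S v ≠ 0 := by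
    intro h
    rw [h, norm_zero] at hcon
    have := sq_nonneg ‖G v‖
    simp only [ne_eq, OfNat.ofNat_ne_zero, not_false_eq_true, zero_pow, mul_zero] at hcon
    linarith
  obtain ⟨μ, u, hu, hμ, hSu, hGu⟩ := exists_minimizer hS hC hY ((hmem v).2 hv) hSv
  have hμΛ : μ < Λ := by
    have h1 := hμ v ((hmem v).2 hv)
    have h2 : 0 < ‖S v‖ ^ 2 := by positivity
    exact lt_of_mul_lt_mul_right (h1.trans_lt hcon) h2.le
  -- Optimality gives the eigenvalue equation for test vectors in `Y` only. The remaining part of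
  -- `w` is a combination of the first `l` eigenvectors, on which both sides vanish.
  have heu : ∀ w, inner ℂ (G w) (G u) = μ * inner ℂ (S w) (S u) := by
    intro w
    set c : ℕ → ℂ := fun i => inner ℂ (S (φ i)) (S w) / inner ℂ (S (φ i)) (S (φ i)) with hc
    set w' := w - ∑ i ∈ Finset.range l, c i • φ i with hw'
    have hw'Y : w' ∈ Y := by
      rw [hmem]
      intro i hi
      rw [hw', map_sub, map_sum, inner_sub_right, inner_sum, Finset.sum_eq_single i]
      · rw [map_smul, inner_smul_right, hc]
        simp only
        rw [div_mul_cancel₀ _ (inner_self_ne_zero.2 (hne i)), sub_self]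
      · intro i' _ hii'
        rw [map_smul, inner_smul_right, horth i i' hii'.symm, mul_zero]
      · intro h; exact absurd (Finset.mem_range.2 hi) h
    have hsplit : w = w' + ∑ i ∈ Finset.range l, c i • φ i := by rw [hw']; abel
    have hφu : ∀ i < l, inner ℂ (S (φ i)) (S u) = 0 ∧ inner ℂ (G (φ i)) (G u) = 0 := by
      intro i hi
      have h1 := (hmem u).1 hu i hi
      refine ⟨h1, ?_⟩
      rw [← inner_conj_symm, heig i u, ← inner_conj_symm (S u), h1]
      simp
    rw [hsplit, map_add, map_add, inner_add_left, inner_add_left,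
      inner_eq_of_minimizer hμ hu hGu hw'Y, map_sum, map_sum, sum_inner, sum_inner,
      Finset.sum_eq_zero, Finset.sum_eq_zero]
    · simp
    · intro i hi
      rw [map_smul, inner_smul_left, (hφu i (Finset.mem_range.1 hi)).1, mul_zero]
    · intro i hi
      rw [map_smul, inner_smul_left, (hφu i (Finset.mem_range.1 hi)).2, mul_zero]
  -- Orthogonality to the first `l` eigenvectors is membership in `Y`; to the others it holds
  -- because their eigenvalues are at least `Λ > μ`.
  have hu0 : u = 0 := by
    refine hall μ u heu fun i => ?_
    by_cases hi : i < l
    · exact (hmem u).1 hu i hi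
    · have h1 := heig i u
      rw [← inner_conj_symm, heu (φ i), map_mul, Complex.conj_ofReal, inner_conj_symm] at h1
      have h2 : ((μ : ℂ) - lam i) * inner ℂ (S u) (S (φ i)) = 0 := by rw [sub_mul, h1, sub_self]
      have h3 : (μ : ℂ) - lam i ≠ 0 := by
        rw [← Complex.ofReal_sub]
        exact_mod_cast (sub_neg.2 (hμΛ.trans_le (hΛ i (not_lt.1 hi)))).ne
      rw [← inner_conj_symm, (mul_eq_zero.1 h2).resolve_left h3, map_zero]
  rw [hu0, map_zero, norm_zero] at hSu
  exact zero_ne_one hSu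

end Rayleigh

/-! ### Weighted `L²` spaces and restrictions -/

section Weighted

variable {α : Type*} [MeasurableSpace α] {μ ν : Measure α} {F : Type*}
  [NormedAddCommGroup F] [InnerProductSpace ℂ F]

theorem smulOp_sqrt_integrand {w : α → ℝ} (hw : ∀ᵐ x ∂μ, 0 ≤ w x)
    (hm : MemLp (fun x => Real.sqrt (w x)) ∞ μ) (f g : Lp F 2 μ) :
    (fun x => inner ℂ (smulOp _ hm g x) (smulOp _ hm f x))
      =ᵐ[μ] fun x => (w x : ℂ) * inner ℂ (g x) (f x) := by
  filter_upwards [coeFn_smulOp _ hm f, coeFn_smulOp _ hm g, hw] with x h1 h2 h3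
  rw [h1, h2, inner_smul_left, inner_smul_right, Complex.conj_ofReal, ← mul_assoc,
    ← Complex.ofReal_mul, Real.mul_self_sqrt h3]

/-- Multiplication by the square root of the weight turns the weighted forms into ordinary inner
products, to which orthogonal projections and adjoints apply. -/
theorem inner_smulOp_sqrt {w : α → ℝ} (hw : ∀ᵐ x ∂μ, 0 ≤ w x)
    (hm : MemLp (fun x => Real.sqrt (w x)) ∞ μ) (f g : Lp F 2 μ) :
    inner ℂ (smulOp _ hm g) (smulOp _ hm f) = ∫ x, (w x : ℂ) * inner ℂ (g x) (f x) ∂μ := by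
  rw [L2.inner_def, integral_congr_ae (smulOp_sqrt_integrand hw hm f g)]

theorem integrable_smulOp_sqrt {w : α → ℝ} (hw : ∀ᵐ x ∂μ, 0 ≤ w x)
    (hm : MemLp (fun x => Real.sqrt (w x)) ∞ μ) (f g : Lp F 2 μ) :
    Integrable (fun x => (w x : ℂ) * inner ℂ (g x) (f x)) μ :=
  (L2.integrable_inner _ _).congr (smulOp_sqrt_integrand hw hm f g)

theorem norm_sq_smulOp_sqrt_integrand {w : α → ℝ} (hw : ∀ᵐ x ∂μ, 0 ≤ w x)
    (hm : MemLp (fun x => Real.sqrt (w x)) ∞ μ) (f : Lp F 2 μ) :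
    (fun x => ‖smulOp _ hm f x‖ ^ 2) =ᵐ[μ] fun x => w x * ‖f x‖ ^ 2 := by
  filter_upwards [coeFn_smulOp _ hm f, hw] with x h1 h3
  rw [h1, norm_smul, mul_pow, Complex.norm_real, Real.norm_eq_abs, sq_abs, Real.sq_sqrt h3]

theorem norm_sq_smulOp_sqrt {w : α → ℝ} (hw : ∀ᵐ x ∂μ, 0 ≤ w x)
    (hm : MemLp (fun x => Real.sqrt (w x)) ∞ μ) (f : Lp F 2 μ) :
    ‖smulOp _ hm f‖ ^ 2 = ∫ x, w x * ‖f x‖ ^ 2 ∂μ := by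
  rw [norm_sq_Lp, integral_congr_ae (norm_sq_smulOp_sqrt_integrand hw hm f)]

theorem integrable_norm_sq_smulOp_sqrt {w : α → ℝ} (hw : ∀ᵐ x ∂μ, 0 ≤ w x)
    (hm : MemLp (fun x => Real.sqrt (w x)) ∞ μ) (f : Lp F 2 μ) :
    Integrable (fun x => w x * ‖f x‖ ^ 2) μ :=
  (integrable_norm_sq_Lp _).congr (norm_sq_smulOp_sqrt_integrand hw hm f)

theorem mul_norm_sq_le_norm_sq_smulOp_sqrt {w : α → ℝ} {c : ℝ} (hc : 0 ≤ c)
    (hw : ∀ᵐ x ∂μ, c ≤ w x) (hm : MemLp (fun x => Real.sqrt (w x)) ∞ μ) (f : Lp F 2 μ) :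
    c * ‖f‖ ^ 2 ≤ ‖smulOp _ hm f‖ ^ 2 := by
  have hw0 : ∀ᵐ x ∂μ, 0 ≤ w x := hw.mono fun x hx => hc.trans hx
  rw [norm_sq_smulOp_sqrt hw0, norm_sq_Lp, ← integral_const_mul]
  refine integral_mono_ae ((integrable_norm_sq_Lp f).const_mul c)
    (integrable_norm_sq_smulOp_sqrt hw0 hm f) ?_
  filter_upwards [hw] with x hx
  exact mul_le_mul_of_nonneg_right hx (sq_nonneg _)

/-- Restriction of `L²` functions to a smaller measure. -/
def resLp (h : ν ≤ μ) : Lp F 2 μ →L[ℂ] Lp F 2 ν :=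
  LinearMap.mkContinuous
    { toFun := fun f => ((Lp.memLp f).mono_measure h).toLp f
      map_add' := fun f g => by
        rw [← MemLp.toLp_add]
        exact MemLp.toLp_congr _ _ (Measure.absolutelyContinuous_of_le h (Lp.coeFn_add f g))
      map_smul' := fun c f => by
        rw [RingHom.id_apply, ← MemLp.toLp_const_smul]
        exact MemLp.toLp_congr _ _ (Measure.absolutelyContinuous_of_le h (Lp.coeFn_smul c f)) }
    1 fun f => by
      rw [one_mul]
      simp only [LinearMap.coe_mk, AddHom.coe_mk, Lp.norm_toLp]
      exact ENNReal.toReal_mono (Lp.eLpNorm_ne_top f) (eLpNorm_mono_measure _ h)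

theorem coeFn_resLp (h : ν ≤ μ) (f : Lp F 2 μ) : resLp h f =ᵐ[ν] f :=
  ((Lp.memLp f).mono_measure h).coeFn_toLp

end Weighted

theorem ae_surf_restrict_empty (p : E d → Prop) : ∀ᵐ x ∂((surf d).restrict ∅), p x := by
  rw [Measure.restrict_empty, ae_zero]
  exact Filter.eventually_bot

/-- Restriction of triples to a subdomain, forgetting the trace. -/
def resT {D' D : Set (E d)} (h : D' ⊆ D) (S : Set (E d)) : Triple D S →L[ℂ] Triple D' ∅ :=
  ((resLp (Measure.restrict_mono h le_rfl)).comp (ContinuousLinearMap.fst ℂ _ _)).prod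
    (((resLp (Measure.restrict_mono h le_rfl)).comp
      ((ContinuousLinearMap.fst ℂ _ _).comp (ContinuousLinearMap.snd ℂ _ _))).prod 0)

theorem resT_fst {D' D : Set (E d)} (h : D' ⊆ D) {S : Set (E d)} (u : Triple D S) :
    (resT h S u).1 = resLp (Measure.restrict_mono h le_rfl) u.1 := rfl

theorem resT_grad {D' D : Set (E d)} (h : D' ⊆ D) {S : Set (E d)} (u : Triple D S) :
    (resT h S u).2.1 = resLp (Measure.restrict_mono h le_rfl) u.2.1 := rfl

theorem coeFn_resT_fst {D' D : Set (E d)} (h : D' ⊆ D) {S : Set (E d)} (u : Triple D S) :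
    (resT h S u).1 =ᵐ[volume.restrict D'] u.1 := by
  rw [resT_fst]
  exact coeFn_resLp _ _

theorem coeFn_resT_grad {D' D : Set (E d)} (h : D' ⊆ D) {S : Set (E d)} (u : Triple D S) :
    (resT h S u).2.1 =ᵐ[volume.restrict D'] u.2.1 := by
  rw [resT_grad]
  exact coeFn_resLp _ _

theorem resT_mem_smoothTriples {D' D : Set (E d)} (h : D' ⊆ D) {S : Set (E d)} {U : Triple D S}
    (hU : U ∈ smoothTriples D S) : resT h S U ∈ smoothTriples D' ∅ := by
  obtain ⟨φ, hφ, hφc, h1, h2, -⟩ := hU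
  exact ⟨φ, hφ, hφc,
    (coeFn_resT_fst h U).trans (ae_restrict_of_ae_restrict_of_subset h h1),
    (coeFn_resT_grad h U).trans (ae_restrict_of_ae_restrict_of_subset h h2),
    ae_surf_restrict_empty _⟩

theorem resT_mem_H1 {D' D : Set (E d)} (h : D' ⊆ D) {S : Set (E d)} {u : Triple D S}
    (hu : u ∈ H1 D S) : resT h S u ∈ H1 D' ∅ :=
  map_mem_closure (resT h S).continuous hu fun _ hU => resT_mem_smoothTriples h hU

instance (D S : Set (E d)) : CompleteSpace (H1 D S) :=
  inferInstanceAs (CompleteSpace (smoothTriples D S).topologicalClosure)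

theorem trace_eq_zero {D : Set (E d)} (u : Triple D ∅) : u.2.2 = 0 := by
  rw [Lp.eq_zero_iff_ae_eq_zero]
  exact ae_surf_restrict_empty _

/-! ### Weighted forms and the spectral gap on one element. -/

namespace Helmholtz

variable {P : Helmholtz d} {M : QuadMesh d P.Ω}

/-- The weight `Ã` is bounded and dominates `2 k²` on the elements. -/
structure Resolved (P : Helmholtz d) (M : QuadMesh d P.Ω) (W : ℝ) : Prop where
  lower : ∀ j, ∀ x ∈ M.K j, 2 * P.k ^ 2 ≤ P.wt M x
  upper : ∀ j, ∀ x ∈ M.K j, P.wt M x ≤ W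

theorem measurable_wt (P : Helmholtz d) (M : QuadMesh d P.Ω) : Measurable (P.wt M) := by
  refine Finset.measurable_sum _ fun j _ => Measurable.indicator (P.A_measurable.mul
    (Finset.measurable_sum _ fun σ _ => ?_)) (M.measurableSet_K j)
  exact (((InnerProductSpace.toDual ℝ (E d)).symm.continuous.measurable.comp
    (measurable_fderiv ℝ _)).norm).pow_const 2

theorem wt_eq {j : Fin M.N} {x : E d} (hx : x ∈ M.K j) :
    P.wt M x = P.A x * ∑ σ, ‖gradient (lagrange (M.vert j) σ) x‖ ^ 2 := by
  rw [wt, Finset.sum_eq_single j]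
  · rw [indicator_of_mem hx]
  · intro i _ hij
    exact indicator_of_notMem (disjoint_left.1 (M.disjoint j i hij.symm) hx) _
  · simp

theorem ε_sq_le_A (P : Helmholtz d) {x : E d} (hx : x ∈ P.Ω) : P.ε ^ 2 ≤ P.A x := by
  have h0 := P.ε_pos
  have h1 := P.ε_lt_one
  rcases P.A_values x hx with h | h <;> rw [h]
  nlinarith

theorem A_le_one (P : Helmholtz d) {x : E d} (hx : x ∈ P.Ω) : P.A x ≤ 1 := by
  have h0 := P.ε_pos
  have h1 := P.ε_lt_one
  rcases P.A_values x hx with h | h <;> rw [h]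
  nlinarith

theorem A_nonneg (P : Helmholtz d) {x : E d} (hx : x ∈ P.Ω) : 0 ≤ P.A x :=
  (sq_nonneg _).trans (P.ε_sq_le_A hx)

theorem ae_A (P : Helmholtz d) (M : QuadMesh d P.Ω) (j : Fin M.N) :
    ∀ᵐ x ∂volume.restrict (M.K j), P.ε ^ 2 ≤ P.A x :=
  (ae_restrict_iff' (M.measurableSet_K j)).2
    (Filter.Eventually.of_forall fun _ hx => P.ε_sq_le_A (M.K_subset j hx))

theorem ae_A_nonneg (P : Helmholtz d) (M : QuadMesh d P.Ω) (j : Fin M.N) :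
    ∀ᵐ x ∂volume.restrict (M.K j), 0 ≤ P.A x :=
  (P.ae_A M j).mono fun _ hx => (sq_nonneg _).trans hx

theorem memLp_sqrt_A (P : Helmholtz d) (M : QuadMesh d P.Ω) (j : Fin M.N) :
    MemLp (fun x => Real.sqrt (P.A x)) ∞ (volume.restrict (M.K j)) :=
  memLp_top_of_bound P.A_measurable.sqrt.aestronglyMeasurable 1
    ((ae_restrict_iff' (M.measurableSet_K j)).2 (Filter.Eventually.of_forall fun x hx => by
      rw [Real.norm_of_nonneg (Real.sqrt_nonneg _), Real.sqrt_le_one]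
      exact P.A_le_one (M.K_subset j hx)))

variable {W : ℝ}

namespace Resolved

variable (hR : P.Resolved M W)

include hR in
theorem ae_lower (j : Fin M.N) :
    ∀ᵐ x ∂volume.restrict (M.K j), 2 * P.k ^ 2 ≤ P.wt M x :=
  (ae_restrict_iff' (M.measurableSet_K j)).2
    (Filter.Eventually.of_forall fun x hx => hR.lower j x hx)

include hR in
theorem ae_nonneg (j : Fin M.N) : ∀ᵐ x ∂volume.restrict (M.K j), 0 ≤ P.wt M x :=
  (hR.ae_lower j).mono fun _ hx => le_trans (by positivity) hx

include hR in
theorem memLp_sqrt_wt (j : Fin M.N) :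
    MemLp (fun x => Real.sqrt (P.wt M x)) ∞ (volume.restrict (M.K j)) :=
  memLp_top_of_bound (P.measurable_wt M).sqrt.aestronglyMeasurable (Real.sqrt W)
    ((ae_restrict_iff' (M.measurableSet_K j)).2 (Filter.Eventually.of_forall fun x hx => by
      rw [Real.norm_of_nonneg (Real.sqrt_nonneg _)]
      exact Real.sqrt_le_sqrt (hR.upper j x hx)))

/-- `√A ∇u` on an element. -/
def locG (P : Helmholtz d) (M : QuadMesh d P.Ω) (j : Fin M.N) :
    Triple (M.K j) ∅ →L[ℂ] Lp (CVec d) 2 (volume.restrict (M.K j)) :=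
  (smulOp _ (P.memLp_sqrt_A M j)).comp
    ((ContinuousLinearMap.fst ℂ _ _).comp (ContinuousLinearMap.snd ℂ _ _))

/-- Multiplication by `√Ã` on an element. -/
def wtOp (j : Fin M.N) :
    Lp ℂ 2 (volume.restrict (M.K j)) →L[ℂ] Lp ℂ 2 (volume.restrict (M.K j)) :=
  smulOp _ (hR.memLp_sqrt_wt j)

/-- `√Ã u` on an element. -/
def locS (j : Fin M.N) : Triple (M.K j) ∅ →L[ℂ] Lp ℂ 2 (volume.restrict (M.K j)) :=
  (hR.wtOp j).comp (ContinuousLinearMap.fst ℂ _ _)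

theorem aForm_eq (j : Fin M.N) (u v : Triple (M.K j) ∅) :
    P.aForm (M.K j) u v = inner ℂ (locG P M j v) (locG P M j u) :=
  (inner_smulOp_sqrt (P.ae_A_nonneg M j) (P.memLp_sqrt_A M j) u.2.1 v.2.1).symm

theorem sForm_eq (j : Fin M.N) (f g : Lp ℂ 2 (volume.restrict (M.K j))) :
    P.sForm M (M.K j) f g = inner ℂ (hR.wtOp j g) (hR.wtOp j f) :=
  (inner_smulOp_sqrt (hR.ae_nonneg j) (hR.memLp_sqrt_wt j) f g).symm

/-- The bounds `2k² ≤ Ã` and `ε² ≤ A` give the norm equivalence required by `rayleigh_bound`; the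
trace component on the empty set is zero. The size of the constant plays no role later. -/
theorem norm_le (hR : P.Resolved M W) (j : Fin M.N) (u : Triple (M.K j) ∅) :
    ‖u‖ ≤ ((Real.sqrt (2 * P.k ^ 2))⁻¹ + P.ε⁻¹) * (‖locG P M j u‖ + ‖hR.locS j u‖) := by
  have hk := P.k_pos
  have hε := P.ε_pos
  have h1 := mul_norm_sq_le_norm_sq_smulOp_sqrt (by positivity) (hR.ae_lower j)
    (hR.memLp_sqrt_wt j) u.1
  have h2 := mul_norm_sq_le_norm_sq_smulOp_sqrt (by positivity) (P.ae_A M j)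
    (P.memLp_sqrt_A M j) u.2.1
  have hc : 0 < Real.sqrt (2 * P.k ^ 2) := Real.sqrt_pos.2 (by positivity)
  have h3 : ‖u.1‖ ≤ (Real.sqrt (2 * P.k ^ 2))⁻¹ * ‖hR.locS j u‖ := by
    rw [inv_mul_eq_div, le_div_iff₀ hc, mul_comm]
    refine le_of_sq_le_sq ?_ (norm_nonneg _)
    rw [mul_pow, Real.sq_sqrt (by positivity)]
    exact h1
  have h4 : ‖u.2.1‖ ≤ P.ε⁻¹ * ‖locG P M j u‖ := by
    rw [inv_mul_eq_div, le_div_iff₀ hε, mul_comm]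
    refine le_of_sq_le_sq ?_ (norm_nonneg _)
    rw [mul_pow]
    exact h2
  have n1 := norm_nonneg (locG P M j u)
  have n2 := norm_nonneg (hR.locS j u)
  have n3 : 0 ≤ (Real.sqrt (2 * P.k ^ 2))⁻¹ := by positivity
  have n4 : 0 ≤ P.ε⁻¹ := by positivity
  rw [Prod.norm_def, Prod.norm_def, trace_eq_zero, norm_zero]
  refine max_le ?_ (max_le ?_ (by positivity)) <;> nlinarith [mul_nonneg n3 n1, mul_nonneg n4 n2]

section Aux

variable (X : P.Aux M)

include hR in
theorem eigen_inner (j : Fin M.N) {μ : ℝ} {w : Triple (M.K j) ∅} (hw : P.IsEigen M j μ w)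
    {v : Triple (M.K j) ∅} (hv : v ∈ H1 (M.K j) ∅) :
    inner ℂ (locG P M j v) (locG P M j w) = μ * inner ℂ (hR.locS j v) (hR.locS j w) := by
  rw [← aForm_eq, hw.2 v hv, hR.sForm_eq]
  rfl

include hR in
theorem eq_zero_of_locS_eq_zero {j : Fin M.N} {μ : ℝ} {w : Triple (M.K j) ∅}
    (hw : P.IsEigen M j μ w) (h0 : hR.locS j w = 0) : w = 0 := by
  have h1 := hR.eigen_inner j hw hw.1
  rw [h0, inner_zero_left, mul_zero, inner_self_eq_zero] at h1
  have h2 := hR.norm_le j w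
  rw [h0, h1, norm_zero, norm_zero, add_zero, mul_zero] at h2
  exact norm_le_zero_iff.1 h2

theorem locS_φ_ne_zero (j : Fin M.N) (i : ℕ) : hR.locS j (X.φ j i) ≠ 0 := fun h =>
  X.ne_zero j i (hR.eq_zero_of_locS_eq_zero (X.eigen j i) h)

theorem locS_φ_orth (j : Fin M.N) {i i' : ℕ} (h : i ≠ i') :
    inner ℂ (hR.locS j (X.φ j i)) (hR.locS j (X.φ j i')) = 0 := by
  have := X.orth j i' i h.symm
  rw [hR.sForm_eq] at this
  exact this

theorem isCompactOperator_locS (j : Fin M.N) :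
    IsCompactOperator ((hR.locS j).comp (H1 (M.K j) ∅).subtypeL) := by
  have h : IsCompactOperator (embedL2 (M.K j)) :=
    isCompactOperator_embedL2 (M.injOn j) (M.nondegenerate j)
  exact h.clm_comp (hR.wtOp j)

/-- The span of the weighted auxiliary functions. -/
def auxSpan (j : Fin M.N) : Submodule ℂ (Lp ℂ 2 (volume.restrict (M.K j))) :=
  Submodule.span ℂ ((fun i => hR.locS j (X.φ j i)) '' (Finset.range (X.l j) : Set ℕ))

instance (j : Fin M.N) : FiniteDimensional ℂ (hR.auxSpan X j) :=
  FiniteDimensional.span_of_finite ℂ ((Finset.finite_toSet _).image _)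

/-- The coefficients of the local projection. -/
def coeff (j : Fin M.N) (f : Lp ℂ 2 (volume.restrict (M.K j))) (i : ℕ) : ℂ :=
  inner ℂ (hR.locS j (X.φ j i)) (hR.wtOp j f) /
    inner ℂ (hR.locS j (X.φ j i)) (hR.locS j (X.φ j i))

theorem inner_sub_sum_coeff (j : Fin M.N) (f : Lp ℂ 2 (volume.restrict (M.K j))) {i : ℕ}
    (hi : i < X.l j) : inner ℂ (hR.locS j (X.φ j i)) (hR.wtOp j f
      - ∑ i ∈ Finset.range (X.l j), hR.coeff X j f i • hR.locS j (X.φ j i)) = 0 := by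
  rw [inner_sub_right, inner_sum, Finset.sum_eq_single i]
  · rw [inner_smul_right, coeff, div_mul_cancel₀ _ (inner_self_ne_zero.2 (hR.locS_φ_ne_zero X j i)),
      sub_self]
  · intro i' _ hii'
    rw [inner_smul_right, hR.locS_φ_orth X j hii'.symm, mul_zero]
  · intro h; exact absurd (Finset.mem_range.2 hi) h

/-- After multiplication by `√Ã` the `s_j`-orthogonal projection `π_j` is the orthogonal projection
onto a finite-dimensional subspace of `L²`. -/
theorem starProjection_auxSpan (j : Fin M.N) (f : Lp ℂ 2 (volume.restrict (M.K j))) :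
    (hR.auxSpan X j).starProjection (hR.wtOp j f)
      = ∑ i ∈ Finset.range (X.l j), hR.coeff X j f i • hR.locS j (X.φ j i) := by
  refine Submodule.eq_starProjection_of_mem_of_inner_eq_zero ?_ fun w hw => ?_
  · exact Submodule.sum_mem _ fun i hi => Submodule.smul_mem _ _
      (Submodule.subset_span ⟨i, hi, rfl⟩)
  · induction hw using Submodule.span_induction with
    | mem x hx =>
      obtain ⟨i, hi, rfl⟩ := hx
      rw [← inner_conj_symm]
      simp only [hR.inner_sub_sum_coeff X j f (Finset.mem_range.1 hi), map_zero]
    | zero => rw [inner_zero_right]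
    | add x y _ _ hx hy => rw [inner_add_right, hx, hy, add_zero]
    | smul c x _ hx => rw [inner_smul_right, hx, mul_zero]

/-- The spectral gap estimate on an element. -/
theorem spectral_gap {Λ : ℝ} (j : Fin M.N) (hΛ : Λ ≤ X.lam j (X.l j)) {v : Triple (M.K j) ∅}
    (hv : v ∈ H1 (M.K j) ∅) :
    Λ * ‖hR.locS j v - (hR.auxSpan X j).starProjection (hR.locS j v)‖ ^ 2
      ≤ ‖locG P M j v‖ ^ 2 := by
  set c := hR.coeff X j v.1 with hc
  set w := ∑ i ∈ Finset.range (X.l j), c i • X.φ j i with hw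
  have hwH : w ∈ H1 (M.K j) ∅ := Submodule.sum_mem _ fun i _ =>
    Submodule.smul_mem _ _ (X.eigen j i).1
  have hproj : (hR.auxSpan X j).starProjection (hR.locS j v) = hR.locS j w := by
    rw [hw, map_sum]
    simp only [map_smul]
    exact hR.starProjection_auxSpan X j v.1
  have horth : ∀ i < X.l j, inner ℂ (hR.locS j (X.φ j i)) (hR.locS j (v - w)) = 0 := by
    intro i hi
    rw [map_sub, ← hproj]
    have := hR.inner_sub_sum_coeff X j v.1 hi
    rwa [← hR.starProjection_auxSpan] at this
  have hray := rayleigh_bound (G := (locG P M j).comp (H1 (M.K j) ∅).subtypeL)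
    (S := (hR.locS j).comp (H1 (M.K j) ∅).subtypeL) (hR.isCompactOperator_locS j)
    (fun u => hR.norm_le j u) (lam := X.lam j) (φ := fun i => ⟨X.φ j i, (X.eigen j i).1⟩)
    (fun i v => hR.eigen_inner j (X.eigen j i) v.2) (fun i i' h => hR.locS_φ_orth X j h)
    (fun i => hR.locS_φ_ne_zero X j i) (fun μ w hw h0 => ?_) (l := X.l j) (Λ := Λ)
    (fun i hi => hΛ.trans (X.mono j hi)) (v := ⟨v - w, Submodule.sub_mem _ hv hwH⟩) horth
  -- By the eigenvalue equation, `s_j`-orthogonality of `v - w` to the first eigenfunctions implies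
  -- `a_j`-orthogonality. Hence subtracting the projection `w` does not increase the energy.
  · have hGorth : inner ℂ (locG P M j (v - w)) (locG P M j w) = 0 := by
      rw [hw, map_sum, inner_sum]
      refine Finset.sum_eq_zero fun i hi => ?_
      rw [map_smul, inner_smul_right, hR.eigen_inner j (X.eigen j i)
        (Submodule.sub_mem _ hv hwH), ← inner_conj_symm, horth i (Finset.mem_range.1 hi), map_zero,
        mul_zero, mul_zero]
    have hpyth : ‖locG P M j v‖ ^ 2 = ‖locG P M j (v - w)‖ ^ 2 + ‖locG P M j w‖ ^ 2 := by
      have h1 : locG P M j v = locG P M j (v - w) + locG P M j w := by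
        rw [← map_add, sub_add_cancel]
      rw [h1, @norm_add_sq ℂ, hGorth]
      simp
    rw [hproj, ← map_sub, hpyth]
    exact hray.trans (le_add_of_nonneg_right (sq_nonneg _))
  · refine Subtype.ext (X.all j μ w ⟨w.2, fun v hv => ?_⟩ fun i => ?_)
    · rw [aForm_eq, hR.sForm_eq]
      exact hw ⟨v, hv⟩
    · rw [hR.sForm_eq]
      exact h0 i

end Aux

end Resolved

end Helmholtz

theorem Triple.ext_ae {D : Set (E d)} {u v : Triple D ∅} (h1 : u.1 =ᵐ[volume.restrict D] v.1)
    (h2 : u.2.1 =ᵐ[volume.restrict D] v.2.1) : u = v :=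
  Prod.ext (Lp.ext h1) (Prod.ext (Lp.ext h2) ((trace_eq_zero u).trans (trace_eq_zero v).symm))

theorem QuadMesh.rgrad_eq_zero {Ω : Set (E d)} (M : QuadMesh d Ω) {j : Fin M.N} {g : E d → ℝ}
    {c : ℝ} (hc : ∀ x ∈ M.K j, g x = c) {x : E d} (hx : x ∈ M.K j) : rgrad g x = 0 := by
  have h1 : g =ᶠ[nhds x] fun _ => c :=
    Filter.mem_of_superset ((M.isOpen_K j).mem_nhds hx) hc
  rw [← norm_eq_zero, norm_rgrad, h1.fderiv_eq]
  simp

/-! ### Decomposition of the global forms into element contributions. -/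

namespace Helmholtz

variable {P : Helmholtz d} {M : QuadMesh d P.Ω}

theorem sForm_congr {D : Set (E d)} {f f' g g' : E d → ℂ} (hf : f =ᵐ[volume.restrict D] f')
    (hg : g =ᵐ[volume.restrict D] g') : P.sForm M D f g = P.sForm M D f' g' := by
  refine integral_congr_ae ?_
  filter_upwards [hf, hg] with x h1 h2
  rw [h1, h2]

theorem projLoc_eq_zero (X : P.Aux M) {i j : Fin M.N} (h : i ≠ j) (f : E d → ℂ) {x : E d}
    (hx : x ∈ M.K j) : P.projLoc X i f x = 0 :=
  indicator_of_notMem (disjoint_left.1 (M.disjoint j i h.symm) hx) _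

theorem proj_eq_projLoc (X : P.Aux M) {j : Fin M.N} (f : E d → ℂ) {x : E d} (hx : x ∈ M.K j) :
    P.proj X f x = P.projLoc X j f x := by
  rw [proj, Finset.sum_eq_single j]
  · exact fun i _ hij => projLoc_eq_zero X hij f hx
  · simp

/-- Restriction of a triple on `Ω` to an element. -/
def resK (P : Helmholtz d) (M : QuadMesh d P.Ω) (j : Fin M.N) :
    Triple P.Ω P.Γ →L[ℂ] Triple (M.K j) ∅ :=
  resT (M.K_subset j) P.Γ

/-- `√A ∇u` on an element, for `u` on `Ω`. -/
def opG (P : Helmholtz d) (M : QuadMesh d P.Ω) (j : Fin M.N) :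
    Triple P.Ω P.Γ →L[ℂ] Lp (CVec d) 2 (volume.restrict (M.K j)) :=
  (Resolved.locG P M j).comp (resK P M j)

/-- The restriction of `u` to an element. -/
def opM (P : Helmholtz d) (M : QuadMesh d P.Ω) (j : Fin M.N) :
    Triple P.Ω P.Γ →L[ℂ] Lp ℂ 2 (volume.restrict (M.K j)) :=
  (ContinuousLinearMap.fst ℂ _ _).comp (resK P M j)

/-- The trace on `ΓR`. -/
def opR (P : Helmholtz d) : Triple P.Ω P.Γ →L[ℂ] Lp ℂ 2 ((surf d).restrict P.ΓR) :=
  (resLp (Measure.restrict_mono subset_union_right le_rfl)).comp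
    ((ContinuousLinearMap.snd ℂ _ _).comp (ContinuousLinearMap.snd ℂ _ _))

theorem coeFn_opR (u : Triple P.Ω P.Γ) : opR P u =ᵐ[(surf d).restrict P.ΓR] u.2.2 :=
  coeFn_resLp (Measure.restrict_mono subset_union_right le_rfl) u.2.2

variable {W : ℝ}

namespace Resolved

variable (hR : P.Resolved M W)

/-- `√Ã u` on an element, for `u` on `Ω`. -/
def opS (j : Fin M.N) : Triple P.Ω P.Γ →L[ℂ] Lp ℂ 2 (volume.restrict (M.K j)) :=
  (hR.locS j).comp (resK P M j)

variable (X : P.Aux M)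

/-- `√Ã π f` on an element. -/
def dat (j : Fin M.N) :
    Lp ℂ 2 (volume.restrict P.Ω) →L[ℂ] Lp ℂ 2 (volume.restrict (M.K j)) :=
  ((hR.auxSpan X j).starProjection.comp (hR.wtOp j)).comp
    (resLp (Measure.restrict_mono (M.K_subset j) le_rfl))

/-- `√Ã π u` on an element, for `u` on `Ω`. -/
def opP (j : Fin M.N) : Triple P.Ω P.Γ →L[ℂ] Lp ℂ 2 (volume.restrict (M.K j)) :=
  (hR.dat X j).comp (ContinuousLinearMap.fst ℂ _ _)

theorem opP_eq (j : Fin M.N) (u : Triple P.Ω P.Γ) :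
    hR.opP X j u = (hR.auxSpan X j).starProjection (hR.opS j u) := rfl

/-- The local projection as an `L²` function on the element. -/
def prLp (j : Fin M.N) (f : Lp ℂ 2 (volume.restrict (M.K j))) :
    Lp ℂ 2 (volume.restrict (M.K j)) :=
  ∑ i ∈ Finset.range (X.l j), hR.coeff X j f i • (X.φ j i).1

theorem wtOp_prLp (j : Fin M.N) (f : Lp ℂ 2 (volume.restrict (M.K j))) :
    hR.wtOp j (hR.prLp X j f) = (hR.auxSpan X j).starProjection (hR.wtOp j f) := by
  rw [starProjection_auxSpan, prLp, map_sum]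
  simp only [map_smul]
  rfl

theorem projLoc_ae_eq (j : Fin M.N) {f : E d → ℂ} {f' : Lp ℂ 2 (volume.restrict (M.K j))}
    (hf : f =ᵐ[volume.restrict (M.K j)] f') :
    P.projLoc X j f =ᵐ[volume.restrict (M.K j)] hR.prLp X j f' := by
  have hsm := ae_all_iff.2 fun i => Lp.coeFn_smul (hR.coeff X j f' i) (X.φ j i).1
  filter_upwards [coeFn_sum_Lp (Finset.range (X.l j)) fun i =>
    hR.coeff X j f' i • (X.φ j i).1, hsm, ae_restrict_mem (M.measurableSet_K j)] with x h1 h2 h3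
  rw [prLp, h1, projLoc, indicator_of_mem h3]
  refine Finset.sum_congr rfl fun i _ => ?_
  rw [h2, Pi.smul_apply, smul_eq_mul, coeff, sForm_congr hf (Filter.EventuallyEq.refl _ _),
    hR.sForm_eq, hR.sForm_eq]
  rfl

theorem projLoc_ae_eq_Lp (j : Fin M.N) (f : Lp ℂ 2 (volume.restrict P.Ω)) :
    P.projLoc X j f =ᵐ[volume.restrict (M.K j)]
      hR.prLp X j (resLp (Measure.restrict_mono (M.K_subset j) le_rfl) f) :=
  hR.projLoc_ae_eq X j (coeFn_resLp (Measure.restrict_mono (M.K_subset j) le_rfl) f).symm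

theorem proj_ae_eq_Lp (j : Fin M.N) (f : Lp ℂ 2 (volume.restrict P.Ω)) :
    P.proj X f =ᵐ[volume.restrict (M.K j)]
      hR.prLp X j (resLp (Measure.restrict_mono (M.K_subset j) le_rfl) f) := by
  refine Filter.EventuallyEq.trans ?_ (hR.projLoc_ae_eq_Lp X j f)
  filter_upwards [ae_restrict_mem (M.measurableSet_K j)] with x hx
  exact proj_eq_projLoc X _ hx

theorem wtOp_prLp_res (j : Fin M.N) (f : Lp ℂ 2 (volume.restrict P.Ω)) :
    hR.wtOp j (hR.prLp X j (resLp (Measure.restrict_mono (M.K_subset j) le_rfl) f))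
      = hR.dat X j f := hR.wtOp_prLp X j _

include hR in
theorem integrableOn_sForm {j : Fin M.N} {f g : E d → ℂ}
    {f' g' : Lp ℂ 2 (volume.restrict (M.K j))} (hf : f =ᵐ[volume.restrict (M.K j)] f')
    (hg : g =ᵐ[volume.restrict (M.K j)] g') :
    IntegrableOn (fun x => (P.wt M x : ℂ) * (f x * (starRingEnd ℂ) (g x))) (M.K j) := by
  refine (integrable_smulOp_sqrt (hR.ae_nonneg j) (hR.memLp_sqrt_wt j) f' g').congr ?_
  filter_upwards [hf, hg] with x h1 h2
  rw [h1, h2]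
  rfl

theorem sForm_proj_proj (f g : Lp ℂ 2 (volume.restrict P.Ω)) :
    P.sForm M P.Ω (P.proj X f) (P.proj X g) = ∑ j, inner ℂ (hR.dat X j g) (hR.dat X j f) := by
  rw [sForm, M.integral_eq_sum fun j =>
    hR.integrableOn_sForm (hR.proj_ae_eq_Lp X j f) (hR.proj_ae_eq_Lp X j g)]
  refine Finset.sum_congr rfl fun j _ => ?_
  rw [← hR.wtOp_prLp_res, ← hR.wtOp_prLp_res, ← hR.sForm_eq]
  exact sForm_congr (hR.proj_ae_eq_Lp X j f) (hR.proj_ae_eq_Lp X j g)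

theorem sForm_projLoc_proj (j : Fin M.N) (f g : Lp ℂ 2 (volume.restrict P.Ω)) :
    P.sForm M P.Ω (P.projLoc X j f) (P.proj X g) = inner ℂ (hR.dat X j g) (hR.dat X j f) := by
  have h0 : ∀ i, i ≠ j → P.projLoc X j f =ᵐ[volume.restrict (M.K i)]
      (0 : Lp ℂ 2 (volume.restrict (M.K i))) := by
    intro i hij
    filter_upwards [Lp.coeFn_zero ℂ 2 (volume.restrict (M.K i)),
      ae_restrict_mem (M.measurableSet_K i)] with x h1 h2
    rw [h1, projLoc_eq_zero X hij.symm _ h2]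
    rfl
  rw [sForm, M.integral_eq_sum, Finset.sum_eq_single j]
  · rw [← hR.wtOp_prLp_res, ← hR.wtOp_prLp_res, ← hR.sForm_eq]
    exact sForm_congr (hR.projLoc_ae_eq_Lp X j f) (hR.proj_ae_eq_Lp X j g)
  · intro i _ hij
    have := sForm_congr (P := P) (M := M) (h0 i hij) (hR.proj_ae_eq_Lp X i g)
    rw [hR.sForm_eq, map_zero, inner_zero_right] at this
    exact this
  · simp
  · intro i
    by_cases hij : i = j
    · subst hij
      exact hR.integrableOn_sForm (hR.projLoc_ae_eq_Lp X i f) (hR.proj_ae_eq_Lp X i g)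
    · exact hR.integrableOn_sForm (h0 i hij) (hR.proj_ae_eq_Lp X i g)

theorem sNormSq_proj (f : Lp ℂ 2 (volume.restrict P.Ω)) :
    P.sNormSq M (P.proj X f) = ∑ j, ‖hR.dat X j f‖ ^ 2 := by
  have hcong : ∀ j, (fun x => P.wt M x * ‖P.proj X f x‖ ^ 2) =ᵐ[volume.restrict (M.K j)]
      fun x => P.wt M x *
        ‖hR.prLp X j (resLp (Measure.restrict_mono (M.K_subset j) le_rfl) f) x‖ ^ 2 := by
    intro j
    filter_upwards [hR.proj_ae_eq_Lp X j f] with x h1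
    rw [h1]
  rw [sNormSq, M.integral_eq_sum fun j => (integrable_norm_sq_smulOp_sqrt (hR.ae_nonneg j)
    (hR.memLp_sqrt_wt j) _).congr (hcong j).symm]
  refine Finset.sum_congr rfl fun j _ => ?_
  rw [← hR.wtOp_prLp_res, integral_congr_ae (hcong j)]
  exact (norm_sq_smulOp_sqrt (hR.ae_nonneg j) (hR.memLp_sqrt_wt j) _).symm

theorem _root_.CEM.Helmholtz.coeFn_resK_fst (j : Fin M.N) (u : Triple P.Ω P.Γ) :
    (resK P M j u).1 =ᵐ[volume.restrict (M.K j)] u.1 := coeFn_resT_fst _ u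

theorem _root_.CEM.Helmholtz.coeFn_resK_grad (j : Fin M.N) (u : Triple P.Ω P.Γ) :
    (resK P M j u).2.1 =ᵐ[volume.restrict (M.K j)] u.2.1 := coeFn_resT_grad _ u

theorem _root_.CEM.Helmholtz.aNormSq_eq (M : QuadMesh d P.Ω) (u : Triple P.Ω P.Γ) :
    P.aNormSq u = ∑ j, ‖opG P M j u‖ ^ 2 := by
  have hcong : ∀ j, (fun x => P.A x * ‖u.2.1 x‖ ^ 2) =ᵐ[volume.restrict (M.K j)]
      fun x => P.A x * ‖(resK P M j u).2.1 x‖ ^ 2 := by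
    intro j
    filter_upwards [coeFn_resK_grad j u] with x h1
    rw [h1]
  rw [aNormSq, M.integral_eq_sum fun j => (integrable_norm_sq_smulOp_sqrt (P.ae_A_nonneg M j)
    (P.memLp_sqrt_A M j) _).congr (hcong j).symm]
  refine Finset.sum_congr rfl fun j _ => ?_
  rw [integral_congr_ae (hcong j)]
  exact (norm_sq_smulOp_sqrt (P.ae_A_nonneg M j) (P.memLp_sqrt_A M j) _).symm

theorem _root_.CEM.Helmholtz.aForm_eq_sum (M : QuadMesh d P.Ω) (u v : Triple P.Ω P.Γ) :
    P.aForm P.Ω u v = ∑ j, inner ℂ (opG P M j v) (opG P M j u) := by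
  have hcong : ∀ j, (fun x => (P.A x : ℂ) * inner ℂ (v.2.1 x) (u.2.1 x))
      =ᵐ[volume.restrict (M.K j)] fun x => (P.A x : ℂ) *
        inner ℂ ((resK P M j v).2.1 x) ((resK P M j u).2.1 x) := by
    intro j
    filter_upwards [coeFn_resK_grad j u, coeFn_resK_grad j v] with x h1 h2
    rw [h1, h2]
  rw [aForm, M.integral_eq_sum fun j => (integrable_smulOp_sqrt (P.ae_A_nonneg M j)
    (P.memLp_sqrt_A M j) _ _).congr (hcong j).symm]
  refine Finset.sum_congr rfl fun j _ => ?_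
  rw [integral_congr_ae (hcong j)]
  exact (inner_smulOp_sqrt (P.ae_A_nonneg M j) (P.memLp_sqrt_A M j) _ _).symm

theorem _root_.CEM.Helmholtz.mass_eq_sum (M : QuadMesh d P.Ω) (u v : Triple P.Ω P.Γ) :
    ∫ x in P.Ω, u.1 x * (starRingEnd ℂ) (v.1 x) = ∑ j, inner ℂ (opM P M j v) (opM P M j u) := by
  have hcong : ∀ j, (fun x => u.1 x * (starRingEnd ℂ) (v.1 x))
      =ᵐ[volume.restrict (M.K j)] fun x => inner ℂ (opM P M j v x) (opM P M j u x) := by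
    intro j
    filter_upwards [coeFn_resK_fst j u, coeFn_resK_fst j v] with x h1 h2
    rw [← h1, ← h2]
    rfl
  rw [M.integral_eq_sum fun j => (L2.integrable_inner _ _).congr (hcong j).symm]
  refine Finset.sum_congr rfl fun j _ => ?_
  rw [integral_congr_ae (hcong j)]
  exact (L2.inner_def _ _).symm

theorem _root_.CEM.Helmholtz.trace_eq_inner (u v : Triple P.Ω P.Γ) :
    ∫ x in P.ΓR, u.2.2 x * (starRingEnd ℂ) (v.2.2 x) ∂(surf d) = inner ℂ (opR P v) (opR P u) := by
  rw [L2.inner_def]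
  refine integral_congr_ae ?_
  filter_upwards [coeFn_opR u, coeFn_opR v] with x h1 h2
  rw [h1, h2]
  rfl

/-- The contribution of an element to `𝓑(u, v) + s(π u, π v)`. -/
def q (j : Fin M.N) (u v : Triple P.Ω P.Γ) : ℂ :=
  inner ℂ (opG P M j v) (opG P M j u) + inner ℂ (hR.opP X j v) (hR.opP X j u)
    - (P.k : ℂ) ^ 2 * inner ℂ (opM P M j v) (opM P M j u)

/-- `𝓑(u, v) + s(π u, π v)`. -/
def form (u v : Triple P.Ω P.Γ) : ℂ :=
  ∑ j, hR.q X j u v - Complex.I * P.k * inner ℂ (opR P v) (opR P u)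

theorem form_eq (u v : Triple P.Ω P.Γ) :
    P.B u v + P.sForm M P.Ω (P.proj X u.1) (P.proj X v.1) = hR.form X u v := by
  rw [B, aForm_eq_sum M, mass_eq_sum M, trace_eq_inner, hR.sForm_proj_proj, form]
  simp only [q, Finset.sum_sub_distrib, Finset.sum_add_distrib, Finset.mul_sum]
  simp only [opP, ContinuousLinearMap.comp_apply, ContinuousLinearMap.coe_fst']
  ring

/-- The right-hand side depends on `v` only through `opP j v`, so test functions whose projection on
`K_j` vanishes do not see the data. -/
theorem isCorrector_iff (V₀ : Submodule ℂ (Triple P.Ω P.Γ)) (j : Fin M.N)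
    (t : Lp ℂ 2 (volume.restrict P.Ω)) (u : Triple P.Ω P.Γ) :
    P.IsCorrector X V₀ j t u ↔ u ∈ V₀ ∧ ∀ v ∈ V₀,
      hR.form X u v = inner ℂ (hR.opP X j v) (hR.dat X j t) := by
  simp only [IsCorrector, hR.form_eq X, hR.sForm_projLoc_proj]
  rfl

/-! ### The effect of cutoff functions -/

section Cutoff

variable {L : NNReal} {g : E d → ℝ}

/-- Multiplication by a cutoff function. -/
abbrev _root_.CEM.QuadMesh.IsCutoff.op {P : Helmholtz d} {M : QuadMesh d P.Ω}
    (hg : M.IsCutoff L g) : Triple P.Ω P.Γ →L[ℂ] Triple P.Ω P.Γ :=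
  cutOp hg.lipschitz hg.mem_Icc P.Ω P.Γ

variable (hg : M.IsCutoff L g)

theorem _root_.CEM.Helmholtz.cut_mem_V {u : Triple P.Ω P.Γ} (hu : u ∈ P.V) : hg.op u ∈ P.V := by
  refine ⟨cutOp_mem_H1 hg.lipschitz hg.mem_Icc hg.ae_strict hu.1, ?_⟩
  filter_upwards [cutOp_trace hg.lipschitz hg.mem_Icc u, hu.2] with x h1 h2 h3
  rw [h1, h2 h3, mul_zero]

theorem _root_.CEM.Helmholtz.resK_cut_of_eq {j : Fin M.N} {c : ℝ} (hc : ∀ x ∈ M.K j, g x = c)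
    (u : Triple P.Ω P.Γ) : resK P M j (hg.op u) = (c : ℂ) • resK P M j u := by
  refine Triple.ext_ae ?_ ?_
  · filter_upwards [coeFn_resK_fst j (hg.op u), M.ae_restrict_K
      (cutOp_fst hg.lipschitz hg.mem_Icc u) j, coeFn_resK_fst j u,
      Lp.coeFn_smul (c : ℂ) (resK P M j u).1, ae_restrict_mem (M.measurableSet_K j)]
      with x h1 h2 h3 h4 h5
    rw [h1, h2, Prod.smul_fst, h4, Pi.smul_apply, h3, hc x h5, smul_eq_mul]
  · filter_upwards [coeFn_resK_grad j (hg.op u), M.ae_restrict_K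
      (cutOp_grad hg.lipschitz hg.mem_Icc u) j, coeFn_resK_grad j u,
      Lp.coeFn_smul (c : ℂ) (resK P M j u).2.1, ae_restrict_mem (M.measurableSet_K j)]
      with x h1 h2 h3 h4 h5
    rw [h1, h2, Prod.smul_snd, Prod.smul_fst, h4, Pi.smul_apply, h3, hc x h5, M.rgrad_eq_zero hc h5,
      smul_zero, add_zero]

/-- By the product rule the new term is `A|∇g|²|u|²`, and `A|∇g|² ≤ 2^d Ã` on the element by the
choice of `Ã`. -/
theorem norm_sq_opG_cut_le (j : Fin M.N) (u : Triple P.Ω P.Γ) :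
    ‖opG P M j (hg.op u)‖ ^ 2 ≤ 2 * ‖opG P M j u‖ ^ 2 + 2 * 2 ^ d * ‖hR.opS j u‖ ^ 2 := by
  have e1 : ∀ v : Triple P.Ω P.Γ, ‖opG P M j v‖ ^ 2
      = ∫ x in M.K j, P.A x * ‖(resK P M j v).2.1 x‖ ^ 2 := fun v =>
    norm_sq_smulOp_sqrt (P.ae_A_nonneg M j) (P.memLp_sqrt_A M j) _
  have e2 : ‖hR.opS j u‖ ^ 2 = ∫ x in M.K j, P.wt M x * ‖(resK P M j u).1 x‖ ^ 2 :=
    norm_sq_smulOp_sqrt (hR.ae_nonneg j) (hR.memLp_sqrt_wt j) _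
  have i1 : ∀ v : Triple P.Ω P.Γ, IntegrableOn
      (fun x => P.A x * ‖(resK P M j v).2.1 x‖ ^ 2) (M.K j) := fun v =>
    integrable_norm_sq_smulOp_sqrt (P.ae_A_nonneg M j) (P.memLp_sqrt_A M j) _
  have i2 : IntegrableOn (fun x => P.wt M x * ‖(resK P M j u).1 x‖ ^ 2) (M.K j) :=
    integrable_norm_sq_smulOp_sqrt (hR.ae_nonneg j) (hR.memLp_sqrt_wt j) _
  rw [e1, e1, e2, ← integral_const_mul, ← integral_const_mul,
    ← integral_add ((i1 u).const_mul 2) (i2.const_mul _)]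
  refine integral_mono_ae (i1 _) (((i1 u).const_mul 2).add (i2.const_mul _)) ?_
  filter_upwards [coeFn_resK_grad j (hg.op u), M.ae_restrict_K
    (cutOp_grad hg.lipschitz hg.mem_Icc u) j, coeFn_resK_grad j u, coeFn_resK_fst j u,
    ae_restrict_mem (M.measurableSet_K j)] with x h1 h2 h3 h4 h5
  rw [h1, h2, h3, h4, wt_eq h5]
  have hA := P.A_nonneg (M.K_subset j h5)
  set sη := ∑ σ, ‖gradient (lagrange (M.vert j) σ) x‖ ^ 2
  have n1 : ‖(g x : ℂ) • u.2.1 x + u.1 x • rgrad g x‖ ≤ ‖u.2.1 x‖ + ‖u.1 x‖ * ‖rgrad g x‖ := by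
    refine (norm_add_le _ _).trans (add_le_add ?_ (norm_smul _ _).le)
    rw [norm_smul, Complex.norm_real, Real.norm_of_nonneg (hg.mem_Icc x).1]
    exact mul_le_of_le_one_left (norm_nonneg _) (hg.mem_Icc x).2
  have n2 := hg.grad_le j x h5
  have n3 : ‖(g x : ℂ) • u.2.1 x + u.1 x • rgrad g x‖ ^ 2
      ≤ 2 * ‖u.2.1 x‖ ^ 2 + 2 * (‖u.1 x‖ ^ 2 * ‖rgrad g x‖ ^ 2) := by
    refine (pow_le_pow_left₀ (norm_nonneg _) n1 2).trans ?_
    nlinarith [sq_nonneg (‖u.2.1 x‖ - ‖u.1 x‖ * ‖rgrad g x‖)]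
  have n4 : ‖u.1 x‖ ^ 2 * ‖rgrad g x‖ ^ 2 ≤ ‖u.1 x‖ ^ 2 * (2 ^ d * sη) :=
    mul_le_mul_of_nonneg_left n2 (sq_nonneg _)
  calc _ ≤ P.A x * (2 * ‖u.2.1 x‖ ^ 2 + 2 * (‖u.1 x‖ ^ 2 * (2 ^ d * sη))) :=
        mul_le_mul_of_nonneg_left (n3.trans (by linarith)) hA
    _ = _ := by ring

theorem norm_opS_cut_le (j : Fin M.N) (u : Triple P.Ω P.Γ) :
    ‖hR.opS j (hg.op u)‖ ≤ ‖hR.opS j u‖ := by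
  have e2 : ∀ v : Triple P.Ω P.Γ, ‖hR.opS j v‖ ^ 2
      = ∫ x in M.K j, P.wt M x * ‖(resK P M j v).1 x‖ ^ 2 := fun v =>
    norm_sq_smulOp_sqrt (hR.ae_nonneg j) (hR.memLp_sqrt_wt j) _
  have i2 : ∀ v : Triple P.Ω P.Γ, IntegrableOn
      (fun x => P.wt M x * ‖(resK P M j v).1 x‖ ^ 2) (M.K j) := fun v =>
    integrable_norm_sq_smulOp_sqrt (hR.ae_nonneg j) (hR.memLp_sqrt_wt j) _
  refine le_of_sq_le_sq ?_ (norm_nonneg _)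
  rw [e2, e2]
  refine integral_mono_ae (i2 _) (i2 _) ?_
  filter_upwards [coeFn_resK_fst j (hg.op u), M.ae_restrict_K
    (cutOp_fst hg.lipschitz hg.mem_Icc u) j, coeFn_resK_fst j u, hR.ae_nonneg j] with x h1 h2 h3 h4
  rw [h1, h2, h3]
  refine mul_le_mul_of_nonneg_left (pow_le_pow_left₀ (norm_nonneg _) ?_ 2) h4
  rw [norm_mul, Complex.norm_real, Real.norm_of_nonneg (hg.mem_Icc x).1]
  exact mul_le_of_le_one_left (norm_nonneg _) (hg.mem_Icc x).2

theorem _root_.CEM.Helmholtz.coeFn_opR_cut (u : Triple P.Ω P.Γ) :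
    opR P (hg.op u) =ᵐ[(surf d).restrict P.ΓR] fun x => (g x : ℂ) * opR P u x := by
  filter_upwards [coeFn_opR (hg.op u), coeFn_opR u, ae_restrict_of_ae_restrict_of_subset
    subset_union_right (cutOp_trace hg.lipschitz hg.mem_Icc u)] with x h1 h2 h3
  rw [h1, h2, h3]

include hg in
theorem _root_.CEM.Helmholtz.integrable_cut_trace (u : Triple P.Ω P.Γ) :
    Integrable (fun x => g x * ‖opR P u x‖ ^ 2) ((surf d).restrict P.ΓR) := by
  refine (integrable_norm_sq_Lp (opR P u)).mono'
    (hg.lipschitz.continuous.aestronglyMeasurable.mul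
      ((Lp.aestronglyMeasurable _).norm.pow 2)) (Filter.Eventually.of_forall fun x => ?_)
  rw [norm_mul, Real.norm_of_nonneg (hg.mem_Icc x).1, Real.norm_of_nonneg (sq_nonneg _)]
  exact mul_le_of_le_one_left (sq_nonneg _) (hg.mem_Icc x).2

/-- The value is real and nonnegative, so the boundary term tested with `g u` keeps a favourable
sign after the rotation by `1 + i`. -/
theorem _root_.CEM.Helmholtz.inner_opR_cut (u : Triple P.Ω P.Γ) :
    inner ℂ (opR P (hg.op u)) (opR P u)
      = ((∫ x, g x * ‖opR P u x‖ ^ 2 ∂((surf d).restrict P.ΓR) : ℝ) : ℂ) := by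
  rw [L2.inner_def, ← integral_complex_ofReal]
  refine integral_congr_ae ?_
  filter_upwards [coeFn_opR_cut hg u] with x h1
  rw [h1, ← smul_eq_mul, inner_smul_left, Complex.conj_ofReal, inner_self_eq_norm_sq_to_K]
  push_cast
  rfl

/-- Because `g² ≤ g`, the boundary norm of the cut function is controlled by the integral that
appears in `caccioppoli`. -/
theorem _root_.CEM.Helmholtz.norm_sq_opR_cut_le (u : Triple P.Ω P.Γ) :
    ‖opR P (hg.op u)‖ ^ 2 ≤ ∫ x, g x * ‖opR P u x‖ ^ 2 ∂((surf d).restrict P.ΓR) := by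
  rw [norm_sq_Lp]
  refine integral_mono_ae (integrable_norm_sq_Lp _) (integrable_cut_trace hg u) ?_
  filter_upwards [coeFn_opR_cut hg u] with x h1
  rw [h1, norm_mul, mul_pow, Complex.norm_real, Real.norm_of_nonneg (hg.mem_Icc x).1]
  refine mul_le_mul_of_nonneg_right ?_ (sq_nonneg _)
  nlinarith [(hg.mem_Icc x).1, (hg.mem_Icc x).2]

end Cutoff

end Resolved

end Helmholtz

/-! ### Coercivity and continuity of the form in the energy norm. -/

theorem add_sqrt_mul_sqrt_le {a b c e : ℝ} (ha : 0 ≤ a) (hb : 0 ≤ b) (hc : 0 ≤ c) (he : 0 ≤ e) :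
    √a * √b + √c * √e ≤ √(a + c) * √(b + e) := by
  rw [← Real.sqrt_mul (add_nonneg ha hc)]
  refine Real.le_sqrt_of_sq_le ?_
  have h1 := Real.sq_sqrt ha
  have h2 := Real.sq_sqrt hb
  have h3 := Real.sq_sqrt hc
  have h4 := Real.sq_sqrt he
  rw [← h1, ← h2, ← h3, ← h4]
  simp only [Real.sqrt_sq (Real.sqrt_nonneg _)]
  nlinarith [sq_nonneg (√a * √e - √b * √c)]

/-- The coercivity constant. -/
def coerc (Λ : ℝ) : ℝ := min (1 - 1 / (2 * Λ)) (1 / 2)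

theorem coerc_pos {Λ : ℝ} (hΛ : 1 / 2 < Λ) : 0 < coerc Λ := by
  refine lt_min ?_ (by norm_num)
  rw [sub_pos, div_lt_one (by linarith)]
  linarith

theorem coerc_le_one (Λ : ℝ) : coerc Λ ≤ 1 := (min_le_right _ _).trans (by norm_num)

/-- The stability constant of multiplication by cutoff functions. -/
def cutConst (d : ℕ) : ℝ := 4 * 2 ^ d + 4

theorem one_le_cutConst (d : ℕ) : 1 ≤ cutConst d := by
  have : (0 : ℝ) < 2 ^ d := by positivity
  rw [cutConst]
  linarith

namespace Helmholtz

variable {P : Helmholtz d} {M : QuadMesh d P.Ω} {W : ℝ}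

namespace Resolved

variable (hR : P.Resolved M W) (X : P.Aux M)

/-- The contribution of an element to `‖u‖_a² + ‖π u‖_s²`. -/
def en (j : Fin M.N) (u : Triple P.Ω P.Γ) : ℝ := ‖opG P M j u‖ ^ 2 + ‖hR.opP X j u‖ ^ 2

theorem en_nonneg (j : Fin M.N) (u : Triple P.Ω P.Γ) : 0 ≤ hR.en X j u := by
  rw [en]
  positivity

/-- `‖u‖_a² + ‖π u‖_s² + k ‖u‖²` with the last norm taken on `ΓR`. -/
def energy (u : Triple P.Ω P.Γ) : ℝ := ∑ j, hR.en X j u + P.k * ‖opR P u‖ ^ 2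

theorem boundary_nonneg (u : Triple P.Ω P.Γ) : 0 ≤ P.k * ‖opR P u‖ ^ 2 :=
  mul_nonneg P.k_pos.le (sq_nonneg _)

theorem energy_nonneg (u : Triple P.Ω P.Γ) : 0 ≤ hR.energy X u :=
  add_nonneg (Finset.sum_nonneg fun j _ => hR.en_nonneg X j u) (boundary_nonneg u)

theorem aNormSq_add_sNormSq (u : Triple P.Ω P.Γ) :
    P.aNormSq u + P.sNormSq M (P.proj X u.1) = ∑ j, hR.en X j u := by
  rw [aNormSq_eq M, hR.sNormSq_proj, ← Finset.sum_add_distrib]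
  rfl

theorem norm_sq_opS (j : Fin M.N) (u : Triple P.Ω P.Γ) :
    ‖hR.opS j u‖ ^ 2 = ‖hR.opP X j u‖ ^ 2 + ‖hR.opS j u - hR.opP X j u‖ ^ 2 := by
  have h0 : inner ℂ (hR.opP X j u) (hR.opS j u - hR.opP X j u) = 0 := by
    rw [opP_eq]
    exact Submodule.inner_right_of_mem_orthogonal (Submodule.starProjection_apply_mem _ _)
      (Submodule.sub_starProjection_mem_orthogonal _)
  have h1 := @norm_add_sq ℂ _ _ _ _ (hR.opP X j u) (hR.opS j u - hR.opP X j u)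
  rw [h0, add_sub_cancel] at h1
  simpa using h1

theorem norm_opP_le (j : Fin M.N) (u : Triple P.Ω P.Γ) : ‖hR.opP X j u‖ ≤ ‖hR.opS j u‖ := by
  refine le_of_sq_le_sq ?_ (norm_nonneg _)
  rw [hR.norm_sq_opS X]
  exact le_add_of_nonneg_right (sq_nonneg _)

theorem mass_le (j : Fin M.N) (u : Triple P.Ω P.Γ) :
    2 * P.k ^ 2 * ‖opM P M j u‖ ^ 2 ≤ ‖hR.opS j u‖ ^ 2 :=
  mul_norm_sq_le_norm_sq_smulOp_sqrt (by positivity) (hR.ae_lower j) (hR.memLp_sqrt_wt j) _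

theorem resK_mem_H1 {u : Triple P.Ω P.Γ} (hu : u ∈ P.V) (j : Fin M.N) :
    resK P M j u ∈ H1 (M.K j) ∅ := resT_mem_H1 (M.K_subset j) hu.1

theorem q_self (j : Fin M.N) (u : Triple P.Ω P.Γ) : hR.q X j u u
    = ((‖opG P M j u‖ ^ 2 + ‖hR.opP X j u‖ ^ 2 - P.k ^ 2 * ‖opM P M j u‖ ^ 2 : ℝ) : ℂ) := by
  rw [q, inner_self_eq_norm_sq_to_K, inner_self_eq_norm_sq_to_K, inner_self_eq_norm_sq_to_K]
  push_cast
  rfl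

theorem re_form_self (u : Triple P.Ω P.Γ) :
    (hR.form X u u).re = ∑ j, (hR.q X j u u).re := by
  rw [form, inner_self_eq_norm_sq_to_K, Complex.sub_re, Complex.re_sum]
  have : (Complex.I * P.k * ((‖opR P u‖ : ℝ) : ℂ) ^ 2).re = 0 := by
    rw [mul_assoc, ← Complex.ofReal_pow, ← Complex.ofReal_mul, Complex.I_mul_re, Complex.ofReal_im,
      neg_zero]
  rw [sub_eq_self]
  exact this

/-- The element contributions are real on the diagonal and the impedance term is `-ik‖u‖²`.
Multiplication by `1 + i` adds minus the imaginary part to the real part. -/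
theorem re_one_add_I_mul_form_self (u : Triple P.Ω P.Γ) :
    ((1 + Complex.I) * hR.form X u u).re = ∑ j, (hR.q X j u u).re + P.k * ‖opR P u‖ ^ 2 := by
  have h1 : (hR.form X u u).im = -(P.k * ‖opR P u‖ ^ 2) := by
    rw [form, inner_self_eq_norm_sq_to_K, Complex.sub_im, Complex.im_sum]
    have h2 : (Complex.I * P.k * ((‖opR P u‖ : ℝ) : ℂ) ^ 2).im = P.k * ‖opR P u‖ ^ 2 := by
      rw [mul_assoc, ← Complex.ofReal_pow, ← Complex.ofReal_mul, Complex.I_mul_im,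
        Complex.ofReal_re]
    have h3 : ∑ j, (hR.q X j u u).im = 0 :=
      Finset.sum_eq_zero fun j _ => by rw [hR.q_self, Complex.ofReal_im]
    rw [h3, zero_sub, neg_inj]
    exact h2
  rw [add_mul, one_mul, Complex.add_re, Complex.I_mul_re, h1, hR.re_form_self X, neg_neg]

section Gap

variable {Λ : ℝ} (hΛ : 1 / 2 < Λ) (hgap : ∀ j, Λ ≤ X.lam j (X.l j))

include hΛ hgap

theorem defect_le {u : Triple P.Ω P.Γ} (hu : u ∈ P.V) (j : Fin M.N) :
    ‖hR.opS j u - hR.opP X j u‖ ^ 2 ≤ 1 / Λ * ‖opG P M j u‖ ^ 2 := by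
  have := hR.spectral_gap X j (hgap j) (resK_mem_H1 hu j)
  rw [one_div, ← div_eq_inv_mul, le_div_iff₀ (by linarith), mul_comm]
  exact this

/-- Half of `‖u‖_s²` dominates the mass term. Splitting it by `π`, half of `‖πu‖_s²` and the
fraction `1/(2Λ)` of `‖u‖_a²` are spent, and the rest is positive exactly when `Λ > 1/2`. -/
theorem coerc_mul_en_le {u : Triple P.Ω P.Γ} (hu : u ∈ P.V) (j : Fin M.N) :
    coerc Λ * hR.en X j u ≤ (hR.q X j u u).re := by
  have h1 := hR.defect_le X hΛ hgap hu j
  have h2 := hR.mass_le j u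
  rw [hR.norm_sq_opS X] at h2
  rw [hR.q_self, Complex.ofReal_re, en]
  have h3 : coerc Λ * ‖opG P M j u‖ ^ 2 ≤ (1 - 1 / (2 * Λ)) * ‖opG P M j u‖ ^ 2 :=
    mul_le_mul_of_nonneg_right (min_le_left _ _) (sq_nonneg _)
  have h4 : coerc Λ * ‖hR.opP X j u‖ ^ 2 ≤ 1 / 2 * ‖hR.opP X j u‖ ^ 2 :=
    mul_le_mul_of_nonneg_right (min_le_right _ _) (sq_nonneg _)
  have h5 : 1 / (2 * Λ) = 1 / Λ / 2 := by rw [mul_comm, ← div_div]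
  rw [h5] at h3
  linarith

theorem norm_sq_opS_le {u : Triple P.Ω P.Γ} (hu : u ∈ P.V) (j : Fin M.N) :
    ‖hR.opS j u‖ ^ 2 ≤ 2 * hR.en X j u := by
  have h1 := hR.defect_le X hΛ hgap hu j
  rw [hR.norm_sq_opS X, en]
  have h2 : 1 / Λ * ‖opG P M j u‖ ^ 2 ≤ 2 * ‖opG P M j u‖ ^ 2 := by
    refine mul_le_mul_of_nonneg_right ?_ (sq_nonneg _)
    rw [div_le_iff₀ (by linarith)]
    linarith
  nlinarith [sq_nonneg ‖hR.opP X j u‖]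

/-- The gradient and projection terms together cost one product of square roots, the mass term
another, because `2k² ≤ Ã` and `‖u‖_s² ≤ 2 en` give `k‖u‖ ≤ √en`. -/
theorem norm_q_le {u v : Triple P.Ω P.Γ} (hu : u ∈ P.V) (hv : v ∈ P.V) (j : Fin M.N) :
    ‖hR.q X j u v‖ ≤ 2 * (√(hR.en X j u) * √(hR.en X j v)) := by
  have hk := P.k_pos
  have hS : ∀ {w : Triple P.Ω P.Γ}, w ∈ P.V → P.k * ‖opM P M j w‖ ≤ √(hR.en X j w) := by
    intro w hw
    refine Real.le_sqrt_of_sq_le ?_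
    have h1 := hR.mass_le j w
    have h2 := hR.norm_sq_opS_le X hΛ hgap hw j
    rw [mul_pow]
    linarith
  have h1 : ‖opG P M j v‖ * ‖opG P M j u‖ + ‖hR.opP X j v‖ * ‖hR.opP X j u‖
      ≤ √(hR.en X j v) * √(hR.en X j u) := by
    have := add_sqrt_mul_sqrt_le (sq_nonneg ‖opG P M j v‖) (sq_nonneg ‖opG P M j u‖)
      (sq_nonneg ‖hR.opP X j v‖) (sq_nonneg ‖hR.opP X j u‖)
    simpa only [en, Real.sqrt_sq (norm_nonneg _)] using this
  have h2 : P.k * ‖opM P M j v‖ * (P.k * ‖opM P M j u‖) ≤ √(hR.en X j v) * √(hR.en X j u) :=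
    mul_le_mul (hS hv) (hS hu) (by positivity) (Real.sqrt_nonneg _)
  have h3 : ‖(P.k : ℂ) ^ 2 * inner ℂ (opM P M j v) (opM P M j u)‖
      ≤ P.k * ‖opM P M j v‖ * (P.k * ‖opM P M j u‖) := by
    rw [norm_mul, norm_pow, Complex.norm_real, Real.norm_of_nonneg hk.le]
    have := mul_le_mul_of_nonneg_left (norm_inner_le_norm (𝕜 := ℂ) (opM P M j v) (opM P M j u))
      (sq_nonneg P.k)
    linarith
  have h4 := norm_inner_le_norm (𝕜 := ℂ) (opG P M j v) (opG P M j u)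
  have h5 := norm_inner_le_norm (𝕜 := ℂ) (hR.opP X j v) (hR.opP X j u)
  rw [q]
  refine (norm_sub_le _ _).trans ?_
  have h6 := norm_add_le (inner ℂ (opG P M j v) (opG P M j u))
    (inner ℂ (hR.opP X j v) (hR.opP X j u))
  linarith

theorem norm_form_le {u v : Triple P.Ω P.Γ} (hu : u ∈ P.V) (hv : v ∈ P.V) :
    ‖hR.form X u v‖ ≤ 2 * (√(hR.energy X u) * √(hR.energy X v)) := by
  have hk := P.k_pos
  have h1 : ‖∑ j, hR.q X j u v‖ ≤ 2 * (√(∑ j, hR.en X j u) * √(∑ j, hR.en X j v)) := by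
    refine (norm_sum_le_of_le _ fun j _ => hR.norm_q_le X hΛ hgap hu hv j).trans ?_
    rw [← Finset.mul_sum]
    exact mul_le_mul_of_nonneg_left (Real.sum_sqrt_mul_sqrt_le _ (fun j => hR.en_nonneg X j u)
      fun j => hR.en_nonneg X j v) two_pos.le
  have h2 : ‖Complex.I * P.k * inner ℂ (opR P v) (opR P u)‖
      ≤ √(P.k * ‖opR P u‖ ^ 2) * √(P.k * ‖opR P v‖ ^ 2) := by
    rw [norm_mul, norm_mul, Complex.norm_I, one_mul, Complex.norm_real,
      Real.norm_of_nonneg hk.le, Real.sqrt_mul hk.le, Real.sqrt_mul hk.le,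
      Real.sqrt_sq (norm_nonneg _), Real.sqrt_sq (norm_nonneg _)]
    have h3 := mul_le_mul_of_nonneg_left (norm_inner_le_norm (𝕜 := ℂ) (opR P v) (opR P u)) hk.le
    have h4 := Real.mul_self_sqrt hk.le
    calc P.k * ‖inner ℂ (opR P v) (opR P u)‖ ≤ P.k * (‖opR P v‖ * ‖opR P u‖) := h3
      _ = √P.k * √P.k * (‖opR P v‖ * ‖opR P u‖) := by rw [h4]
      _ = √P.k * ‖opR P u‖ * (√P.k * ‖opR P v‖) := by ring
  have h3 := add_sqrt_mul_sqrt_le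
    (Finset.sum_nonneg fun j (_ : j ∈ Finset.univ) => hR.en_nonneg X j u)
    (Finset.sum_nonneg fun j (_ : j ∈ Finset.univ) => hR.en_nonneg X j v)
    (boundary_nonneg u) (boundary_nonneg v)
  have h4 : 0 ≤ √(P.k * ‖opR P u‖ ^ 2) * √(P.k * ‖opR P v‖ ^ 2) := by positivity
  rw [form, energy, energy]
  refine (norm_sub_le _ _).trans ?_
  linarith

/-- Gårding type inequality: a rotation of the form is coercive. -/
theorem coerc_mul_energy_le {u : Triple P.Ω P.Γ} (hu : u ∈ P.V) :
    coerc Λ * hR.energy X u ≤ ((1 + Complex.I) * hR.form X u u).re := by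
  rw [hR.re_one_add_I_mul_form_self X, energy, mul_add, Finset.mul_sum]
  exact add_le_add (Finset.sum_le_sum fun j _ => hR.coerc_mul_en_le X hΛ hgap hu j)
    (mul_le_of_le_one_left (boundary_nonneg u) (coerc_le_one Λ))

theorem coerc_mul_sum_en_le {u : Triple P.Ω P.Γ} (hu : u ∈ P.V) :
    coerc Λ * ∑ j, hR.en X j u ≤ (hR.form X u u).re := by
  rw [hR.re_form_self X, Finset.mul_sum]
  exact Finset.sum_le_sum fun j _ => hR.coerc_mul_en_le X hΛ hgap hu j

variable {L : NNReal} {g : E d → ℝ} (hg : M.IsCutoff L g)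

/-- Multiplication by `g` does not commute with `π`, so `π(g u)` is bounded through `‖g u‖_s ≤
‖u‖_s` and `‖u‖_s² ≤ 2 en`. The gradient contributes `2 + 4 * 2 ^ d`, the projection `2`, which adds
up to `cutConst d`. -/
theorem en_cut_le {u : Triple P.Ω P.Γ} (hu : u ∈ P.V) (j : Fin M.N) :
    hR.en X j (hg.op u) ≤ cutConst d * hR.en X j u := by
  have h1 := hR.norm_sq_opG_cut_le hg j u
  have h2 : ‖hR.opP X j (hg.op u)‖ ^ 2 ≤ ‖hR.opS j u‖ ^ 2 :=
    pow_le_pow_left₀ (norm_nonneg _) ((hR.norm_opP_le X j _).trans (hR.norm_opS_cut_le hg j u)) 2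
  have h3 := hR.norm_sq_opS_le X hΛ hgap hu j
  have h4 : ‖opG P M j u‖ ^ 2 ≤ hR.en X j u := le_add_of_nonneg_right (sq_nonneg _)
  have h5 : (0 : ℝ) ≤ 2 ^ d := by positivity
  have h6 := mul_le_mul_of_nonneg_left h3 h5
  rw [en, cutConst]
  nlinarith

end Gap

/-! ### Locality and sesquilinearity of the form. -/

theorem ops_eq_of_resK_eq {j : Fin M.N} {u v : Triple P.Ω P.Γ}
    (h : resK P M j u = resK P M j v) : opG P M j u = opG P M j v ∧ opM P M j u = opM P M j v ∧
      hR.opP X j u = hR.opP X j v := by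
  refine ⟨?_, ?_, ?_⟩
  · rw [opG, ContinuousLinearMap.comp_apply, h]; rfl
  · rw [opM, ContinuousLinearMap.comp_apply, h]; rfl
  · rw [opP_eq, opP_eq, opS, ContinuousLinearMap.comp_apply, h]; rfl

theorem q_congr_right {j : Fin M.N} (u : Triple P.Ω P.Γ) {v w : Triple P.Ω P.Γ}
    (h : resK P M j v = resK P M j w) : hR.q X j u v = hR.q X j u w := by
  obtain ⟨h1, h2, h3⟩ := hR.ops_eq_of_resK_eq X h
  rw [q, q, h1, h2, h3]

theorem q_congr_left {j : Fin M.N} {u v : Triple P.Ω P.Γ} (w : Triple P.Ω P.Γ)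
    (h : resK P M j u = resK P M j v) : hR.q X j u w = hR.q X j v w := by
  obtain ⟨h1, h2, h3⟩ := hR.ops_eq_of_resK_eq X h
  rw [q, q, h1, h2, h3]

theorem q_zero_right (j : Fin M.N) (u : Triple P.Ω P.Γ) : hR.q X j u 0 = 0 := by
  simp [q]

theorem q_zero_left (j : Fin M.N) (u : Triple P.Ω P.Γ) : hR.q X j 0 u = 0 := by
  simp [q]

theorem en_zero (j : Fin M.N) : hR.en X j 0 = 0 := by simp [en]

theorem en_congr {j : Fin M.N} {u v : Triple P.Ω P.Γ} (h : resK P M j u = resK P M j v) :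
    hR.en X j u = hR.en X j v := by
  obtain ⟨h1, -, h3⟩ := hR.ops_eq_of_resK_eq X h
  rw [en, en, h1, h3]

theorem form_add_left (u v w : Triple P.Ω P.Γ) :
    hR.form X (u + v) w = hR.form X u w + hR.form X v w := by
  simp only [form, q, map_add, inner_add_right, mul_add, Finset.sum_add_distrib,
    Finset.sum_sub_distrib]
  ring

theorem form_add_right (u v w : Triple P.Ω P.Γ) :
    hR.form X u (v + w) = hR.form X u v + hR.form X u w := by
  simp only [form, q, map_add, inner_add_left, mul_add, Finset.sum_add_distrib,
    Finset.sum_sub_distrib]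
  ring

theorem form_smul_left (c : ℂ) (u w : Triple P.Ω P.Γ) :
    hR.form X (c • u) w = c * hR.form X u w := by
  simp only [form, q, map_smul, inner_smul_right, mul_sub, Finset.mul_sum, Finset.sum_sub_distrib,
    mul_add]
  congr 1
  · congr 1
    refine Finset.sum_congr rfl fun j _ => ?_
    ring
  · ring

theorem form_neg_left (u w : Triple P.Ω P.Γ) : hR.form X (-u) w = -hR.form X u w := by
  rw [← neg_one_smul ℂ, form_smul_left, neg_one_mul]

theorem form_sub_left (u v w : Triple P.Ω P.Γ) :
    hR.form X (u - v) w = hR.form X u w - hR.form X v w := by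
  rw [sub_eq_add_neg, form_add_left, form_neg_left, sub_eq_add_neg]

theorem form_zero_left (w : Triple P.Ω P.Γ) : hR.form X 0 w = 0 := by
  have := hR.form_smul_left X 0 0 w
  rwa [zero_smul, zero_mul] at this

theorem form_sum_left {ι : Type*} (s : Finset ι) (u : ι → Triple P.Ω P.Γ) (w : Triple P.Ω P.Γ) :
    hR.form X (∑ i ∈ s, u i) w = ∑ i ∈ s, hR.form X (u i) w := by
  classical
  induction s using Finset.induction_on with
  | empty => simp [form_zero_left]
  | insert i s hi ih => rw [Finset.sum_insert hi, Finset.sum_insert hi, form_add_left, ih]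

end Resolved

end Helmholtz

/-! ### Well-posedness -/

theorem isClosed_ae_eq_zero {α F : Type*} [MeasurableSpace α] [NormedAddCommGroup F]
    [InnerProductSpace ℂ F] {μ : Measure α} {s : Set α} (hs : MeasurableSet s) :
    IsClosed {f : Lp F 2 μ | ∀ᵐ x ∂μ, x ∈ s → f x = 0} := by
  have h : {f : Lp F 2 μ | ∀ᵐ x ∂μ, x ∈ s → f x = 0}
      = (resLp (ν := μ.restrict s) (F := F) Measure.restrict_le_self) ⁻¹' {0} := by
    ext f
    rw [mem_preimage, mem_singleton_iff, Lp.eq_zero_iff_ae_eq_zero, mem_ofPred_eq,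
      ← ae_restrict_iff' hs]
    exact Filter.eventually_congr ((coeFn_resLp _ f).mono fun x hx => by rw [hx]; rfl)
  rw [h]
  exact isClosed_singleton.preimage (ContinuousLinearMap.continuous _)

theorem lax_milgram {F : Type*} [NormedAddCommGroup F] [InnerProductSpace ℂ F] [CompleteSpace F]
    (A : F →L[ℂ] F) {c : ℝ} (hc : 0 < c) (h : ∀ u, c * ‖u‖ ^ 2 ≤ ‖inner ℂ u (A u)‖) (f : F) :
    ∃ u, A u = f := by
  lift c to NNReal using hc.le
  have hu : IsUnit A := ContinuousLinearMap.isUnit_of_forall_le_norm_inner_map A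
    (NNReal.coe_pos.1 hc) fun u => by
      rw [← inner_conj_symm, RCLike.norm_conj, mul_comm]
      exact h u
  exact (ContinuousLinearMap.isUnit_iff_bijective.1 hu).2 f

/-- The Hilbert space structure on triples. -/
abbrev HTriple (D S : Set (E d)) :=
  WithLp 2 (Lp ℂ 2 (volume.restrict D) ×
    WithLp 2 (Lp (CVec d) 2 (volume.restrict D) × Lp ℂ 2 ((surf d).restrict S)))

/-- Triples with the Hilbert space norm. -/
def toTriple (D S : Set (E d)) : HTriple D S ≃L[ℂ] Triple D S :=
  (WithLp.prodContinuousLinearEquiv 2 ℂ _ _).trans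
    ((ContinuousLinearEquiv.refl ℂ _).prodCongr (WithLp.prodContinuousLinearEquiv 2 ℂ _ _))

namespace Helmholtz

variable {P : Helmholtz d} {M : QuadMesh d P.Ω} {W : ℝ}

theorem isClosed_V (P : Helmholtz d) : IsClosed (P.V : Set (Triple P.Ω P.Γ)) :=
  (Submodule.isClosed_topologicalClosure _).inter
    ((isClosed_ae_eq_zero P.ΓD_measurable).preimage (continuous_snd.comp continuous_snd))

theorem isClosed_V0 (P : Helmholtz d) (D : Set (E d)) :
    IsClosed (P.V0 D : Set (Triple P.Ω P.Γ)) := by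
  have hD : MeasurableSet (closure D)ᶜ := isClosed_closure.measurableSet.compl
  have h : (P.V0 D : Set (Triple P.Ω P.Γ)) = (P.V : Set (Triple P.Ω P.Γ)) ∩
      (({u | ∀ᵐ x ∂volume.restrict P.Ω, x ∈ (closure D)ᶜ → u.1 x = 0} ∩
        {u | ∀ᵐ x ∂volume.restrict P.Ω, x ∈ (closure D)ᶜ → u.2.1 x = 0}) ∩
      {u | ∀ᵐ x ∂(surf d).restrict P.Γ, x ∈ (closure D)ᶜ → u.2.2 x = 0}) := by
    ext u
    refine and_congr Iff.rfl (and_congr ?_ Iff.rfl)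
    rw [mem_inter_iff, mem_ofPred_eq, mem_ofPred_eq, ← Filter.eventually_and]
    exact Filter.eventually_congr (Filter.Eventually.of_forall fun x => imp_and)
  rw [h]
  exact P.isClosed_V.inter ((((isClosed_ae_eq_zero hD).preimage continuous_fst).inter
    ((isClosed_ae_eq_zero hD).preimage (continuous_fst.comp continuous_snd))).inter
    ((isClosed_ae_eq_zero hD).preimage (continuous_snd.comp continuous_snd)))

theorem V0_le_V (P : Helmholtz d) (D : Set (E d)) : P.V0 D ≤ P.V := fun _ hu => hu.1

theorem norm_sq_fst (M : QuadMesh d P.Ω) (u : Triple P.Ω P.Γ) :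
    ‖u.1‖ ^ 2 = ∑ j, ‖opM P M j u‖ ^ 2 := by
  have h := mass_eq_sum M u u
  have h1 : ∫ x in P.Ω, u.1 x * (starRingEnd ℂ) (u.1 x) = inner ℂ u.1 u.1 :=
    (L2.inner_def (𝕜 := ℂ) u.1 u.1).symm
  simp only [h1, inner_self_eq_norm_sq_to_K] at h
  exact_mod_cast h

theorem norm_sq_grad_le (u : Triple P.Ω P.Γ) : P.ε ^ 2 * ‖u.2.1‖ ^ 2 ≤ P.aNormSq u := by
  have hA : ∀ᵐ x ∂volume.restrict P.Ω, P.ε ^ 2 ≤ P.A x ∧ P.A x ≤ 1 :=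
    (ae_restrict_iff' P.lipschitz.isOpen.measurableSet).2
      (Filter.Eventually.of_forall fun x hx => ⟨P.ε_sq_le_A hx, P.A_le_one hx⟩)
  rw [norm_sq_Lp, ← integral_const_mul]
  refine integral_mono_ae ((integrable_norm_sq_Lp _).const_mul _)
    ((integrable_norm_sq_Lp u.2.1).mono' (P.A_measurable.aestronglyMeasurable.mul
      ((Lp.aestronglyMeasurable _).norm.pow 2)) ?_) ?_
  · filter_upwards [hA] with x hx
    rw [Real.norm_of_nonneg (mul_nonneg ((sq_nonneg _).trans hx.1) (sq_nonneg _))]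
    exact mul_le_of_le_one_left (sq_nonneg _) hx.2
  · filter_upwards [hA] with x hx
    exact mul_le_mul_of_nonneg_right hx.1 (sq_nonneg _)

/-- Functions in `V` vanish on `ΓD`, so the norm on `ΓR`, which the energy controls, is the norm of
the whole trace. -/
theorem norm_trace_eq {u : Triple P.Ω P.Γ} (hu : u ∈ P.V) : ‖u.2.2‖ ^ 2 = ‖opR P u‖ ^ 2 := by
  rw [norm_sq_Lp, norm_sq_Lp]
  have h1 : ∫ x in P.ΓR, ‖opR P u x‖ ^ 2 ∂surf d = ∫ x in P.ΓR, ‖u.2.2 x‖ ^ 2 ∂surf d := by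
    refine integral_congr_ae ?_
    filter_upwards [coeFn_opR u] with x hx
    rw [hx]
  have hm : MeasurableSet P.Γ := P.ΓD_measurable.union P.ΓR_measurable
  refine Eq.trans ?_ h1.symm
  refine setIntegral_eq_of_subset_of_ae_sdiff_eq_zero hm.nullMeasurableSet subset_union_right ?_
  filter_upwards [(ae_restrict_iff' hm).1 hu.2] with x hx hx'
  rw [hx hx'.1 (hx'.1.resolve_right hx'.2), norm_zero]
  norm_num

namespace Resolved

variable (hR : P.Resolved M W) (X : P.Aux M) {Λ : ℝ}

/-- The operator of the form `𝓑(u, v) + s(π u, π v)` on a Hilbert space that is mapped to the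
space of triples. -/
def formOp {F : Type*} [NormedAddCommGroup F] [InnerProductSpace ℂ F] [CompleteSpace F]
    (e : F →L[ℂ] Triple P.Ω P.Γ) : F →L[ℂ] F :=
  ∑ j, ((((opG P M j).comp e).adjoint.comp ((opG P M j).comp e)
    + ((hR.opP X j).comp e).adjoint.comp ((hR.opP X j).comp e))
    - (P.k : ℂ) ^ 2 • ((opM P M j).comp e).adjoint.comp ((opM P M j).comp e))
    - (Complex.I * P.k) • ((opR P).comp e).adjoint.comp ((opR P).comp e)

theorem inner_formOp {F : Type*} [NormedAddCommGroup F] [InnerProductSpace ℂ F] [CompleteSpace F]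
    (e : F →L[ℂ] Triple P.Ω P.Γ) (u v : F) :
    inner ℂ v (hR.formOp X e u) = hR.form X (e u) (e v) := by
  simp only [formOp, form, q, sub_apply, add_apply,
    sum_apply, smul_apply,
    ContinuousLinearMap.comp_apply, inner_sub_right, inner_add_right, inner_sum, inner_smul_right,
    ContinuousLinearMap.adjoint_inner_right]

variable (hΛ : 1 / 2 < Λ) (hgap : ∀ j, Λ ≤ X.lam j (X.l j))
include hR hΛ hgap

/-- The constant depends on `k` and `ε`; it serves only existence and uniqueness and does not enter
the localization estimate. -/
theorem norm_sq_le_energy {u : Triple P.Ω P.Γ} (hu : u ∈ P.V) :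
    ‖u‖ ^ 2 ≤ ((P.k ^ 2)⁻¹ + (P.ε ^ 2)⁻¹ + P.k⁻¹) * hR.energy X u := by
  have hk := P.k_pos
  have hε := P.ε_pos
  have hb := boundary_nonneg u
  have hs : 0 ≤ ∑ j, hR.en X j u := Finset.sum_nonneg fun j _ => hR.en_nonneg X j u
  have hE : hR.energy X u = ∑ j, hR.en X j u + P.k * ‖opR P u‖ ^ 2 := rfl
  have h1 : ‖u.1‖ ^ 2 ≤ (P.k ^ 2)⁻¹ * hR.energy X u := by
    rw [inv_mul_eq_div, le_div_iff₀ (by positivity), norm_sq_fst M, Finset.sum_mul, hE]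
    refine le_add_of_le_of_nonneg (Finset.sum_le_sum fun j _ => ?_) hb
    have h2 := hR.mass_le j u
    have h3 := hR.norm_sq_opS_le X hΛ hgap hu j
    linarith
  have h2 : ‖u.2.1‖ ^ 2 ≤ (P.ε ^ 2)⁻¹ * hR.energy X u := by
    rw [inv_mul_eq_div, le_div_iff₀ (by positivity), hE, mul_comm]
    refine (norm_sq_grad_le u).trans (le_add_of_le_of_nonneg ?_ hb)
    rw [aNormSq_eq M]
    exact Finset.sum_le_sum fun j _ => le_add_of_nonneg_right (sq_nonneg _)
  have h3 : ‖u.2.2‖ ^ 2 ≤ P.k⁻¹ * hR.energy X u := by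
    rw [inv_mul_eq_div, le_div_iff₀ hk, norm_trace_eq hu, hE, mul_comm]
    exact le_add_of_nonneg_left hs
  have hEn := hR.energy_nonneg X u
  have p1 : 0 ≤ (P.k ^ 2)⁻¹ * hR.energy X u := by positivity
  have p2 : 0 ≤ (P.ε ^ 2)⁻¹ * hR.energy X u := by positivity
  have p3 : 0 ≤ P.k⁻¹ * hR.energy X u := by positivity
  rw [add_mul, add_mul]
  rcases max_choice ‖u.1‖ ‖u.2‖ with h | h <;> rw [Prod.norm_def, h]
  · linarith
  · rcases max_choice ‖u.2.1‖ ‖u.2.2‖ with h' | h' <;> rw [Prod.norm_def, h'] <;> linarith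

theorem coerc_mul_energy_le_norm {u : Triple P.Ω P.Γ} (hu : u ∈ P.V) :
    coerc Λ * hR.energy X u ≤ 2 * ‖hR.form X u u‖ := by
  refine (hR.coerc_mul_energy_le X hΛ hgap hu).trans ((Complex.re_le_norm _).trans ?_)
  rw [norm_mul]
  refine mul_le_mul_of_nonneg_right ((norm_add_le _ _).trans ?_) (norm_nonneg _)
  rw [norm_one, Complex.norm_I]
  norm_num

theorem eq_zero_of_form_eq_zero {u : Triple P.Ω P.Γ} (hu : u ∈ P.V) (h : hR.form X u u = 0) :
    u = 0 := by
  have h1 := hR.coerc_mul_energy_le_norm X hΛ hgap hu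
  rw [h, norm_zero, mul_zero] at h1
  have h2 : hR.energy X u = 0 :=
    le_antisymm (nonpos_of_mul_nonpos_right h1 (coerc_pos hΛ)) (hR.energy_nonneg X u)
  have h3 := hR.norm_sq_le_energy X hΛ hgap hu
  rw [h2, mul_zero] at h3
  exact norm_eq_zero.1 (pow_eq_zero_iff two_ne_zero |>.1 (le_antisymm h3 (sq_nonneg _)))

/-- Triples carry the maximum norm of a product, which is not Hilbertian. Lax–Milgram is therefore
applied on a Hilbert space `F` mapped to the triples by an `e` that is bounded below. -/
theorem exists_form_eq {F : Type*} [NormedAddCommGroup F] [InnerProductSpace ℂ F]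
    [CompleteSpace F] (e : F →L[ℂ] Triple P.Ω P.Γ) (heV : ∀ u, e u ∈ P.V) {n : ℝ} (hn : 0 < n)
    (hnorm : ∀ u, ‖u‖ ≤ n * ‖e u‖) (j : Fin M.N) (t : Lp ℂ 2 (volume.restrict P.Ω)) :
    ∃ u, ∀ v, hR.form X (e u) (e v) = inner ℂ (hR.opP X j (e v)) (hR.dat X j t) := by
  set c : ℝ := (P.k ^ 2)⁻¹ + (P.ε ^ 2)⁻¹ + P.k⁻¹
  have hk := P.k_pos
  have hε := P.ε_pos
  have hcpos : 0 < c := by positivity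
  have hc0 := coerc_pos hΛ
  obtain ⟨u, hu⟩ := lax_milgram (hR.formOp X e) (c := coerc Λ / (2 * c * n ^ 2)) (by positivity)
    (fun u => by
      rw [inner_formOp, div_mul_eq_mul_div, div_le_iff₀ (by positivity)]
      have h1 := hR.norm_sq_le_energy X hΛ hgap (heV u)
      have h2 := hR.coerc_mul_energy_le_norm X hΛ hgap (heV u)
      have h3 : ‖u‖ ^ 2 ≤ n ^ 2 * ‖e u‖ ^ 2 := by
        rw [← mul_pow]
        exact pow_le_pow_left₀ (norm_nonneg _) (hnorm u) 2
      have h4 : ‖u‖ ^ 2 ≤ n ^ 2 * (c * hR.energy X (e u)) :=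
        h3.trans (mul_le_mul_of_nonneg_left h1 (sq_nonneg n))
      calc coerc Λ * ‖u‖ ^ 2 ≤ coerc Λ * (n ^ 2 * (c * hR.energy X (e u))) :=
            mul_le_mul_of_nonneg_left h4 hc0.le
        _ = c * n ^ 2 * (coerc Λ * hR.energy X (e u)) := by ring
        _ ≤ c * n ^ 2 * (2 * ‖hR.form X (e u) (e u)‖) :=
            mul_le_mul_of_nonneg_left h2 (by positivity)
        _ = _ := by ring)
    (((hR.opP X j).comp e).adjoint (hR.dat X j t))
  refine ⟨u, fun v => ?_⟩
  rw [← inner_formOp, hu, ContinuousLinearMap.adjoint_inner_right]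
  rfl

theorem existsUnique_isCorrector_of_equiv {F : Type*} [NormedAddCommGroup F]
    [InnerProductSpace ℂ F] [CompleteSpace F] (τ : F ≃L[ℂ] Triple P.Ω P.Γ)
    {V₀ : Submodule ℂ (Triple P.Ω P.Γ)} (hV : V₀ ≤ P.V)
    (hc : IsClosed (V₀ : Set (Triple P.Ω P.Γ))) (j : Fin M.N)
    (t : Lp ℂ 2 (volume.restrict P.Ω)) : ∃! u, P.IsCorrector X V₀ j t u := by
  let V' : Submodule ℂ (F) := V₀.comap τ.toContinuousLinearMap.toLinearMap
  have hcl : IsClosed (V' : Set (F)) := hc.preimage τ.continuous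
  have : CompleteSpace V' := hcl.completeSpace_coe
  let e : V' →L[ℂ] Triple P.Ω P.Γ := τ.toContinuousLinearMap.comp V'.subtypeL
  have heV : ∀ u, e u ∈ V₀ := fun u => u.2
  have hnorm : ∀ u, ‖u‖ ≤ (‖τ.symm.toContinuousLinearMap‖ + 1) * ‖e u‖ := by
    intro u
    have h1 := τ.symm.toContinuousLinearMap.le_opNorm (e u)
    have h2 : τ.symm.toContinuousLinearMap (e u) = (u : F) :=
      τ.symm_apply_apply _
    rw [h2] at h1
    exact h1.trans (mul_le_mul_of_nonneg_right (le_add_of_nonneg_right zero_le_one)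
      (norm_nonneg _))
  obtain ⟨u, hu⟩ := hR.exists_form_eq X hΛ hgap e (fun u => hV (heV u))
    (add_pos_of_nonneg_of_pos (norm_nonneg _) one_pos) hnorm j t
  have hsol : ∀ v ∈ V₀, hR.form X (e u) v = inner ℂ (hR.opP X j v) (hR.dat X j t) := by
    intro v hv
    have hv' : τ.symm v ∈ V' := by
      have h : τ (τ.symm v) ∈ V₀ := (τ.apply_symm_apply v).symm ▸ hv
      exact h
    have h := hu ⟨τ.symm v, hv'⟩
    have h3 : e ⟨τ.symm v, hv'⟩ = v := τ.apply_symm_apply v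
    rwa [h3] at h
  refine ⟨e u, (hR.isCorrector_iff X V₀ j t _).2 ⟨heV u, hsol⟩, fun u' hu' => ?_⟩
  obtain ⟨hu1, hu2⟩ := (hR.isCorrector_iff X V₀ j t u').1 hu'
  have hd : u' - e u ∈ V₀ := V₀.sub_mem hu1 (heV u)
  rw [← sub_eq_zero]
  refine hR.eq_zero_of_form_eq_zero X hΛ hgap (hV hd) ?_
  rw [form_sub_left, hu2 _ hd, hsol _ hd, sub_self]

theorem existsUnique_isCorrector {V₀ : Submodule ℂ (Triple P.Ω P.Γ)} (hV : V₀ ≤ P.V)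
    (hc : IsClosed (V₀ : Set (Triple P.Ω P.Γ))) (j : Fin M.N)
    (t : Lp ℂ 2 (volume.restrict P.Ω)) : ∃! u, P.IsCorrector X V₀ j t u :=
  hR.existsUnique_isCorrector_of_equiv X hΛ hgap (toTriple P.Ω P.Γ) hV hc j t

theorem isCorrector_corrector {V₀ : Submodule ℂ (Triple P.Ω P.Γ)} (hV : V₀ ≤ P.V)
    (hc : IsClosed (V₀ : Set (Triple P.Ω P.Γ))) (j : Fin M.N)
    (t : Lp ℂ 2 (volume.restrict P.Ω)) : P.IsCorrector X V₀ j t (P.corrector X V₀ j t) := by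
  have h := (hR.existsUnique_isCorrector X hΛ hgap hV hc j t).exists
  rw [corrector, dif_pos h]
  exact h.choose_spec

end Resolved

end Helmholtz

/-! ### Decay of the correctors -/

theorem le_of_mul_le_sqrt_mul_sqrt {a b c : ℝ} (hc : 0 < c) (ha : 0 ≤ a) (hb : 0 ≤ b)
    (h : c * a ≤ 4 * (√a * √b)) : a ≤ 16 / c ^ 2 * b := by
  rcases ha.eq_or_lt with rfl | ha'
  · positivity
  have h1 : 0 < √a := Real.sqrt_pos.2 ha'
  have h2 : c * √a ≤ 4 * √b := by
    refine le_of_mul_le_mul_right ?_ h1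
    have := Real.mul_self_sqrt ha
    nlinarith
  have h3 : (c * √a) ^ 2 ≤ (4 * √b) ^ 2 := pow_le_pow_left₀ (by positivity) h2 2
  rw [mul_pow, mul_pow, Real.sq_sqrt ha, Real.sq_sqrt hb] at h3
  rw [div_mul_eq_mul_div, le_div_iff₀ (by positivity)]
  linarith

theorem neg_two_mul_norm_le_re (z : ℂ) : -(2 * ‖z‖) ≤ ((1 + Complex.I) * z).re := by
  have h1 := Complex.abs_re_le_norm z
  have h2 := Complex.abs_im_le_norm z
  rw [add_mul, one_mul, Complex.add_re, Complex.I_mul_re]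
  have h3 := neg_abs_le z.re
  have h4 := le_abs_self z.im
  linarith

theorem rgrad_one_sub (g : E d → ℝ) (x : E d) : rgrad (fun x => 1 - g x) x = -rgrad g x := by
  ext i
  simp [rgrad, fderiv_const_sub]

namespace QuadMesh

variable {Ω : Set (E d)} (M : QuadMesh d Ω)

/-- An element outside `m + 1` layers does not touch the first `m` layers, so all its nodal values
are zero. The transition takes exactly one layer. -/
theorem exists_layer_cutoff (hΩ : IsLipschitzDomain Ω) (j : Fin M.N) (m : ℕ) :
    ∃ (L : NNReal) (g : E d → ℝ), M.IsCutoff L g ∧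
      (∀ i ∈ M.layer j m, ∀ x ∈ closedElem (M.vert i), g x = 1) ∧
      (∀ i ∉ M.layer j (m + 1), ∀ x ∈ closedElem (M.vert i), g x = 0) := by
  obtain ⟨L, g, hg, h1, h0⟩ := M.exists_cutoff hΩ (M.layerUnion j m)
  refine ⟨L, g, hg, fun i hi => h1 i (subset_biUnion_of_mem
    (u := fun i => closedElem (M.vert i)) hi), fun i hi => h0 i ?_⟩
  refine disjoint_iUnion₂_right.2 fun l hl => ?_
  by_contra hcon
  exact hi ⟨l, hl, by rw [inter_comm]; exact not_disjoint_iff_nonempty_inter.1 hcon⟩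

theorem K_subset_closedElem (i : Fin M.N) : M.K i ⊆ closedElem (M.vert i) :=
  openElem_subset_closedElem

theorem not_mem_layer {j i : Fin M.N} {m : ℕ} {x : E d} (hx : x ∉ M.layerUnion j m)
    (hi : x ∈ closedElem (M.vert i)) : i ∉ M.layer j m := fun h =>
  hx (mem_iUnion₂.2 ⟨i, h, hi⟩)

end QuadMesh

namespace Helmholtz

variable {P : Helmholtz d} {M : QuadMesh d P.Ω} {W : ℝ}

theorem Γ_subset_closure (P : Helmholtz d) : P.Γ ⊆ closure P.Ω :=
  (union_subset P.ΓD_subset P.ΓR_subset).trans frontier_subset_closure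

theorem ae_mem_closedElem (M : QuadMesh d P.Ω) :
    ∀ᵐ x ∂(surf d).restrict P.Γ, ∃ i, x ∈ closedElem (M.vert i) := by
  filter_upwards [ae_restrict_mem (P.ΓD_measurable.union P.ΓR_measurable)] with x hx
  exact mem_iUnion.1 (M.cover ▸ P.Γ_subset_closure hx)

theorem ae_mem_closedElem_ΓR (M : QuadMesh d P.Ω) :
    ∀ᵐ x ∂(surf d).restrict P.ΓR, ∃ i, x ∈ closedElem (M.vert i) :=
  ae_restrict_of_ae_restrict_of_subset subset_union_right (ae_mem_closedElem M)

section Cutoff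

variable {L : NNReal} {g : E d → ℝ} (hg : M.IsCutoff L g)

theorem op_add_one_sub_op (u : Triple P.Ω P.Γ) : hg.op u + hg.one_sub.op u = u := by
  refine Prod.ext (Lp.ext ?_) (Prod.ext (Lp.ext ?_) (Lp.ext ?_))
  · filter_upwards [Lp.coeFn_add (hg.op u).1 (hg.one_sub.op u).1,
      cutOp_fst hg.lipschitz hg.mem_Icc u, cutOp_fst hg.one_sub.lipschitz hg.one_sub.mem_Icc u]
      with x h1 h2 h3
    rw [Prod.fst_add, h1, Pi.add_apply, h2, h3]
    push_cast
    ring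
  · filter_upwards [Lp.coeFn_add (hg.op u).2.1 (hg.one_sub.op u).2.1,
      cutOp_grad hg.lipschitz hg.mem_Icc u, cutOp_grad hg.one_sub.lipschitz hg.one_sub.mem_Icc u]
      with x h1 h2 h3
    rw [Prod.snd_add, Prod.fst_add, h1, Pi.add_apply, h2, h3, rgrad_one_sub]
    push_cast
    module
  · filter_upwards [Lp.coeFn_add (hg.op u).2.2 (hg.one_sub.op u).2.2,
      cutOp_trace hg.lipschitz hg.mem_Icc u, cutOp_trace hg.one_sub.lipschitz hg.one_sub.mem_Icc u]
      with x h1 h2 h3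
    rw [Prod.snd_add, Prod.snd_add, h1, Pi.add_apply, h2, h3]
    push_cast
    ring

theorem resK_cut_of_eq_one {j : Fin M.N} (hc : ∀ x ∈ closedElem (M.vert j), g x = 1)
    (u : Triple P.Ω P.Γ) : resK P M j (hg.op u) = resK P M j u := by
  rw [resK_cut_of_eq hg fun x hx => hc x (M.K_subset_closedElem j hx), Complex.ofReal_one, one_smul]

theorem resK_cut_of_eq_zero {j : Fin M.N} (hc : ∀ x ∈ closedElem (M.vert j), g x = 0)
    (u : Triple P.Ω P.Γ) : resK P M j (hg.op u) = 0 := by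
  rw [resK_cut_of_eq hg fun x hx => hc x (M.K_subset_closedElem j hx), Complex.ofReal_zero,
    zero_smul]

theorem cut_mem_V0 {j : Fin M.N} {m : ℕ}
    (hc : ∀ i ∉ M.layer j m, ∀ x ∈ closedElem (M.vert i), g x = 0) {u : Triple P.Ω P.Γ}
    (hu : u ∈ P.V) : hg.op u ∈ P.V0 (M.patch j m) := by
  refine ⟨cut_mem_V hg hu, ?_, ?_⟩
  · have hK : ∀ᵐ x ∂volume.restrict P.Ω, ∃ i, x ∈ M.K i :=
      M.ae_restrict_of_forall fun j =>
        (ae_restrict_mem (M.measurableSet_K j)).mono fun x hx => ⟨j, hx⟩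
    filter_upwards [cutOp_fst hg.lipschitz hg.mem_Icc u, cutOp_grad hg.lipschitz hg.mem_Icc u, hK]
      with x h1 h2 ⟨i, hi⟩ hx
    rw [M.closure_patch] at hx
    have hi' := hc i (M.not_mem_layer hx (M.K_subset_closedElem i hi))
    rw [h1, h2, hi' x (M.K_subset_closedElem i hi),
      M.rgrad_eq_zero (fun y hy => hi' y (M.K_subset_closedElem i hy)) hi]
    simp
  · filter_upwards [cutOp_trace hg.lipschitz hg.mem_Icc u, ae_mem_closedElem M]
      with x h1 ⟨i, hi⟩ hx
    rw [M.closure_patch] at hx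
    rw [h1, hc i (M.not_mem_layer hx hi) x hi, Complex.ofReal_zero, zero_mul]

end Cutoff

theorem resK_of_mem_V0 {j i : Fin M.N} {m : ℕ} (hi : i ∉ M.layer j m) {u : Triple P.Ω P.Γ}
    (hu : u ∈ P.V0 (M.patch j m)) : resK P M i u = 0 := by
  have hx : ∀ x ∈ M.K i, x ∉ closure (M.patch j m) := fun x hx => by
    rw [M.closure_patch]
    exact disjoint_left.1 (M.K_disjoint_layerUnion hi) hx
  refine Triple.ext_ae ?_ ?_
  · filter_upwards [coeFn_resK_fst i u, M.ae_restrict_K hu.2.1 i,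
      ae_restrict_mem (M.measurableSet_K i), Lp.coeFn_zero ℂ 2 (volume.restrict (M.K i))]
      with x h1 h2 h3 h4
    rw [h1, (h2 (hx x h3)).1]
    exact h4.symm
  · filter_upwards [coeFn_resK_grad i u, M.ae_restrict_K hu.2.1 i,
      ae_restrict_mem (M.measurableSet_K i), Lp.coeFn_zero (CVec d) 2 (volume.restrict (M.K i))]
      with x h1 h2 h3 h4
    rw [h1, (h2 (hx x h3)).2]
    exact h4.symm

namespace Resolved

variable (hR : P.Resolved M W) (X : P.Aux M) {Λ : ℝ}

/-- On every element one of the two functions vanishes. The boundary integral is treated pointwise: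
a trace point outside the closed patch is handled by `u`, one in the patch by `g`, which vanishes on
closed elements. -/
theorem form_eq_zero_of_mem_V0 {L : NNReal} {g : E d → ℝ} (hg : M.IsCutoff L g) {j : Fin M.N}
    {m : ℕ} (hc : ∀ i ∈ M.layer j m, ∀ x ∈ closedElem (M.vert i), g x = 0)
    {u : Triple P.Ω P.Γ} (hu : u ∈ P.V0 (M.patch j m)) (v : Triple P.Ω P.Γ) :
    hR.form X u (hg.op v) = 0 := by
  have h1 : ∑ i, hR.q X i u (hg.op v) = 0 := Finset.sum_eq_zero fun i _ => by
    by_cases hi : i ∈ M.layer j m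
    · rw [hR.q_congr_right X u (w := 0) ((resK_cut_of_eq_zero hg (hc i hi) v).trans
        (map_zero _).symm), hR.q_zero_right]
    · rw [hR.q_congr_left X (v := 0) _ ((resK_of_mem_V0 hi hu).trans (map_zero _).symm),
        hR.q_zero_left]
  have h2 : inner ℂ (opR P (hg.op v)) (opR P u) = 0 := by
    rw [L2.inner_def]
    refine integral_eq_zero_of_ae ?_
    filter_upwards [coeFn_opR_cut hg v, coeFn_opR u,
      ae_restrict_of_ae_restrict_of_subset subset_union_right hu.2.2] with x h1 h2 h3
    rw [h1, h2]
    by_cases hx : x ∈ closure (M.patch j m)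
    · rw [M.closure_patch] at hx
      obtain ⟨i, hi, hxi⟩ := mem_iUnion₂.1 hx
      rw [hc i hi x hxi, Complex.ofReal_zero, zero_mul, inner_zero_left]
      rfl
    · rw [h3 hx, inner_zero_right]
      rfl
  rw [form, h1, h2, mul_zero, sub_zero]

open Classical in
/-- The energy outside `m` layers around an element. -/
def far (j : Fin M.N) (m : ℕ) (u : Triple P.Ω P.Γ) : ℝ :=
  ∑ i, if i ∈ M.layer j m then 0 else hR.en X i u

theorem far_nonneg (j : Fin M.N) (m : ℕ) (u : Triple P.Ω P.Γ) : 0 ≤ hR.far X j m u :=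
  Finset.sum_nonneg fun i _ => by
    split_ifs
    exacts [le_rfl, hR.en_nonneg X i u]

theorem far_le_sum_en (j : Fin M.N) (m : ℕ) (u : Triple P.Ω P.Γ) :
    hR.far X j m u ≤ ∑ i, hR.en X i u :=
  Finset.sum_le_sum fun i _ => by
    split_ifs
    exacts [hR.en_nonneg X i u, le_rfl]

/-- The decay rate per layer. -/
def _root_.CEM.rate (d : ℕ) (Λ : ℝ) : ℝ := 4 * cutConst d / (4 * cutConst d + coerc Λ)

theorem _root_.CEM.rate_pos (d : ℕ) (hΛ : 1 / 2 < Λ) : 0 < rate d Λ := by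
  have h1 := one_le_cutConst d
  have h2 := coerc_pos hΛ
  exact div_pos (by linarith) (by linarith)

theorem _root_.CEM.rate_lt_one (d : ℕ) (hΛ : 1 / 2 < Λ) : rate d Λ < 1 := by
  have h1 := one_le_cutConst d
  have h2 := coerc_pos hΛ
  exact (div_lt_one (by linarith)).2 (by linarith)

variable (hΛ : 1 / 2 < Λ) (hgap : ∀ j, Λ ≤ X.lam j (X.l j))
include hR hΛ hgap

/-- The test function is `g u`. It vanishes on `K_j`, so the data do not see it. Beyond `m + 1`
layers it equals `u` and coercivity applies; within `m` layers nothing remains. Only the transition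
layer, whose energy is the difference of two values of `far`, has no sign. -/
theorem caccioppoli {L : NNReal} {g : E d → ℝ} (hg : M.IsCutoff L g) {j : Fin M.N} {m : ℕ}
    (h0 : ∀ i ∈ M.layer j m, ∀ x ∈ closedElem (M.vert i), g x = 0)
    (h1 : ∀ i ∉ M.layer j (m + 1), ∀ x ∈ closedElem (M.vert i), g x = 1)
    {u : Triple P.Ω P.Γ} (hu : u ∈ P.V)
    (horth : ∀ v ∈ P.V, hR.opP X j v = 0 → hR.form X u v = 0) :
    coerc Λ * hR.far X j (m + 1) u
        + P.k * ∫ x, g x * ‖opR P u x‖ ^ 2 ∂((surf d).restrict P.ΓR)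
      ≤ 4 * cutConst d * (hR.far X j m u - hR.far X j (m + 1) u) := by
  classical
  have hC := one_le_cutConst d
  have hw := cut_mem_V hg hu
  have hform : hR.form X u (hg.op u) = 0 := by
    refine horth _ hw ?_
    rw [(hR.ops_eq_of_resK_eq X (v := 0) ((resK_cut_of_eq_zero hg
      (h0 j (M.self_mem_layer j m)) u).trans (map_zero _).symm)).2.2, map_zero]
  have hb : ((1 + Complex.I) * (Complex.I * P.k * inner ℂ (opR P (hg.op u)) (opR P u))).re
      = -(P.k * ∫ x, g x * ‖opR P u x‖ ^ 2 ∂((surf d).restrict P.ΓR)) := by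
    rw [inner_opR_cut, mul_assoc Complex.I, ← Complex.ofReal_mul, add_mul, one_mul, ← mul_assoc,
      Complex.I_mul_I, Complex.add_re, Complex.I_mul_re, Complex.ofReal_im, neg_one_mul,
      Complex.neg_re, Complex.ofReal_re, neg_zero, zero_add]
  have hsum : ∑ i, ((1 + Complex.I) * hR.q X i u (hg.op u)).re
      + P.k * ∫ x, g x * ‖opR P u x‖ ^ 2 ∂((surf d).restrict P.ΓR) = 0 := by
    have h := congrArg (fun z => ((1 + Complex.I) * z).re) hform
    simp only [form, mul_sub, Finset.mul_sum, Complex.sub_re, Complex.re_sum, hb, mul_zero,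
      Complex.zero_re] at h
    linarith
  have hterm : ∀ i, coerc Λ * (if i ∈ M.layer j (m + 1) then 0 else hR.en X i u)
      - 4 * cutConst d * ((if i ∈ M.layer j m then 0 else hR.en X i u)
        - (if i ∈ M.layer j (m + 1) then 0 else hR.en X i u))
      ≤ ((1 + Complex.I) * hR.q X i u (hg.op u)).re := by
    intro i
    by_cases hi : i ∈ M.layer j m
    · have hi' : i ∈ M.layer j (m + 1) := M.layer_mono j (Nat.le_succ m) hi
      rw [if_pos hi, if_pos hi', hR.q_congr_right X u (w := 0)
        ((resK_cut_of_eq_zero hg (h0 i hi) u).trans (map_zero _).symm), hR.q_zero_right]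
      simp
    · by_cases hi' : i ∈ M.layer j (m + 1)
      -- Transition layer: the rotation by `1 + i` and `norm_q_le` contribute a factor 2 each, and
      -- `√(cutConst d) ≤ cutConst d`.
      · rw [if_neg hi, if_pos hi']
        have e1 := neg_two_mul_norm_le_re (hR.q X i u (hg.op u))
        have e2 := hR.norm_q_le X hΛ hgap hu hw i
        have e3 := hR.en_cut_le X hΛ hgap hg hu i
        have e4 := hR.en_nonneg X i u
        have e5 : √(hR.en X i u) * √(hR.en X i (hg.op u)) ≤ cutConst d * hR.en X i u := by
          rw [← Real.sqrt_mul e4]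
          refine Real.sqrt_le_iff.2 ⟨by positivity, ?_⟩
          have e6 : hR.en X i u * hR.en X i (hg.op u)
              ≤ hR.en X i u * (cutConst d * hR.en X i u) := mul_le_mul_of_nonneg_left e3 e4
          have e7 : hR.en X i u * (cutConst d * hR.en X i u)
              ≤ cutConst d * (hR.en X i u * (cutConst d * hR.en X i u)) :=
            le_mul_of_one_le_left (by positivity) hC
          linarith
        linarith
      · rw [if_neg hi, if_neg hi', hR.q_congr_right X u (resK_cut_of_eq_one hg (h1 i hi') u),
          sub_self, mul_zero, sub_zero, hR.q_self, add_mul, one_mul, Complex.add_re,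
          Complex.I_mul_re, Complex.ofReal_im, neg_zero, add_zero, ← hR.q_self X]
        exact hR.coerc_mul_en_le X hΛ hgap hu i
  have hall := Finset.sum_le_sum fun i (_ : i ∈ Finset.univ) => hterm i
  rw [Finset.sum_sub_distrib, ← Finset.mul_sum, ← Finset.mul_sum, Finset.sum_sub_distrib] at hall
  change coerc Λ * hR.far X j (m + 1) u - 4 * cutConst d * (hR.far X j m u
    - hR.far X j (m + 1) u) ≤ _ at hall
  linarith

/-- Hole filling: moving the subtracted `far` term of `caccioppoli` to the left gives `(4 * cutConst
d + coerc Λ) * far (m + 1) ≤ 4 * cutConst d * far m`, which explains `rate`. -/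
theorem far_le {j : Fin M.N} {u : Triple P.Ω P.Γ} (hu : u ∈ P.V)
    (horth : ∀ v ∈ P.V, hR.opP X j v = 0 → hR.form X u v = 0) (m : ℕ) :
    hR.far X j m u ≤ rate d Λ ^ m * ∑ i, hR.en X i u := by
  have hC := one_le_cutConst d
  have hc := coerc_pos hΛ
  induction m with
  | zero =>
    rw [pow_zero, one_mul]
    exact hR.far_le_sum_en X j 0 u
  | succ m ih =>
    obtain ⟨L, g, hg, h1, h0⟩ := M.exists_layer_cutoff P.lipschitz j m
    have hcac := hR.caccioppoli X hΛ hgap hg.one_sub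
      (fun i hi x hx => by rw [h1 i hi x hx, sub_self]) (fun i hi x hx => by rw [h0 i hi x hx, sub_zero]) hu horth
    have hpos : 0 ≤ P.k * ∫ x, (1 - g x) * ‖opR P u x‖ ^ 2 ∂((surf d).restrict P.ΓR) :=
      mul_nonneg P.k_pos.le (integral_nonneg fun x =>
        mul_nonneg (hg.one_sub.mem_Icc x).1 (sq_nonneg _))
    have hstep : hR.far X j (m + 1) u ≤ rate d Λ * hR.far X j m u := by
      rw [rate, div_mul_eq_mul_div, le_div_iff₀ (by linarith)]
      linarith
    calc hR.far X j (m + 1) u ≤ rate d Λ * hR.far X j m u := hstep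
      _ ≤ rate d Λ * (rate d Λ ^ m * ∑ i, hR.en X i u) :=
          mul_le_mul_of_nonneg_left ih (rate_pos d hΛ).le
      _ = _ := by ring

/-- Localization error of a single corrector. -/
theorem energy_sub_le {j : Fin M.N} {u w : Triple P.Ω P.Γ} (hu : u ∈ P.V)
    (horth : ∀ v ∈ P.V, hR.opP X j v = 0 → hR.form X u v = 0) (m : ℕ)
    (hw : w ∈ P.V0 (M.patch j (m + 1)))
    (hgal : ∀ v ∈ P.V0 (M.patch j (m + 1)), hR.form X (u - w) v = 0) :
    hR.energy X (u - w) ≤ 16 / coerc Λ ^ 2 * (5 * cutConst d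
      * (rate d Λ ^ m * ∑ i, hR.en X i u)) := by
  classical
  have hC := one_le_cutConst d
  have hc := coerc_pos hΛ
  obtain ⟨L, g, hg, h1, h0⟩ := M.exists_layer_cutoff P.lipschitz j m
  have h0' : ∀ i ∈ M.layer j m, ∀ x ∈ closedElem (M.vert i), 1 - g x = 0 :=
    fun i hi x hx => by rw [h1 i hi x hx, sub_self]
  have hcac := hR.caccioppoli X hΛ hgap hg.one_sub h0'
    (fun i hi x hx => by rw [h0 i hi x hx, sub_zero]) hu horth
  set r := hg.one_sub.op u with hr
  have hrV : r ∈ P.V := cut_mem_V hg.one_sub hu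
  have hyV : u - w ∈ P.V := P.V.sub_mem hu hw.1
  -- Céa's argument: `g u - w` lies in the local space and is removed by Galerkin orthogonality, so
  -- the error is controlled by the energy of `(1 - g) u`.
  have hdec : u - w = (hg.op u - w) + r := by
    rw [hr, sub_add_eq_add_sub, op_add_one_sub_op hg]
  have hform : hR.form X (u - w) (u - w) = hR.form X (u - w) r := by
    have h2 := hR.form_add_right X (u - w) (hg.op u - w) r
    rw [← hdec, hgal _ (Submodule.sub_mem _ (cut_mem_V0 hg h0 hu) hw), zero_add] at h2
    exact h2
  have hmain : coerc Λ * hR.energy X (u - w)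
      ≤ 4 * (√(hR.energy X (u - w)) * √(hR.energy X r)) := by
    have h2 := hR.coerc_mul_energy_le_norm X hΛ hgap hyV
    have h3 := hR.norm_form_le X hΛ hgap hyV hrV
    rw [hform] at h2
    linarith
  refine (le_of_mul_le_sqrt_mul_sqrt hc (hR.energy_nonneg X _) (hR.energy_nonneg X _) hmain).trans
    (mul_le_mul_of_nonneg_left ?_ (by positivity))
  -- The elements give `cutConst d * far m`; the boundary part is bounded by `caccioppoli` with `4 *
  -- cutConst d * far m`. This is the factor 5.
  have hen : ∑ i, hR.en X i r ≤ cutConst d * hR.far X j m u := by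
    rw [far, Finset.mul_sum]
    refine Finset.sum_le_sum fun i _ => ?_
    split_ifs with hi
    · rw [hR.en_congr X (v := 0) ((resK_cut_of_eq_zero hg.one_sub (h0' i hi) u).trans
        (map_zero _).symm), hR.en_zero, mul_zero]
    · exact hR.en_cut_le X hΛ hgap hg.one_sub hu i
  have hb : P.k * ‖opR P r‖ ^ 2
      ≤ P.k * ∫ x, (1 - g x) * ‖opR P u x‖ ^ 2 ∂((surf d).restrict P.ΓR) :=
    mul_le_mul_of_nonneg_left (norm_sq_opR_cut_le hg.one_sub u) P.k_pos.le
  have hf := hR.far_le X hΛ hgap hu horth m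
  have hn := hR.far_nonneg X j (m + 1) u
  have e1 : 0 ≤ coerc Λ * hR.far X j (m + 1) u := by positivity
  have e2 : 0 ≤ 4 * cutConst d * hR.far X j (m + 1) u := by positivity
  have e3 : 5 * cutConst d * hR.far X j m u
      ≤ 5 * cutConst d * (rate d Λ ^ m * ∑ i, hR.en X i u) :=
    mul_le_mul_of_nonneg_left hf (by positivity)
  rw [energy]
  linarith

end Resolved

end Helmholtz

/-! ### The sum of all localization errors. -/

namespace Helmholtz

variable {P : Helmholtz d} {M : QuadMesh d P.Ω} {W : ℝ}

namespace Resolved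

variable (hR : P.Resolved M W) (X : P.Aux M) {Λ : ℝ}

open Classical in
theorem _root_.CEM.QuadMesh.sum_ite_mem_layer {Ω : Set (E d)} (M : QuadMesh d Ω) (i : Fin M.N)
    (m : ℕ) : ∑ j, (if i ∈ M.layer j m then (1 : ℝ) else 0) = (M.layer i m).ncard := by
  simp only [M.mem_layer_comm (i := i)]
  rw [Finset.sum_boole, ncard_eq_toFinset_card']
  congr 2
  ext j
  simp

variable (hΛ : 1 / 2 < Λ) (hgap : ∀ j, Λ ≤ X.lam j (X.l j))
include hR hΛ hgap

/-- The energy of a sum of localization errors. -/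
theorem energy_sum_le {m : ℕ} {K : ℝ} (hK : ∀ i, ((M.layer i (m + 1)).ncard : ℝ) ≤ K)
    {u w : Fin M.N → Triple P.Ω P.Γ} (hu : ∀ j, u j ∈ P.V)
    (horth : ∀ j, ∀ v ∈ P.V, hR.opP X j v = 0 → hR.form X (u j) v = 0)
    (hw : ∀ j, w j ∈ P.V0 (M.patch j m)) :
    hR.energy X (∑ j, (u j - w j))
      ≤ 16 / coerc Λ ^ 2 * (cutConst d * K * ∑ j, hR.energy X (u j - w j)) := by
  classical
  have hC := one_le_cutConst d
  have hc := coerc_pos hΛ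
  set z := ∑ j, (u j - w j) with hz
  have hzj : ∀ j, u j - w j ∈ P.V := fun j => P.V.sub_mem (hu j) (hw j).1
  have hzV : z ∈ P.V := Submodule.sum_mem _ fun j _ => hzj j
  choose L g hg h1 h0 using fun j => M.exists_layer_cutoff P.lipschitz j m
  have h1' : ∀ j, ∀ i ∈ M.layer j m, ∀ x ∈ closedElem (M.vert i), 1 - g j x = 0 :=
    fun j i hi x hx => by rw [h1 j i hi x hx, sub_self]
  -- `(1 - g_j) z` vanishes on the first `m` layers: there is no interaction with `w j`, which lives
  -- in them, and its projection on `K_j` is zero, so `horth` applies to `u j`.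
  have hfar : ∀ j, hR.form X (u j - w j) ((hg j).one_sub.op z) = 0 := by
    intro j
    rw [form_sub_left, hR.form_eq_zero_of_mem_V0 X (hg j).one_sub (h1' j) (hw j) z, sub_zero]
    refine horth j _ (cut_mem_V (hg j).one_sub hzV) ?_
    rw [(hR.ops_eq_of_resK_eq X (v := 0) ((resK_cut_of_eq_zero (hg j).one_sub
      (h1' j j (M.self_mem_layer j m)) z).trans (map_zero _).symm)).2.2, map_zero]
  have hnear : ∀ j, hR.form X (u j - w j) z = hR.form X (u j - w j) ((hg j).op z) := by
    intro j
    have := hR.form_add_right X (u j - w j) ((hg j).op z) ((hg j).one_sub.op z)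
    rwa [op_add_one_sub_op, hfar, add_zero] at this
  set b : Fin M.N → ℝ := fun j => cutConst d * ∑ i, (if i ∈ M.layer j (m + 1) then 1 else 0)
    * hR.en X i z + P.k * ∫ x, g j x * ‖opR P z x‖ ^ 2 ∂((surf d).restrict P.ΓR) with hb
  have hcut : ∀ j, hR.energy X ((hg j).op z) ≤ b j := by
    intro j
    refine add_le_add ?_ (mul_le_mul_of_nonneg_left (norm_sq_opR_cut_le (hg j) z) P.k_pos.le)
    rw [Finset.mul_sum]
    refine Finset.sum_le_sum fun i _ => ?_
    split_ifs with hi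
    · rw [one_mul]
      exact hR.en_cut_le X hΛ hgap (hg j) hzV i
    · rw [hR.en_congr X (v := 0) ((resK_cut_of_eq_zero (hg j) (h0 j i hi) z).trans
        (map_zero _).symm), hR.en_zero, zero_mul, mul_zero]
  have hb0 : ∀ j, 0 ≤ b j := fun j => (hR.energy_nonneg X _).trans (hcut j)
  have hsum1 : ∑ j, ∑ i, (if i ∈ M.layer j (m + 1) then (1 : ℝ) else 0) * hR.en X i z
      ≤ K * ∑ i, hR.en X i z := by
    -- For a fixed element `i`, the number of `j` whose `m + 1` layers contain `i` is the number of
    -- elements in the `m + 1` layers around `i`.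
    rw [Finset.sum_comm, Finset.mul_sum]
    refine Finset.sum_le_sum fun i _ => ?_
    rw [← Finset.sum_mul, M.sum_ite_mem_layer]
    exact mul_le_mul_of_nonneg_right (hK i) (hR.en_nonneg X i z)
  have hsum2 : ∑ j, ∫ x, g j x * ‖opR P z x‖ ^ 2 ∂((surf d).restrict P.ΓR)
      ≤ K * ‖opR P z‖ ^ 2 := by
    rw [← integral_finsetSum _ fun j _ => integrable_cut_trace (hg j) z, norm_sq_Lp,
      ← integral_const_mul]
    refine integral_mono_ae (integrable_finsetSum _ fun j _ => integrable_cut_trace (hg j) z)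
      ((integrable_norm_sq_Lp _).const_mul K) ?_
    -- A boundary point may lie in several closed elements; fixing one of them, `i`, suffices, since
    -- `g_j` vanishes there unless `i` belongs to the `m + 1` layers of `j`.
    filter_upwards [ae_mem_closedElem_ΓR M] with x ⟨i, hi⟩
    rw [← Finset.sum_mul]
    refine mul_le_mul_of_nonneg_right (le_trans ?_ (hK i)) (sq_nonneg _)
    rw [← M.sum_ite_mem_layer]
    refine Finset.sum_le_sum fun j _ => ?_
    split_ifs with hij
    · exact ((hg j).mem_Icc x).2
    · exact (h0 j i hij x hi).le
  have hbsum : ∑ j, b j ≤ cutConst d * K * hR.energy X z := by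
    rw [hb, Finset.sum_add_distrib, ← Finset.mul_sum, ← Finset.mul_sum, energy]
    have e1 := mul_le_mul_of_nonneg_left hsum1 (zero_le_one.trans hC)
    have e2 := mul_le_mul_of_nonneg_left hsum2 P.k_pos.le
    have e3 : 0 ≤ ∑ j, ∫ x, g j x * ‖opR P z x‖ ^ 2 ∂((surf d).restrict P.ΓR) :=
      Finset.sum_nonneg fun j _ => integral_nonneg fun x =>
        mul_nonneg ((hg j).mem_Icc x).1 (sq_nonneg _)
    have e4 : 0 ≤ P.k * (K * ‖opR P z‖ ^ 2) := mul_nonneg P.k_pos.le (e3.trans hsum2)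
    have e5 := le_mul_of_one_le_left e4 hC
    linarith
  have hES : 0 ≤ ∑ j, hR.energy X (u j - w j) :=
    Finset.sum_nonneg fun j _ => hR.energy_nonneg X _
  have hEz := hR.energy_nonneg X z
  have hKC : 0 ≤ ∑ j, b j := Finset.sum_nonneg fun j _ => hb0 j
  have hzz : hR.form X z z = ∑ j, hR.form X (u j - w j) ((hg j).op z) := by
    refine Eq.trans ?_ (Finset.sum_congr rfl fun j _ => hnear j)
    rw [← hR.form_sum_left X]
  clear_value z b
  have hform1 : ∀ j, ‖hR.form X (u j - w j) ((hg j).op z)‖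
      ≤ 2 * (√(hR.energy X (u j - w j)) * √(b j)) := fun j =>
    (hR.norm_form_le X hΛ hgap (hzj j) (cut_mem_V (hg j) hzV)).trans
      (mul_le_mul_of_nonneg_left (mul_le_mul_of_nonneg_left (Real.sqrt_le_sqrt (hcut j))
        (Real.sqrt_nonneg _)) two_pos.le)
  have hform : ‖hR.form X z z‖
      ≤ 2 * (√(∑ j, hR.energy X (u j - w j)) * √(∑ j, b j)) := by
    rw [hzz]
    refine (norm_sum_le _ _).trans ((Finset.sum_le_sum fun j _ => hform1 j).trans ?_)
    rw [← Finset.mul_sum]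
    exact mul_le_mul_of_nonneg_left (Real.sum_sqrt_mul_sqrt_le _
      (fun j => hR.energy_nonneg X _) hb0) two_pos.le
  -- `0 ≤ K` is read off from the count at some element; for an empty mesh both sides are zero.
  by_cases hN : Nonempty (Fin M.N)
  · have hK0 : 0 ≤ K := (Nat.cast_nonneg _).trans (hK hN.some)
    refine le_of_mul_le_sqrt_mul_sqrt hc hEz
      (mul_nonneg (mul_nonneg (zero_le_one.trans hC) hK0) hES) ?_
    have h2 := hR.coerc_mul_energy_le_norm X hΛ hgap hzV
    have h3 : √(∑ j, hR.energy X (u j - w j)) * √(∑ j, b j)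
        ≤ √(hR.energy X z) * √(cutConst d * K * ∑ j, hR.energy X (u j - w j)) := by
      rw [← Real.sqrt_mul hES, ← Real.sqrt_mul hEz]
      refine Real.sqrt_le_sqrt ?_
      have := mul_le_mul_of_nonneg_left hbsum hES
      linarith
    linarith
  · have : IsEmpty (Fin M.N) := not_nonempty_iff.1 hN
    have hz0 : z = 0 := by rw [hz, Finset.univ_eq_empty, Finset.sum_empty]
    have hS0 : ∑ j, hR.energy X (u j - w j) = 0 := by
      rw [Finset.univ_eq_empty, Finset.sum_empty]
    rw [hS0, hz0, energy]
    simp [en]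

/-- The constant in the localization estimate. -/
def _root_.CEM.locConst (d : ℕ) (Λ : ℝ) : ℝ :=
  16 / coerc Λ ^ 2 * (cutConst d * (16 / coerc Λ ^ 2 * (5 * cutConst d
    * ((rate d Λ)⁻¹ * (coerc Λ)⁻¹))))

omit hR hgap in
theorem _root_.CEM.locConst_pos (d : ℕ) : 0 < locConst d Λ := by
  have hC := one_le_cutConst d
  have hc := coerc_pos hΛ
  have hr := rate_pos d hΛ
  rw [locConst]
  positivity

theorem T_spec (j : Fin M.N) (t : Lp ℂ 2 (volume.restrict P.Ω)) :
    P.T X j t ∈ P.V ∧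
      ∀ v ∈ P.V, hR.form X (P.T X j t) v = inner ℂ (hR.opP X j v) (hR.dat X j t) :=
  (hR.isCorrector_iff X P.V j t _).1
    (hR.isCorrector_corrector X hΛ hgap le_rfl P.isClosed_V j t)

theorem Tloc_spec (j : Fin M.N) (m : ℕ) (t : Lp ℂ 2 (volume.restrict P.Ω)) :
    P.Tloc X j m t ∈ P.V0 (M.patch j m) ∧ ∀ v ∈ P.V0 (M.patch j m),
      hR.form X (P.Tloc X j m t) v = inner ℂ (hR.opP X j v) (hR.dat X j t) :=
  (hR.isCorrector_iff X _ j t _).1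
    (hR.isCorrector_corrector X hΛ hgap (P.V0_le_V _) (P.isClosed_V0 _) j t)

theorem localization {Col : ℝ} (hcard : ∀ j, ∀ m : ℕ, 1 ≤ m →
      (Nat.card {i : Fin M.N // M.K i ⊆ M.patch j m} : ℝ) ≤ Col * (m : ℝ) ^ d)
    {m : ℕ} (hm : 1 ≤ m) (t : Fin M.N → Lp ℂ 2 (volume.restrict P.Ω)) :
    P.aNormSq (∑ j, (P.T X j (t j) - P.Tloc X j m (t j)))
        + P.sNormSq M (P.proj X (∑ j, (P.T X j (t j) - P.Tloc X j m (t j))).1)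
      ≤ locConst d Λ * Col * rate d Λ ^ m * ((m : ℝ) + 1) ^ d *
        (∑ j, P.sForm M P.Ω (P.projLoc X j (t j)) (P.proj X (P.T X j (t j)).1)).re := by
  have hC := one_le_cutConst d
  have hc := coerc_pos hΛ
  have hr := rate_pos d hΛ
  have hT := fun j => hR.T_spec X hΛ hgap j (t j)
  have hTl := fun j => hR.Tloc_spec X hΛ hgap j m (t j)
  have horth : ∀ j, ∀ v ∈ P.V, hR.opP X j v = 0 → hR.form X (P.T X j (t j)) v = 0 :=
    fun j v hv h => by rw [(hT j).2 v hv, h, inner_zero_left]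
  -- The cutoff of `T_j t` is one on `n = m - 1` layers, so that its transition layer still lies in
  -- the patch. The lost factor is the `(rate d Λ)⁻¹` in `locConst`.
  obtain ⟨n, rfl⟩ : ∃ n, m = n + 1 := ⟨m - 1, by omega⟩
  have hdata : ∀ j, P.sForm M P.Ω (P.projLoc X j (t j)) (P.proj X (P.T X j (t j)).1)
      = hR.form X (P.T X j (t j)) (P.T X j (t j)) := by
    intro j
    rw [hR.sForm_projLoc_proj, (hT j).2 _ (hT j).1]
    rfl
  -- The overlap assumption is used with `m + 1` layers, the support of the cutoffs of `z`; hence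
  -- `(m + 1) ^ d`.
  have hK : ∀ i, ((M.layer i (n + 1 + 1)).ncard : ℝ) ≤ Col * (((n + 1 : ℕ) : ℝ) + 1) ^ d := by
    intro i
    rw [← M.card_layer]
    have := hcard i (n + 1 + 1) (by omega)
    push_cast at this ⊢
    exact this
  have hsingle : ∀ j, hR.energy X (P.T X j (t j) - P.Tloc X j (n + 1) (t j))
      ≤ 16 / coerc Λ ^ 2 * (5 * cutConst d * (rate d Λ ^ n * ((coerc Λ)⁻¹
        * (P.sForm M P.Ω (P.projLoc X j (t j)) (P.proj X (P.T X j (t j)).1)).re))) := by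
    intro j
    refine (hR.energy_sub_le X hΛ hgap (hT j).1 (horth j) n (hTl j).1 fun v hv => ?_).trans ?_
    · rw [form_sub_left, (hTl j).2 v hv, (hT j).2 v (P.V0_le_V _ hv), sub_self]
    · have h1 := hR.coerc_mul_sum_en_le X hΛ hgap (hT j).1
      rw [← hdata] at h1
      have h2 : ∑ i, hR.en X i (P.T X j (t j)) ≤ (coerc Λ)⁻¹
          * (P.sForm M P.Ω (P.projLoc X j (t j)) (P.proj X (P.T X j (t j)).1)).re := by
        rw [inv_mul_eq_div, le_div_iff₀ hc, mul_comm]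
        exact h1
      gcongr
  have hall := hR.energy_sum_le X hΛ hgap hK (fun j => (hT j).1) horth fun j => (hTl j).1
  rw [hR.aNormSq_add_sNormSq]
  refine (le_add_of_nonneg_right (boundary_nonneg _)).trans (hall.trans ?_)
  by_cases hN : Nonempty (Fin M.N)
  · have hK0 : 0 ≤ Col * (((n + 1 : ℕ) : ℝ) + 1) ^ d := (Nat.cast_nonneg _).trans (hK hN.some)
    have hs := Finset.sum_le_sum fun j (_ : j ∈ Finset.univ) => hsingle j
    simp only [← Finset.mul_sum] at hs
    calc 16 / coerc Λ ^ 2 * (cutConst d * (Col * (((n + 1 : ℕ) : ℝ) + 1) ^ d)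
          * ∑ j, hR.energy X (P.T X j (t j) - P.Tloc X j (n + 1) (t j)))
        ≤ 16 / coerc Λ ^ 2 * (cutConst d * (Col * (((n + 1 : ℕ) : ℝ) + 1) ^ d)
          * (16 / coerc Λ ^ 2 * (5 * cutConst d * (rate d Λ ^ n * ((coerc Λ)⁻¹
          * ∑ j, (P.sForm M P.Ω (P.projLoc X j (t j)) (P.proj X (P.T X j (t j)).1)).re))))) := by
          refine mul_le_mul_of_nonneg_left (mul_le_mul_of_nonneg_left hs ?_) (by positivity)
          exact mul_nonneg (zero_le_one.trans hC) hK0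
      _ = _ := by
          rw [locConst, Complex.re_sum]
          field_simp
          ring
  · have : IsEmpty (Fin M.N) := not_nonempty_iff.1 hN
    simp

/-- The data of `t` on an element vanish if `π t` is supported in another one. -/
theorem T_eq_zero {i j : Fin M.N} (hij : i ≠ j) {t : Lp ℂ 2 (volume.restrict P.Ω)}
    (ht : P.proj X t =ᵐ[volume.restrict P.Ω] P.projLoc X j t) : P.T X i t = 0 := by
  have hdat : hR.dat X i t = 0 := by
    -- `s(πt, πt)` is the sum of squares over all elements and, by the hypothesis, the `j`-th square
    -- alone; the other squares vanish.
    have h1 := hR.sForm_proj_proj X t t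
    rw [sForm_congr ht (Filter.EventuallyEq.refl _ _), hR.sForm_projLoc_proj] at h1
    simp only [inner_self_eq_norm_sq_to_K] at h1
    have h2 : ‖hR.dat X j t‖ ^ 2 = ∑ l, ‖hR.dat X l t‖ ^ 2 := by exact_mod_cast h1
    rw [← Finset.add_sum_erase _ _ (Finset.mem_univ j), left_eq_add] at h2
    have h3 := (Finset.sum_eq_zero_iff_of_nonneg fun l _ => sq_nonneg _).1 h2 i
      (Finset.mem_erase.2 ⟨hij, Finset.mem_univ i⟩)
    exact norm_eq_zero.1 (pow_eq_zero_iff two_ne_zero |>.1 h3)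
  have hT := hR.T_spec X hΛ hgap i t
  refine hR.eq_zero_of_form_eq_zero X hΛ hgap hT.1 ?_
  rw [hT.2 _ hT.1, hdat, inner_zero_right]

theorem sForm_Tsum {j : Fin M.N} {t : Lp ℂ 2 (volume.restrict P.Ω)}
    (ht : P.proj X t =ᵐ[volume.restrict P.Ω] P.projLoc X j t) :
    P.sForm M P.Ω (P.proj X t) (P.proj X (P.Tsum X t).1)
      = P.sForm M P.Ω (P.projLoc X j t) (P.proj X (P.T X j t).1) := by
  have h : P.Tsum X t = P.T X j t :=
    Finset.sum_eq_single j (fun i _ hij => hR.T_eq_zero X hΛ hgap hij ht) (by simp)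
  rw [h]
  exact sForm_congr ht (Filter.EventuallyEq.refl _ _)

end Resolved

/-- The resolution condition squared reads `2 c_* k² H² ≤ ε²`, which turns the lower bound on `Ã`
into `2k² ≤ Ã`. -/
theorem resolved_of_bounds {H cstar : ℝ} (hH : 0 < H) (hcs : 0 < cstar)
    (hwt : ∀ j, ∀ x ∈ M.K j, cstar⁻¹ * (H ^ 2)⁻¹ * min 1 (P.ε ^ 2) ≤ P.wt M x ∧
      P.wt M x ≤ cstar * (H ^ 2)⁻¹ * max 1 (P.ε ^ 2))
    (hres : Real.sqrt (2 * cstar) * P.k * H * P.ε⁻¹ ≤ 1) :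
    P.Resolved M (cstar * (H ^ 2)⁻¹ * max 1 (P.ε ^ 2)) where
  upper j x hx := (hwt j x hx).2
  lower j x hx := by
    have hk := P.k_pos
    have hε := P.ε_pos
    refine le_trans ?_ (hwt j x hx).1
    have h1 : P.ε ^ 2 ≤ 1 := pow_le_one₀ hε.le P.ε_lt_one.le
    have h2 : (Real.sqrt (2 * cstar) * P.k * H * P.ε⁻¹) ^ 2 ≤ 1 :=
      pow_le_one₀ (by positivity) hres
    rw [mul_pow, mul_pow, mul_pow, Real.sq_sqrt (by positivity), inv_pow, ← div_eq_mul_inv,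
      div_le_one (by positivity)] at h2
    rw [min_eq_right h1, ← mul_inv, inv_mul_eq_div, le_div_iff₀ (by positivity)]
    linarith

end Helmholtz

end CEM

end

/-! ### The global localization estimate. -/

theorem mainTheorem6 (d : ℕ) (hd : d = 2 ∨ d = 3) (Λ : ℝ) (hΛ : 1 / 2 < Λ) :
    ∃ C β : ℝ, 0 < C ∧ 0 < β ∧ β < 1 ∧
      ∀ (P : CEM.Helmholtz d) (M : CEM.QuadMesh d P.Ω) (X : P.Aux M) (H cstar Col : ℝ),
        0 < H → (∀ j, Metric.diam (M.K j) ≤ H) →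
        0 < cstar →
        (∀ j, ∀ x ∈ M.K j,
          cstar⁻¹ * (H ^ 2)⁻¹ * min 1 (P.ε ^ 2) ≤ P.wt M x ∧
            P.wt M x ≤ cstar * (H ^ 2)⁻¹ * max 1 (P.ε ^ 2)) →
        Real.sqrt (2 * cstar) * P.k * H * P.ε⁻¹ ≤ 1 →
        (∀ j, Λ ≤ X.lam j (X.l j)) →
        (∀ j, ∀ m : ℕ, 1 ≤ m →
          (Nat.card {i : Fin M.N // M.K i ⊆ M.patch j m} : ℝ) ≤ Col * (m : ℝ) ^ d) →
        (∀ j, ∀ t : MeasureTheory.Lp ℂ 2 (MeasureTheory.volume.restrict P.Ω),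
          (∃! u, P.IsCorrector X P.V j t u) ∧
            ∀ m : ℕ, 1 ≤ m → ∃! u, P.IsCorrector X (P.V0 (M.patch j m)) j t u) ∧
        ∀ (m : ℕ), 1 ≤ m →
          ∀ t : Fin M.N → MeasureTheory.Lp ℂ 2 (MeasureTheory.volume.restrict P.Ω),
            (P.aNormSq (∑ j, (P.T X j (t j) - P.Tloc X j m (t j)))
                + P.sNormSq M (P.proj X (∑ j, (P.T X j (t j) - P.Tloc X j m (t j))).1)
              ≤ C ^ 2 * Col * β ^ m * ((m : ℝ) + 1) ^ d *
                (∑ j, P.sForm M P.Ω (P.projLoc X j (t j)) (P.proj X (P.T X j (t j)).1)).re) ∧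
            ((∀ j, P.proj X (t j) =ᵐ[MeasureTheory.volume.restrict P.Ω] P.projLoc X j (t j)) →
              P.aNormSq (∑ j, (P.T X j (t j) - P.Tloc X j m (t j)))
                + P.sNormSq M (P.proj X (∑ j, (P.T X j (t j) - P.Tloc X j m (t j))).1)
              ≤ C ^ 2 * Col * β ^ m * ((m : ℝ) + 1) ^ d *
                (∑ j, P.sForm M P.Ω (P.proj X (t j)) (P.proj X (P.Tsum X (t j)).1)).re) := by
  -- The square root appears because `C` enters squared. Both witnesses are explicit in `d` and `Λ`.
  refine ⟨Real.sqrt (CEM.locConst d Λ), CEM.rate d Λ,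
    Real.sqrt_pos.2 (CEM.locConst_pos hΛ d), CEM.rate_pos d hΛ, CEM.rate_lt_one d hΛ, ?_⟩
  intro P M X H cstar Col hH _ hcs hwt hres hgap hcard
  have hR := CEM.Helmholtz.resolved_of_bounds hH hcs hwt hres
  refine ⟨fun j t => ⟨hR.existsUnique_isCorrector X hΛ hgap le_rfl P.isClosed_V j t,
    fun m _ => hR.existsUnique_isCorrector X hΛ hgap (P.V0_le_V _) (P.isClosed_V0 _) j t⟩, ?_⟩
  intro m hm t
  rw [Real.sq_sqrt (CEM.locConst_pos hΛ d).le]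
  have hloc := hR.localization X hΛ hgap hcard hm t
  refine ⟨hloc, fun ht => ?_⟩
  rw [Finset.sum_congr rfl fun j _ => hR.sForm_Tsum X hΛ hgap (ht j)]
  exact hloc
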